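/- **Setting.** Let $m,T\ge 1$ and $n\ge 0$ be integers, let $f,F:\mathbb R^m\times\mathbb R^n\to\mathbb R$, and let $\mathcal S(x)=\operatorname{argmin}_{y\in\mathbb R^n}f(x,y)$. A function is called $L$-smooth if it is differentiable with $L$-Lipschitz gradient. Assume: * $f$ is $L_f$-smooth and twice differentiable, and $\|\nabla\nabla_y f(x_1,y_1)-\nabla\nabla_y f(x_2,y_2)\|\le H_f(\|x_1-x_2\|+\|y_1-y_2\|)$ for all $x_i,y_i$ (operator norm); * $\mathcal S(x)$ is nonempty, closed and convex for every $x$; * there is $\tau>0$ with $\operatorname{dist}(y,\mathcal S(x))\le\tau\|\nabla_yf(x,y)\|$ for all $x,y$; * $F$ is $M_F$-Lipschitz and $L_F$-smooth. Let $\varphi_o(x)=\inf_{y\in\mathcal S(x)}F(x,y)$ and $\varphi_p(x)=\sup_{y\in\mathcal S(x)}F(x,y)$, and assume in the optimistic case that $\varphi_o(x^\star)>-\infty$ for some $x^\star$, in the pessimistic case that $\varphi_p(x^\star)<+\infty$ for some $x^\star$. Put $M_\varphi=M_F(1+L_f\tau)$, $L_{\mathcal S}=\max\{2H_f\tau(1+9L_f^2\tau^2),\,4L_f^2\tau^2\}$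 and $\rho=M_FL_{\mathcal S}+L_F(1+L_{\mathcal S})$. For Lipschitz $g:\mathbb R^m\to\mathbb R$, the Clarke subdifferential $\partial g(x)$ is the convex hull of all limits $\lim_k\nabla g(x_k)$ with $x_k\to x$ and $g$ differentiable at each $x_k$; $\mathbb B(x,\delta)$ is the closed ball; $g_\gamma(x)=\inf_z\{g(z)+\frac1{2\gamma}\|x-z\|^2\}$ is the Moreau envelope. **Algorithm.** Let $\varphi\in\{\varphi_o,\varphi_p\}$ and let $A:\mathbb R^m\to\mathbb R$ be a (deterministic, measurable) function with $|A(x)-\varphi(x)|\le w$ for all $x$. From $x_0\in\mathbb R^m$ the inexact zeroth-order method computes, for $t=0,\dots,T-1$, $$x_{t+1}=x_t-\eta\,\frac{m}{2\varepsilon}\bigl(A(x_t+\varepsilon u_t)-A(x_t-\varepsilon u_t)\bigr)u_t ,$$ where $u_0,\dots,u_{T-1}$ are independent and uniformly distributed on the unit sphere of $\mathbb R^m$, and returns $\bar x=x_R$, where $R$ is uniform on $\{0,\dots,T-1\}$ and independent of $(u_t)$. **Parameters.** For fixed constants $c_\eta>0$ and $C_\eta,C_\varepsilon,C_w,C_r$,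 let $c_\eta (mT)^{-1/2}\le\eta\le C_\eta (mT)^{-1/2}$, $0<\varepsilon\le C_\varepsilon T^{-1/2}$, $0<w\le C_wm^{-3/4}T^{-3/4}$ and $w/\varepsilon\le C_rm^{-3/4}T^{-1/4}$. (The last condition follows from the bound on $w$, with another constant, if $\varepsilon$ is of exact order $T^{-1/2}$.) **Theorem.** (i) *Optimistic case.* There are constants $K,C$ depending only on $L_f,H_f,\tau,M_F,L_F,c_\eta,C_\eta,C_\varepsilon,C_w,C_r$ (not on $m,n,T,f,F,A,x_0$) such that, if $\varphi_o$ is bounded below, then, with $\Delta_o=\varphi_o(x_0)-\inf\varphi_o+2M_\varphi\varepsilon$, there is $\delta$ with $0\le\delta\le KT^{-1/4}$, chosen independently of $A$, $x_0$ and the run, such that $$\mathbb E\Bigl[\operatorname{dist}\Bigl(0,\bigcup_{z\in\mathbb B(\bar x,\delta)}\partial\varphi_o(z)\Bigr)^2\Bigr]\le C\,\frac{\sqrt m\,(\Delta_o+1)}{\sqrt T}.$$ (ii) *Pessimistic case.* For every $\gamma\in(0,\frac1{\rho+1})$ there is a constant $C$ depending only on $\gamma$ and the constants listed in (i) such that the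 Moreau envelope $\varphi_{p,\gamma}$ of $\varphi_p$ is differentiable and, if it is bounded below, then, with $\Delta_p=\varphi_{p,\gamma}(x_0)-\inf\varphi_{p,\gamma}$, $$\mathbb E\bigl[\|\nabla\varphi_{p,\gamma}(\bar x)\|^2\bigr]\le C\,\frac{\sqrt m\,(\Delta_p+1)}{\sqrt T}.$$ -/

import Mathlib

open MeasureTheory ProbabilityTheory Filter Topology
open scoped NNReal ENNReal Gradient

noncomputable section

namespace Bilevel

/-- Euclidean space `ℝ^k`. -/
abbrev Vec (k : ℕ) := EuclideanSpace ℝ (Fin k)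

/-- `ℝ^m × ℝ^n` with the Euclidean norm of the joint variable `(x, y)`. -/
abbrev Joint (m n : ℕ) := WithLp 2 (Vec m × Vec n)

/-- The pair `(x, y)` as a joint variable. -/
abbrev pair {m n : ℕ} (x : Vec m) (y : Vec n) : Joint m n := WithLp.toLp 2 (x, y)

/-- A function is `L`-smooth: differentiable with `L`-Lipschitz gradient. -/
structure IsSmooth {E : Type*} [NormedAddCommGroup E] [InnerProductSpace ℝ E] [CompleteSpace E]
    (L : ℝ≥0) (g : E → ℝ) : Prop where
  differentiable : Differentiable ℝ g
  lipschitz_gradient : LipschitzWith L (∇ g)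

/-- The partial gradient `∇_y f` at `p = (x, y)`. -/
def gradY {m n : ℕ} (f : Joint m n → ℝ) (p : Joint m n) : Vec n :=
  ∇ (fun y : Vec n => f (pair p.fst y)) p.snd

/-- The lower-level solution set `S(x) = argmin_y f(x, y)`. -/
def solSet {m n : ℕ} (f : Joint m n → ℝ) (x : Vec m) : Set (Vec n) :=
  {y | ∀ y' : Vec n, f (pair x y) ≤ f (pair x y')}

/-- The values of the upper-level function on the lower-level solutions at `x`. -/
def upperValues {m n : ℕ} (f F : Joint m n → ℝ) (x : Vec m) : Set ℝ :=
  (fun y => F (pair x y)) '' solSet f x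

/-- The optimistic hyper-objective. -/
def phiO {m n : ℕ} (f F : Joint m n → ℝ) (x : Vec m) : ℝ := sInf (upperValues f F x)

/-- The pessimistic hyper-objective. -/
def phiP {m n : ℕ} (f F : Joint m n → ℝ) (x : Vec m) : ℝ := sSup (upperValues f F x)

/-- Assumptions on the lower-level function: smoothness, Lipschitz continuity of `∇∇_y f`
(in operator norm), nonempty closed convex solution sets, and the uniform error bound. -/
structure LowerLevel {m n : ℕ} (Lf Hf : ℝ≥0) (τ : ℝ) (f : Joint m n → ℝ) : Prop where
  smooth : IsSmooth Lf f
  twice_differentiable : Differentiable ℝ (∇ f)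
  lipschitz_hessian : ∀ p q : Joint m n,
    ‖fderiv ℝ (gradY f) p - fderiv ℝ (gradY f) q‖
      ≤ Hf * (‖p.fst - q.fst‖ + ‖p.snd - q.snd‖)
  sol_nonempty : ∀ x, (solSet f x).Nonempty
  sol_closed : ∀ x, IsClosed (solSet f x)
  sol_convex : ∀ x, Convex ℝ (solSet f x)
  tau_pos : 0 < τ
  error_bound : ∀ (x : Vec m) (y : Vec n),
    Metric.infDist y (solSet f x) ≤ τ * ‖gradY f (pair x y)‖

/-- Assumptions on the upper-level function. -/
structure UpperLevel {m n : ℕ} (MF LF : ℝ≥0) (F : Joint m n → ℝ) : Prop where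
  lipschitz : LipschitzWith MF F
  smooth : IsSmooth LF F

/-- The Lipschitz modulus `M_F (1 + L_f τ)` of the hyper-objectives. -/
def Mphi (Lf MF : ℝ≥0) (τ : ℝ) : ℝ := MF * (1 + Lf * τ)

/-- The set-smoothness modulus of the solution map. -/
def LS (Lf Hf : ℝ≥0) (τ : ℝ) : ℝ :=
  max (2 * Hf * τ * (1 + 9 * (Lf : ℝ) ^ 2 * τ ^ 2)) (4 * (Lf : ℝ) ^ 2 * τ ^ 2)

/-- The weak convexity/concavity modulus of the hyper-objectives. -/
def rho (Lf Hf MF LF : ℝ≥0) (τ : ℝ) : ℝ := MF * LS Lf Hf τ + LF * (1 + LS Lf Hf τ)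

/-- The Clarke subdifferential: convex hull of all limits of gradients at nearby points of
differentiability. -/
def clarke {m : ℕ} (g : Vec m → ℝ) (x : Vec m) : Set (Vec m) :=
  convexHull ℝ {s | ∃ z : ℕ → Vec m, Tendsto z atTop (𝓝 x) ∧
    (∀ k, DifferentiableAt ℝ g (z k)) ∧ Tendsto (fun k => ∇ g (z k)) atTop (𝓝 s)}

/-- The union of the Clarke subdifferentials over the closed ball of radius `δ` around `x`. -/
def clarkeBall {m : ℕ} (g : Vec m → ℝ) (δ : ℝ) (x : Vec m) : Set (Vec m) :=
  ⋃ z ∈ Metric.closedBall x δ, clarke g z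

/-- The Moreau envelope `g_γ`. -/
def moreau {m : ℕ} (γ : ℝ) (g : Vec m → ℝ) (x : Vec m) : ℝ :=
  ⨅ z : Vec m, (g z + 1 / (2 * γ) * ‖x - z‖ ^ 2)

/-- The uniform distribution on the unit sphere, as a measure on `ℝ^m`: the push-forward of
the normalized surface measure. -/
def sphereUniform (m : ℕ) : Measure (Vec m) :=
  ((((volume : Measure (Vec m)).toSphere Set.univ)⁻¹ •
    (volume : Measure (Vec m)).toSphere)).map Subtype.val

/-- The inexact two-point gradient estimator at `x` in direction `u`, where `A` returns the
(approximate) function values. -/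
def estimator {m : ℕ} (A : Vec m → ℝ) (ε : ℝ) (x u : Vec m) : Vec m :=
  ((m : ℝ) / (2 * ε) * (A (x + ε • u) - A (x - ε • u))) • u

/-- The iterates `x_0, ..., x_T` of the inexact zeroth-order method with sampled directions
`u_0, ..., u_{T-1}` (constant after time `T`). -/
def iterate {m T : ℕ} (A : Vec m → ℝ) (η ε : ℝ) (x₀ : Vec m) (u : Fin T → Vec m) : ℕ → Vec m
  | 0 => x₀
  | t + 1 =>
    if h : t < T then
      iterate A η ε x₀ u t - η • estimator A ε (iterate A η ε x₀ u t) (u ⟨t, h⟩)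
    else iterate A η ε x₀ u t

/-- The random inputs of the method: independent directions `u_t`, uniform on the unit sphere,
and an independent output index `R`, uniform on `{0, ..., T-1}`. -/
structure IsSampling {m T : ℕ} {Ω : Type*} [MeasurableSpace Ω] (P : Measure Ω)
    (u : Fin T → Ω → Vec m) (R : Ω → Fin T) : Prop where
  measurable_dir : ∀ t, Measurable (u t)
  law_dir : ∀ t, P.map (u t) = sphereUniform m
  indep_dir : iIndepFun u P
  measurable_index : Measurable R
  law_index : ∀ t, P (R ⁻¹' {t}) = (T : ℝ≥0∞)⁻¹
  indep_index : IndepFun (fun ω t => u t ω) R P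

/-- The output of the method: the iterate with the random index. -/
def output {m T : ℕ} {Ω : Type*} (A : Vec m → ℝ) (η ε : ℝ) (x₀ : Vec m)
    (u : Fin T → Ω → Vec m) (R : Ω → Fin T) (ω : Ω) : Vec m :=
  iterate A η ε x₀ (fun t => u t ω) (R ω)

/-- `A` is a (deterministic, measurable) evaluation subroutine for `φ` with accuracy `w`. -/
structure IsSubroutine {m : ℕ} (φ : Vec m → ℝ) (w : ℝ) (A : Vec m → ℝ) : Prop where
  measurable : Measurable A
  accurate : ∀ x, |A x - φ x| ≤ w

/-- The parameter choice `η = Θ(m^{-1/2} T^{-1/2})`, `ε = O(T^{-1/2})`,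
`w = O(m^{-3/4} T^{-3/4})`. The evaluation error is of the required order relative to the
radius too, `w / ε = O(m^{-3/4} T^{-1/4})`; this last condition is automatic (with another
constant) when `ε` is of exact order `T^{-1/2}`. -/
structure IsParameterChoice (cη Cη Cε Cw Cr : ℝ) (m T : ℕ) (η ε w : ℝ) : Prop where
  step_lower : cη * ((m : ℝ) ^ (-(1 / 2) : ℝ) * (T : ℝ) ^ (-(1 / 2) : ℝ)) ≤ η
  step_upper : η ≤ Cη * ((m : ℝ) ^ (-(1 / 2) : ℝ) * (T : ℝ) ^ (-(1 / 2) : ℝ))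
  radius_pos : 0 < ε
  radius_upper : ε ≤ Cε * (T : ℝ) ^ (-(1 / 2) : ℝ)
  error_pos : 0 < w
  error_upper : w ≤ Cw * ((m : ℝ) ^ (-(3 / 4) : ℝ) * (T : ℝ) ^ (-(3 / 4) : ℝ))
  error_radius : w / ε ≤ Cr * ((m : ℝ) ^ (-(3 / 4) : ℝ) * (T : ℝ) ^ (-(1 / 4) : ℝ))

end Bilevel

end

/-
Interpolating between minimizers: if `y` minimizes `f(x, ·)` at an intermediate point `x` of the
segment from `x₂` to `x₁`, the error bound gives a minimizer `y₂` near `y` at `x₂`, and at the point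
`z` of the line through `y₂` and `y` lying over `x₁` the Lipschitz Hessian leaves a residual
`∇_y f(x₁, z)` of second order in `‖x₁ - x₂‖`, so the error bound gives a minimizer at `x₁` at
second-order distance from `z`. Hence `φ_p` is `ρ`-weakly convex and, replacing `F` by `-F`, `φ_o`
is `ρ`-weakly concave; both are `M_φ`-Lipschitz.

By the divergence theorem on the ball, the exact two-point estimator averages to the gradient of
the ball smoothing of `φ`. Its second moment is `O(m M_φ²)` rather than `O(m² M_φ²)`: an odd
Lipschitz function on the sphere has variance `O(1/m)`. This follows from the Gaussian Poincaré
inequality (Pisier's rotation argument, with constant `π²/8`) applied to the homogeneous extension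
of the function.

In the optimistic case the smoothing of `φ_o` itself is the Lyapunov function, since weak concavity
bounds its curvature from above independently of `ε`. A small gradient `g` of the smoothing at `x`
is turned into a Clarke subgradient by minimizing `-φ_o + ⟨g, ·⟩ + (ρ+1)/2 ‖· - x‖²`: the minimizer
lies within `2 √(M_φ ε)` of `x`. In the pessimistic case the Lyapunov function is the Moreau
envelope; weak convexity of `φ_p` makes its gradient correlate with that of the smoothing up to an
error `O(ε)`.
-/

namespace Bilevel

section PolarCoordinates

variable {E : Type*} [NormedAddCommGroup E] [NormedSpace ℝ E] [FiniteDimensional ℝ E]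
  [Nontrivial E] [MeasurableSpace E] [BorelSpace E] (μ : Measure E) [μ.IsAddHaarMeasure]

lemma integral_eq_integral_toSphere_prod (f : E → ℝ) :
    ∫ x, f x ∂μ = ∫ p : Metric.sphere (0 : E) 1 × Set.Ioi (0 : ℝ), f (p.2.1 • p.1.1)
      ∂μ.toSphere.prod (.volumeIoiPow (Module.finrank ℝ E - 1)) := by
  rw [← μ.measurePreserving_homeomorphUnitSphereProd.integral_comp
    (Homeomorph.measurableEmbedding _)]
  trans ∫ x in {(0 : E)}ᶜ, f x ∂μ
  · rw [restrict_compl_singleton]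
  rw [← integral_subtype_comap (measurableSet_singleton _).compl]
  refine integral_congr_ae (ae_of_all _ fun x => ?_)
  have hx : ‖(x : E)‖ ≠ 0 := norm_ne_zero_iff.2 x.2
  simp [smul_smul, hx]

lemma integrable_toSphere_prod {f : E → ℝ} (hf : Integrable f μ) :
    Integrable (fun p : Metric.sphere (0 : E) 1 × Set.Ioi (0 : ℝ) => f (p.2.1 • p.1.1))
      (μ.toSphere.prod (.volumeIoiPow (Module.finrank ℝ E - 1))) := by
  rw [← μ.measurePreserving_homeomorphUnitSphereProd.integrable_comp_emb
    (Homeomorph.measurableEmbedding _)]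
  rw [← restrict_compl_singleton (μ := μ) 0, ← IntegrableOn,
    integrableOn_iff_comap_subtypeVal (measurableSet_singleton _).compl] at hf
  refine hf.congr (ae_of_all _ fun x => ?_)
  have hx : ‖(x : E)‖ ≠ 0 := norm_ne_zero_iff.2 x.2
  simp [smul_smul, hx]

lemma integral_volumeIoiPow (n : ℕ) (g : ℝ → ℝ) :
    ∫ r, g r ∂Measure.volumeIoiPow n = ∫ r in Set.Ioi (0 : ℝ), r ^ n * g r := by
  simp only [Measure.volumeIoiPow, ENNReal.ofReal]
  rw [integral_withDensity_eq_integral_smul (measurable_subtype_coe.pow_const _).real_toNNReal,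
    integral_subtype_comap measurableSet_Ioi fun a => Real.toNNReal (a ^ n) • g a]
  refine setIntegral_congr_fun measurableSet_Ioi fun r hr => ?_
  rw [NNReal.smul_def, Real.coe_toNNReal _ (pow_nonneg (le_of_lt hr) _), smul_eq_mul]

lemma setIntegral_annulus {f : E → ℝ} {a b : ℝ} (ha : 0 ≤ a)
    (hf : IntegrableOn f {x | ‖x‖ ∈ Set.Ioo a b} μ) :
    ∫ x in {x | ‖x‖ ∈ Set.Ioo a b}, f x ∂μ =
      ∫ r in Set.Ioo a b, r ^ (Module.finrank ℝ E - 1) * ∫ u, f (r • (u : E)) ∂μ.toSphere := by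
  have hmeas : MeasurableSet {x : E | ‖x‖ ∈ Set.Ioo a b} := measurable_norm measurableSet_Ioo
  rw [← integral_indicator hmeas, integral_eq_integral_toSphere_prod μ, integral_prod_symm _
      (integrable_toSphere_prod μ ((integrable_indicator_iff hmeas).2 hf)),
    integral_volumeIoiPow _ fun r =>
      ∫ u, Set.indicator {x | ‖x‖ ∈ Set.Ioo a b} f (r • (u : E)) ∂μ.toSphere,
    ← integral_indicator measurableSet_Ioi, ← integral_indicator measurableSet_Ioo]
  congr 1 with r
  by_cases hr : r ∈ Set.Ioo a b
  · have hr0 : 0 < r := ha.trans_lt hr.1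
    simp [Set.indicator, norm_smul, abs_of_pos hr0, hr0, hr.1, hr.2]
  · by_cases hr0 : 0 < r
    · simp only [Set.indicator, norm_smul, Set.mem_ofPred_eq, norm_eq_of_mem_sphere, mul_one,
        Real.norm_of_nonneg hr0.le, hr, if_false, integral_zero, mul_zero, ite_self]
    · simp [hr0, hr]

lemma integral_radial_mul_angular (k : ℝ → ℝ) (h : E → ℝ) :
    ∫ x, k ‖x‖ * h (‖x‖⁻¹ • x) ∂μ = (⨍ u, h (u : E) ∂μ.toSphere) * ∫ x, k ‖x‖ ∂μ := by
  have polar : ∀ h : E → ℝ, ∫ x, k ‖x‖ * h (‖x‖⁻¹ • x) ∂μ = (∫ u, h (u : E) ∂μ.toSphere) *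
      ∫ r : Set.Ioi (0 : ℝ), k r ∂.volumeIoiPow (Module.finrank ℝ E - 1) := by
    intro h
    rw [integral_eq_integral_toSphere_prod μ, ← integral_prod_mul]
    refine integral_congr_ae (ae_of_all _ fun p => ?_)
    have hr : (0 : ℝ) < p.2 := p.2.2
    simp [norm_smul, smul_smul, abs_of_pos hr, hr.ne', mul_comm]
  have h1 := polar fun _ => 1
  have hne : μ.toSphere.real Set.univ ≠ 0 :=
    (measureReal_ne_zero_iff (measure_ne_top _ _)).2
      (Measure.measure_univ_ne_zero.2 (Measure.toSphere_ne_zero μ))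
  simp only [mul_one, integral_const, smul_eq_mul] at h1
  rw [polar h, h1, average_eq, smul_eq_mul]
  field_simp

end PolarCoordinates

section RadialCutoff

variable {E : Type*} [NormedAddCommGroup E] {s : ℝ}

/-- The cutoff that is `1` on the unit ball and decreases linearly in the norm to `0` at radius
`1 + s`; it approximates the indicator function of the ball in the divergence theorem. -/
noncomputable def radialCutoff (s : ℝ) (x : E) : ℝ :=
  max 0 (min 1 (s⁻¹ * (1 + s - ‖x‖)))

lemma radialCutoff_nonneg (x : E) : 0 ≤ radialCutoff s x := le_max_left _ _

lemma radialCutoff_le_one (x : E) : radialCutoff s x ≤ 1 :=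
  max_le zero_le_one (min_le_left _ _)

lemma lipschitzWith_radialCutoff (hs : 0 < s) :
    LipschitzWith ⟨s⁻¹, (inv_pos.2 hs).le⟩ (radialCutoff (E := E) s) := by
  refine ((LipschitzWith.of_dist_le_mul fun x y => ?_).const_min _).const_max _
  calc dist (s⁻¹ * (1 + s - ‖x‖)) (s⁻¹ * (1 + s - ‖y‖)) = s⁻¹ * |‖x‖ - ‖y‖| := by
        rw [Real.dist_eq, ← mul_sub, abs_mul, abs_of_pos (inv_pos.2 hs), sub_sub_sub_cancel_left,
          abs_sub_comm]
    _ ≤ s⁻¹ * dist x y := by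
        rw [dist_eq_norm]
        exact mul_le_mul_of_nonneg_left (abs_norm_sub_norm_le x y) (inv_pos.2 hs).le

lemma radialCutoff_of_norm_le (hs : 0 < s) {x : E} (hx : ‖x‖ ≤ 1) : radialCutoff s x = 1 := by
  have : 1 ≤ s⁻¹ * (1 + s - ‖x‖) := by
    rw [← div_eq_inv_mul, le_div_iff₀ hs]
    linarith
  rw [radialCutoff, min_eq_left this, max_eq_right zero_le_one]

lemma radialCutoff_of_le_norm (hs : 0 < s) {x : E} (hx : 1 + s ≤ ‖x‖) : radialCutoff s x = 0 :=
  max_eq_left (min_le_of_right_le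
    (mul_nonpos_of_nonneg_of_nonpos (inv_pos.2 hs).le (by linarith)))

lemma radialCutoff_of_norm_mem_Ioo (hs : 0 < s) {x : E} (hx : ‖x‖ ∈ Set.Ioo 1 (1 + s)) :
    radialCutoff s x = s⁻¹ * (1 + s - ‖x‖) := by
  have hle : s⁻¹ * (1 + s - ‖x‖) ≤ 1 := by
    rw [← div_eq_inv_mul, div_le_iff₀ hs]
    linarith [hx.1]
  rw [radialCutoff, min_eq_right hle,
    max_eq_right (mul_nonneg (inv_pos.2 hs).le (by linarith [hx.2]))]

lemma hasCompactSupport_radialCutoff [ProperSpace E] (hs : 0 < s) :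
    HasCompactSupport (radialCutoff (E := E) s) := by
  refine HasCompactSupport.intro (isCompact_closedBall (0 : E) (1 + s)) fun x hx => ?_
  rw [mem_closedBall_zero_iff, not_le] at hx
  exact radialCutoff_of_le_norm hs hx.le

end RadialCutoff

section Divergence

variable {E : Type*} [NormedAddCommGroup E] [InnerProductSpace ℝ E] {s : ℝ} {f : E → ℝ}

lemma hasDerivAt_norm_add_smul {x : E} (hx : x ≠ 0) (v : E) :
    HasDerivAt (fun t : ℝ => ‖x + t • v‖) (inner ℝ (‖x‖⁻¹ • x) v) 0 := by
  have hline : HasDerivAt (fun t : ℝ => x + t • v) v 0 := by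
    simpa using ((hasDerivAt_id (0 : ℝ)).smul_const v).const_add x
  have h := hline.norm_sq.sqrt (by simpa using hx)
  simp only [Real.sqrt_sq (norm_nonneg _), zero_smul, add_zero] at h
  convert! h using 1
  rw [real_inner_smul_left]
  field_simp

lemma lineDeriv_radialCutoff (hs : 0 < s) {x : E} (v : E) (h1 : ‖x‖ ≠ 1) (h2 : ‖x‖ ≠ 1 + s) :
    lineDeriv ℝ (radialCutoff s) x (-v) =
      Set.indicator {x : E | ‖x‖ ∈ Set.Ioo 1 (1 + s)}
        (fun x => s⁻¹ * inner ℝ (‖x‖⁻¹ • x) v) x := by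
  rcases lt_or_gt_of_ne h1 with h1 | h1
  · have : radialCutoff s =ᶠ[𝓝 x] fun _ => (1 : ℝ) := by
      filter_upwards [(isOpen_lt continuous_norm continuous_const).mem_nhds h1] with y hy
      exact radialCutoff_of_norm_le hs (le_of_lt hy)
    rw [this.lineDeriv_eq, Set.indicator_of_notMem fun hx => h1.not_gt hx.1]
    simp [lineDeriv]
  rcases lt_or_gt_of_ne h2 with h2 | h2
  · have : radialCutoff s =ᶠ[𝓝 x] fun y => s⁻¹ * (1 + s - ‖y‖) := by
      filter_upwards [(isOpen_Ioo.preimage continuous_norm).mem_nhds ⟨h1, h2⟩] with y hy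
      exact radialCutoff_of_norm_mem_Ioo hs hy
    rw [this.lineDeriv_eq,
      Set.indicator_of_mem (show x ∈ {x : E | ‖x‖ ∈ Set.Ioo 1 (1 + s)} from ⟨h1, h2⟩)]
    have hx : x ≠ 0 := norm_ne_zero_iff.1 (by positivity)
    have h := ((hasDerivAt_norm_add_smul hx (-v)).const_sub (1 + s)).const_mul s⁻¹
    rw [inner_neg_right, neg_neg] at h
    exact h.deriv
  · have : radialCutoff s =ᶠ[𝓝 x] fun _ => (0 : ℝ) := by
      filter_upwards [(isOpen_lt continuous_const continuous_norm).mem_nhds h2] with y hy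
      exact radialCutoff_of_le_norm hs (le_of_lt hy)
    rw [this.lineDeriv_eq, Set.indicator_of_notMem fun hx => h2.not_gt hx.2]
    simp [lineDeriv]

variable [FiniteDimensional ℝ E] [MeasurableSpace E] [BorelSpace E]
  (μ : Measure E) [μ.IsAddHaarMeasure]

lemma tendsto_integral_lineDeriv_mul_radialCutoff {C : ℝ≥0} (hf : LipschitzWith C f) (v : E) :
    Tendsto (fun s : ℝ => ∫ x, lineDeriv ℝ f x v * radialCutoff s x ∂μ) (𝓝[>] 0)
      (𝓝 (∫ x in Metric.closedBall 0 1, lineDeriv ℝ f x v ∂μ)) := by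
  have hball : ∀ r : ℝ, MeasurableSet (Metric.closedBall (0 : E) r) := fun _ =>
    Metric.isClosed_closedBall.measurableSet
  rw [← integral_indicator (hball 1)]
  refine tendsto_integral_filter_of_dominated_convergence
    ((Metric.closedBall (0 : E) 2).indicator fun _ => C * ‖v‖) ?_ ?_
    ((integrable_indicator_iff (hball 2)).2 (integrableOn_const measure_closedBall_lt_top.ne)) ?_
  · filter_upwards [self_mem_nhdsWithin] with s hs
    exact (aestronglyMeasurable_lineDeriv hf.continuous μ).mul
      (lipschitzWith_radialCutoff hs).continuous.aestronglyMeasurable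
  · filter_upwards [Ioc_mem_nhdsGT zero_lt_one] with s hs
    refine ae_of_all _ fun x => ?_
    by_cases hx : ‖x‖ ≤ 2
    · rw [Set.indicator_of_mem (mem_closedBall_zero_iff.2 hx), norm_mul,
        Real.norm_of_nonneg (radialCutoff_nonneg x)]
      exact (mul_le_mul (norm_lineDeriv_le_of_lipschitz ℝ hf) (radialCutoff_le_one x)
        (radialCutoff_nonneg x) (by positivity)).trans_eq (mul_one _)
    · rw [Set.indicator_of_notMem (mt mem_closedBall_zero_iff.1 hx),
        radialCutoff_of_le_norm hs.1 (by linarith [hs.2]), mul_zero, norm_zero]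
  · refine ae_of_all _ fun x => tendsto_const_nhds.congr' ?_
    by_cases hx : ‖x‖ ≤ 1
    · filter_upwards [self_mem_nhdsWithin] with s hs
      rw [Set.indicator_of_mem (mem_closedBall_zero_iff.2 hx), radialCutoff_of_norm_le hs hx,
        mul_one]
    · filter_upwards [Ioc_mem_nhdsGT (sub_pos.2 (not_le.1 hx))] with s hs
      rw [Set.indicator_of_notMem (mt mem_closedBall_zero_iff.1 hx),
        radialCutoff_of_le_norm hs.1 (by linarith [hs.2]), mul_zero]

variable [Nontrivial E]

lemma integral_lineDeriv_radialCutoff_mul (hs : 0 < s) (hf : Continuous f) (v : E) :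
    ∫ x, lineDeriv ℝ (radialCutoff s) x (-v) * f x ∂μ =
      s⁻¹ * ∫ r in (1)..(1 + s), r ^ (Module.finrank ℝ E - 1) *
        ∫ u, f (r • (u : E)) * inner ℝ (u : E) v ∂μ.toSphere := by
  set G : E → ℝ := fun x => f x * inner ℝ (‖x‖⁻¹ • x) v
  have hG : IntegrableOn G {x | ‖x‖ ∈ Set.Ioo 1 (1 + s)} μ := by
    have hcompact : IsCompact {x : E | ‖x‖ ∈ Set.Icc 1 (1 + s)} :=
      (isCompact_closedBall (0 : E) (1 + s)).of_isClosed_subset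
        (isClosed_Icc.preimage continuous_norm) fun x hx => mem_closedBall_zero_iff.2 hx.2
    refine (ContinuousOn.integrableOn_compact (K := {x : E | ‖x‖ ∈ Set.Icc 1 (1 + s)}) hcompact
      fun x hx => ?_).mono_set fun x hx => Set.Ioo_subset_Icc_self hx
    have hx0 : ‖x‖ ≠ 0 := (zero_lt_one.trans_le hx.1).ne'
    exact (hf.continuousAt.mul ((((continuous_norm.continuousAt.inv₀ hx0).smul
      continuousAt_id).inner continuousAt_const))).continuousWithinAt
  have hmeas : MeasurableSet {x : E | ‖x‖ ∈ Set.Ioo 1 (1 + s)} :=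
    measurable_norm measurableSet_Ioo
  have hderiv : ∀ᵐ x ∂μ, lineDeriv ℝ (radialCutoff s) x (-v) * f x =
      Set.indicator {x : E | ‖x‖ ∈ Set.Ioo 1 (1 + s)} (fun x => s⁻¹ * G x) x := by
    filter_upwards [measure_eq_zero_iff_ae_notMem.1 (Measure.addHaar_sphere μ (0 : E) 1),
      measure_eq_zero_iff_ae_notMem.1 (Measure.addHaar_sphere μ (0 : E) (1 + s))] with x h1 h2
    rw [mem_sphere_zero_iff_norm] at h1 h2
    rw [lineDeriv_radialCutoff hs v h1 h2, ← Set.indicator_mul_left]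
    simp only [G, mul_assoc, mul_comm (f _)]
  rw [integral_congr_ae hderiv, integral_indicator hmeas, integral_const_mul,
    setIntegral_annulus μ zero_le_one hG, intervalIntegral.integral_of_le (by linarith),
    integral_Ioc_eq_integral_Ioo]
  congr 1
  refine setIntegral_congr_fun measurableSet_Ioo fun r hr => ?_
  have hr0 : 0 < r := zero_lt_one.trans hr.1
  simp [G, norm_smul, abs_of_pos hr0, smul_smul, hr0.ne']

lemma tendsto_integral_lineDeriv_radialCutoff_mul (hf : Continuous f) (v : E) :
    Tendsto (fun s : ℝ => ∫ x, lineDeriv ℝ (radialCutoff s) x (-v) * f x ∂μ) (𝓝[>] 0)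
      (𝓝 (∫ u, f (u : E) * inner ℝ (u : E) v ∂μ.toSphere)) := by
  set g : ℝ → ℝ := fun r => r ^ (Module.finrank ℝ E - 1) *
    ∫ u, f (r • (u : E)) * inner ℝ (u : E) v ∂μ.toSphere
  have hg : Continuous g := by
    refine (continuous_pow _).mul ?_
    simpa using continuous_parametric_integral_of_continuous (μ := μ.toSphere)
      (f := fun (r : ℝ) (u : Metric.sphere (0 : E) 1) => f (r • (u : E)) * inner ℝ (u : E) v)
      (by fun_prop) isCompact_univ
  have h := (hg.integral_hasStrictDerivAt 1 1).hasDerivAt.tendsto_slope_zero_right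
  simp only [intervalIntegral.integral_same, sub_zero, smul_eq_mul] at h
  rw [show g 1 = ∫ u, f (u : E) * inner ℝ (u : E) v ∂μ.toSphere by simp [g]] at h
  refine h.congr' ?_
  filter_upwards [self_mem_nhdsWithin] with s hs
  exact (integral_lineDeriv_radialCutoff_mul μ hs hf v).symm

theorem integral_closedBall_lineDeriv {C : ℝ≥0} (hf : LipschitzWith C f) (v : E) :
    ∫ x in Metric.closedBall 0 1, lineDeriv ℝ f x v ∂μ =
      ∫ u, f (u : E) * inner ℝ (u : E) v ∂μ.toSphere := by
  refine tendsto_nhds_unique (tendsto_integral_lineDeriv_mul_radialCutoff μ hf v)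
    ((tendsto_integral_lineDeriv_radialCutoff_mul μ hf.continuous v).congr' ?_)
  filter_upwards [self_mem_nhdsWithin] with s hs
  exact (hf.integral_lineDeriv_mul_eq (lipschitzWith_radialCutoff hs)
    (hasCompactSupport_radialCutoff hs) v).symm

end Divergence

section Gradient

variable {E : Type*} [NormedAddCommGroup E] [InnerProductSpace ℝ E] [CompleteSpace E]

lemma measurable_gradient [MeasurableSpace E] [BorelSpace E] (f : E → ℝ) : Measurable (∇ f) :=
  (LinearIsometryEquiv.continuous _).measurable.comp (measurable_fderiv ℝ f)

lemma norm_gradient_le {K : ℝ≥0} {f : E → ℝ} (hf : LipschitzWith K f) (x : E) : ‖∇ f x‖ ≤ K := by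
  rw [gradient, LinearIsometryEquiv.norm_map]
  exact norm_fderiv_le_of_lipschitz ℝ hf

end Gradient

section GaussianPoincare

lemma eLpNorm_comp_iterate_sub_le {α F : Type*} [MeasurableSpace α] [NormedAddCommGroup F]
    {ν : Measure α} {T : α → α} (hT : MeasurePreserving T ν ν) {g : α → F}
    (hg : AEStronglyMeasurable g ν) {p : ℝ≥0∞} (hp : 1 ≤ p) (N : ℕ) :
    eLpNorm (g ∘ T^[N] - g) p ν ≤ N * eLpNorm (g ∘ T - g) p ν := by
  induction N with
  | zero => simp
  | succ N ih =>
    have hgN : AEStronglyMeasurable (g ∘ T^[N]) ν := hg.comp_measurePreserving (hT.iterate N)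
    have hgT : AEStronglyMeasurable (g ∘ T) ν := hg.comp_measurePreserving hT
    calc eLpNorm (g ∘ T^[N + 1] - g) p ν
        = eLpNorm ((g ∘ T^[N] - g) ∘ T + (g ∘ T - g)) p ν := by
          congr 1
          ext x
          simp
      _ ≤ eLpNorm ((g ∘ T^[N] - g) ∘ T) p ν + eLpNorm (g ∘ T - g) p ν :=
          eLpNorm_add_le ((hgN.sub hg).comp_measurePreserving hT) (hgT.sub hg) hp
      _ ≤ N * eLpNorm (g ∘ T - g) p ν + eLpNorm (g ∘ T - g) p ν := by
          rw [eLpNorm_comp_measurePreserving (hgN.sub hg) hT]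
          gcongr
      _ = (N + 1 : ℕ) * eLpNorm (g ∘ T - g) p ν := by
          push_cast
          ring

section Rotation

variable {E : Type*} [NormedAddCommGroup E] [NormedSpace ℝ E]

lemma rotation_iterate (θ : ℝ) (N : ℕ) :
    (ContinuousLinearMap.rotation (E := E) θ)^[N] = ContinuousLinearMap.rotation (N * θ) := by
  induction N with
  | zero => ext p <;> simp [ContinuousLinearMap.rotation_apply]
  | succ N ih =>
    ext p <;>
    · simp only [Function.iterate_succ', Function.comp_apply, ih, Nat.cast_add, Nat.cast_one,
        ContinuousLinearMap.rotation_apply, add_mul, one_mul, Real.cos_add, Real.sin_add]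
      module

lemma hasDerivAt_fst_rotation (p : E × E) :
    HasDerivAt (fun θ : ℝ => (ContinuousLinearMap.rotation θ p).1) p.2 0 := by
  have h := ((Real.hasDerivAt_cos 0).smul_const p.1).add ((Real.hasDerivAt_sin 0).smul_const p.2)
  simpa [ContinuousLinearMap.rotation_apply] using! h

lemma norm_fst_rotation_sub_le (θ : ℝ) (p : E × E) :
    ‖(ContinuousLinearMap.rotation θ p).1 - p.1‖ ≤ |θ| * (‖p.1‖ + ‖p.2‖) := by
  calc ‖(ContinuousLinearMap.rotation θ p).1 - p.1‖
      = ‖(Real.cos θ - 1) • p.1 + Real.sin θ • p.2‖ := by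
        rw [ContinuousLinearMap.rotation_apply]
        congr 1
        module
    _ ≤ |Real.cos θ - 1| * ‖p.1‖ + |Real.sin θ| * ‖p.2‖ := by
        simpa only [norm_smul, Real.norm_eq_abs] using
          norm_add_le ((Real.cos θ - 1) • p.1) (Real.sin θ • p.2)
    _ ≤ |θ| * ‖p.1‖ + |θ| * ‖p.2‖ := by
        have hcos : |Real.cos θ - 1| ≤ |θ| := by simpa using Real.abs_cos_sub_cos_le θ 0
        exact add_le_add (mul_le_mul_of_nonneg_right hcos (norm_nonneg _))
          (mul_le_mul_of_nonneg_right Real.abs_sin_le_abs (norm_nonneg _))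
    _ = |θ| * (‖p.1‖ + ‖p.2‖) := (mul_add _ _ _).symm

lemma enorm_rotation_sub_le {K : ℝ≥0} {f : E → ℝ} (hf : LipschitzWith K f) (θ : ℝ) (N : ℕ)
    (p : E × E) :
    ‖N * (f (ContinuousLinearMap.rotation (θ / N) p).1 - f p.1)‖ₑ ≤
      ‖K * |θ| * (‖p.1‖ + ‖p.2‖)‖ₑ := by
  have hp : 0 ≤ K * |θ| * (‖p.1‖ + ‖p.2‖) := by positivity
  rw [enorm_le_iff_norm_le, Real.norm_of_nonneg hp, norm_mul, Real.norm_natCast]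
  rcases N.eq_zero_or_pos with rfl | hN
  · rwa [Nat.cast_zero, zero_mul]
  calc N * ‖f (ContinuousLinearMap.rotation (θ / N) p).1 - f p.1‖
      ≤ N * (K * (|θ / N| * (‖p.1‖ + ‖p.2‖))) := by
        gcongr
        refine (hf.norm_sub_le _ _).trans ?_
        gcongr
        exact norm_fst_rotation_sub_le _ p
    _ = K * |θ| * (‖p.1‖ + ‖p.2‖) := by
        rw [abs_div, Nat.abs_cast]
        field_simp

end Rotation

lemma tendsto_rotation_sub {E : Type*} [NormedAddCommGroup E] [InnerProductSpace ℝ E]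
    [CompleteSpace E] {f : E → ℝ} {p : E × E} (hf : DifferentiableAt ℝ f p.1)
    {θ : ℝ} (hθ : 0 < θ) :
    Tendsto (fun N : ℕ => N * (f (ContinuousLinearMap.rotation (θ / N) p).1 - f p.1)) atTop
      (𝓝 (θ * inner ℝ (∇ f p.1) p.2)) := by
  have h0 : (ContinuousLinearMap.rotation 0 p).1 = p.1 := by
    simp [ContinuousLinearMap.rotation_apply]
  have hderiv : HasDerivAt (fun t : ℝ => f (ContinuousLinearMap.rotation t p).1)
      (inner ℝ (∇ f p.1) p.2) 0 := by
    rw [inner_gradient_left]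
    exact HasFDerivAt.comp_hasDerivAt (0 : ℝ) (h0.symm ▸ hf.hasFDerivAt)
      (hasDerivAt_fst_rotation p)
  have hN : Tendsto (fun N : ℕ => θ / N) atTop (𝓝[>] 0) := by
    refine tendsto_nhdsWithin_iff.2 ⟨tendsto_const_div_atTop_nhds_zero_nat _, ?_⟩
    filter_upwards [eventually_gt_atTop 0] with N hN
    exact div_pos hθ (Nat.cast_pos.2 hN)
  refine ((hderiv.tendsto_slope_zero_right.comp hN).const_mul θ).congr fun N => ?_
  simp only [Function.comp_apply, zero_add, h0, smul_eq_mul]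
  rw [inv_div, ← mul_assoc, mul_div_cancel₀ _ hθ.ne']

variable {E : Type*} [NormedAddCommGroup E] [InnerProductSpace ℝ E]

/-- The Lebesgue density of the standard Gaussian measure. -/
noncomputable def gaussianDensity (x : E) : ℝ :=
  (2 * Real.pi) ^ (-(Module.finrank ℝ E / 2 : ℝ)) * Real.exp (-(1 / 2) * ‖x‖ ^ 2)

lemma gaussianDensity_nonneg (x : E) : 0 ≤ gaussianDensity x := by
  unfold gaussianDensity
  positivity

variable [MeasurableSpace E] [BorelSpace E]

lemma measurable_gaussianDensity : Measurable (gaussianDensity (E := E)) := by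
  unfold gaussianDensity
  fun_prop

variable [FiniteDimensional ℝ E]

lemma integrable_gaussianDensity : Integrable (gaussianDensity (E := E)) := by
  refine Integrable.const_mul ?_ _
  have h := GaussianFourier.integrable_cexp_neg_mul_sq_norm_add (V := E) (b := 1 / 2)
    (by norm_num) 0 0
  refine (h.re).congr (ae_of_all _ fun x => ?_)
  simp [← Complex.exp_ofReal_re]

lemma integral_gaussianDensity_smul_cexp (t : E) :
    ∫ x : E, gaussianDensity x • Complex.exp (inner ℝ x t * Complex.I) =
      Complex.exp (-‖t‖ ^ 2 / 2) := by
  have hnorm : (((2 * Real.pi) ^ (-(Module.finrank ℝ E / 2 : ℝ)) : ℝ) : ℂ) *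
      (Real.pi / (1 / 2)) ^ (Module.finrank ℝ E / 2 : ℂ) = 1 := by
    rw [show (Real.pi / (1 / 2) : ℂ) = ((2 * Real.pi : ℝ) : ℂ) by push_cast; ring,
      show (Module.finrank ℝ E / 2 : ℂ) = ((Module.finrank ℝ E / 2 : ℝ) : ℂ) by push_cast; rfl,
      ← Complex.ofReal_cpow (by positivity), ← Complex.ofReal_mul,
      ← Real.rpow_add (by positivity), neg_add_cancel, Real.rpow_zero, Complex.ofReal_one]
  calc ∫ x : E, gaussianDensity x • Complex.exp (inner ℝ x t * Complex.I)
      = (((2 * Real.pi) ^ (-(Module.finrank ℝ E / 2 : ℝ)) : ℝ) : ℂ) *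
          ∫ x : E, Complex.exp (-(1 / 2) * ‖x‖ ^ 2 + Complex.I * inner ℝ t x) := by
        rw [← integral_const_mul]
        congr 1 with x
        rw [gaussianDensity, Complex.real_smul, Complex.exp_add, real_inner_comm x t]
        push_cast
        ring_nf
    _ = Complex.exp (-‖t‖ ^ 2 / 2) := by
        rw [GaussianFourier.integral_cexp_neg_mul_sq_norm_add (by norm_num), ← mul_assoc, hnorm,
          one_mul, Complex.I_sq]
        congr 1
        ring

lemma stdGaussian_eq_withDensity :
    stdGaussian E = volume.withDensity fun x => ENNReal.ofReal (gaussianDensity x) := by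
  have := isFiniteMeasure_withDensity_ofReal (integrable_gaussianDensity (E := E)).2
  refine Measure.ext_of_charFun (funext fun t => ?_)
  rw [charFun_stdGaussian, charFun_apply, ← integral_gaussianDensity_smul_cexp,
    integral_withDensity_eq_integral_toReal_smul measurable_gaussianDensity.ennreal_ofReal
      (ae_of_all _ fun _ => ENNReal.ofReal_lt_top)]
  simp only [ENNReal.toReal_ofReal (gaussianDensity_nonneg _)]

lemma integral_stdGaussian (f : E → ℝ) :
    ∫ x, f x ∂stdGaussian E = ∫ x, gaussianDensity x * f x := by
  rw [stdGaussian_eq_withDensity,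
    integral_withDensity_eq_integral_toReal_smul measurable_gaussianDensity.ennreal_ofReal
      (ae_of_all _ fun _ => ENNReal.ofReal_lt_top)]
  simp only [ENNReal.toReal_ofReal (gaussianDensity_nonneg _), smul_eq_mul]

lemma stdGaussian_absolutelyContinuous : stdGaussian E ≪ volume :=
  stdGaussian_eq_withDensity (E := E) ▸ withDensity_absolutelyContinuous _ _

lemma lintegral_enorm_inner_sq_stdGaussian (v : E) :
    ∫⁻ x, ‖inner ℝ v x‖ₑ ^ 2 ∂stdGaussian E = ‖v‖ₑ ^ 2 := by
  have hL : MemLp (innerSL ℝ v) 2 (stdGaussian E) :=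
    (innerSL ℝ v).comp_memLp' IsGaussian.memLp_two_id
  have h := ofReal_variance hL
  rw [variance_dual_stdGaussian, innerSL_apply_norm, evariance,
    integral_strongDual_stdGaussian] at h
  simpa [ENNReal.ofReal_pow] using h.symm

lemma integral_norm_sq_stdGaussian :
    ∫ x, ‖x‖ ^ 2 ∂stdGaussian E = Module.finrank ℝ E := by
  set b := stdOrthonormalBasis ℝ E
  have hcoord : ∀ i, ∫ x, inner ℝ (b i) x ^ 2 ∂stdGaussian E = 1 := fun i => by
    have h := variance_dual_stdGaussian (innerSL ℝ (b i))
    rw [variance_of_integral_eq_zero (by fun_prop) (integral_strongDual_stdGaussian _)] at h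
    simpa using h
  have hint : ∀ i, Integrable (fun x => inner ℝ (b i) x ^ 2) (stdGaussian E) := fun i =>
    ((innerSL ℝ (b i)).comp_memLp' IsGaussian.memLp_two_id).integrable_sq
  simp_rw [← b.sum_sq_inner_right]
  rw [integral_finsetSum _ fun i _ => hint i]
  simp [hcoord]

lemma memLp_stdGaussian_of_lipschitzWith {K : ℝ≥0} {f : E → ℝ} (hf : LipschitzWith K f) :
    MemLp f 2 (stdGaussian E) := by
  have h : MemLp ((fun x => f x - f 0) ∘ id) 2 (stdGaussian E) :=
    LipschitzWith.comp_memLp (K := K) (.of_dist_le_mul fun x y => by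
      simpa [dist_sub_right] using hf.dist_le_mul x y) (sub_self _) IsGaussian.memLp_two_id
  exact (h.add (memLp_const (f 0))).congr_norm hf.continuous.aestronglyMeasurable (by simp)

lemma measurePreserving_rotation (θ : ℝ) :
    MeasurePreserving (ContinuousLinearMap.rotation θ)
      ((stdGaussian E).prod (stdGaussian E)) ((stdGaussian E).prod (stdGaussian E)) :=
  ⟨by fun_prop, IsGaussian.map_rotation_eq_self integral_id_stdGaussian θ⟩

lemma lintegral_enorm_sub_sq_le {f : E → ℝ} (hf : Continuous f) {N : ℕ} (hN : N ≠ 0) :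
    ∫⁻ p, ‖f p.2 - f p.1‖ₑ ^ 2 ∂(stdGaussian E).prod (stdGaussian E) ≤
      ∫⁻ p, ‖N * (f (ContinuousLinearMap.rotation (Real.pi / 2 / N) p).1 - f p.1)‖ₑ ^ 2
        ∂(stdGaussian E).prod (stdGaussian E) := by
  have hsq : ∀ g : E × E → ℝ, ∫⁻ p, ‖g p‖ₑ ^ 2 ∂(stdGaussian E).prod (stdGaussian E) =
      eLpNorm g 2 ((stdGaussian E).prod (stdGaussian E)) ^ 2 := fun g => by
    simpa using (eLpNorm_nnreal_pow_eq_lintegral (f := g) (p := 2) two_ne_zero).symm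
  have hrot : ∀ p : E × E,
      ((ContinuousLinearMap.rotation (Real.pi / 2 / N))^[N] p).1 = p.2 := fun p => by
    rw [rotation_iterate, mul_div_cancel₀ _ (Nat.cast_ne_zero.2 hN)]
    simp [ContinuousLinearMap.rotation_apply]
  have h := eLpNorm_comp_iterate_sub_le (measurePreserving_rotation (E := E) (Real.pi / 2 / N))
    (hf.comp continuous_fst).aestronglyMeasurable one_le_two N
  rw [hsq, hsq]
  gcongr
  calc _ = _ := by
        congr 1
        ext p
        simp [hrot]
    _ ≤ _ := h
    _ = _ := by
        rw [show (N : ℝ≥0∞) = ‖(N : ℝ)‖ₑ by simp [enorm], ← eLpNorm_const_smul]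
        rfl

lemma lintegral_enorm_sub_sq_le_of_lipschitzWith {K : ℝ≥0} {f : E → ℝ} (hf : LipschitzWith K f) :
    ∫⁻ p, ‖f p.2 - f p.1‖ₑ ^ 2 ∂(stdGaussian E).prod (stdGaussian E) ≤
      ENNReal.ofReal ((Real.pi / 2 * K) ^ 2) := by
  set γ := stdGaussian E
  have hfm := hf.continuous.measurable
  have hbound : MemLp (fun p : E × E => K * |Real.pi / 2| * (‖p.1‖ + ‖p.2‖)) 2 (γ.prod γ) :=
    (((IsGaussian.memLp_two_id.comp_measurePreserving measurePreserving_fst).norm).add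
      (IsGaussian.memLp_two_id.comp_measurePreserving measurePreserving_snd).norm).const_mul _
  have hlim := tendsto_lintegral_of_dominated_convergence (μ := γ.prod γ)
    (F := fun (N : ℕ) (p : E × E) =>
      ‖N * (f (ContinuousLinearMap.rotation (Real.pi / 2 / N) p).1 - f p.1)‖ₑ ^ 2)
    (f := fun p => ‖Real.pi / 2 * inner ℝ (∇ f p.1) p.2‖ₑ ^ 2)
    (fun p => ‖K * |Real.pi / 2| * (‖p.1‖ + ‖p.2‖)‖ₑ ^ 2) (fun N => by fun_prop)
    (fun N => ae_of_all _ fun p => pow_le_pow_left' (enorm_rotation_sub_le hf _ N p) 2)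
    (by simpa using (lintegral_rpow_enorm_lt_top_of_eLpNorm_lt_top two_ne_zero (by simp)
      hbound.2).ne)
    (by
      filter_upwards [Measure.quasiMeasurePreserving_fst.ae
        (stdGaussian_absolutelyContinuous.ae_le hf.ae_differentiableAt)] with p hp
      exact (ENNReal.continuous_pow 2).continuousAt.tendsto.comp
        (tendsto_rotation_sub hp Real.pi_div_two_pos).enorm)
  calc ∫⁻ p, ‖f p.2 - f p.1‖ₑ ^ 2 ∂γ.prod γ
      ≤ ∫⁻ p, ‖Real.pi / 2 * inner ℝ (∇ f p.1) p.2‖ₑ ^ 2 ∂γ.prod γ :=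
        ge_of_tendsto hlim <| (eventually_ne_atTop 0).mono fun N hN =>
          lintegral_enorm_sub_sq_le hf.continuous hN
    _ = ∫⁻ x, ‖(Real.pi / 2) • ∇ f x‖ₑ ^ 2 ∂γ := by
        have := measurable_gradient f
        rw [lintegral_prod _ (by fun_prop)]
        simp only [← real_inner_smul_left, lintegral_enorm_inner_sq_stdGaussian, γ]
    _ ≤ ∫⁻ _, ENNReal.ofReal ((Real.pi / 2 * K) ^ 2) ∂γ := by
        refine lintegral_mono fun x => ?_
        rw [← ofReal_norm, ← ENNReal.ofReal_pow (norm_nonneg _), norm_smul,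
          Real.norm_of_nonneg Real.pi_div_two_pos.le]
        gcongr
        exact norm_gradient_le hf x
    _ = ENNReal.ofReal ((Real.pi / 2 * K) ^ 2) := by simp

theorem variance_stdGaussian_le {K : ℝ≥0} {f : E → ℝ} (hf : LipschitzWith K f) :
    Var[f; stdGaussian E] ≤ Real.pi ^ 2 / 8 * K ^ 2 := by
  have hL2 := memLp_stdGaussian_of_lipschitzWith hf
  have hfst : MemLp (fun p : E × E => -f p.1) 2 ((stdGaussian E).prod (stdGaussian E)) :=
    hL2.neg.comp_measurePreserving measurePreserving_fst
  have hsnd : MemLp (fun p : E × E => f p.2) 2 ((stdGaussian E).prod (stdGaussian E)) :=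
    hL2.comp_measurePreserving measurePreserving_snd
  have hmean : ∫ p, (-f p.1 + f p.2) ∂(stdGaussian E).prod (stdGaussian E) = 0 := by
    rw [integral_add (hfst.integrable one_le_two) (hsnd.integrable one_le_two),
      integral_fun_fst (fun x => -f x), integral_fun_snd f, integral_neg]
    simp
  have hvar : Var[fun p : E × E => -f p.1 + f p.2; (stdGaussian E).prod (stdGaussian E)] =
      2 * Var[f; stdGaussian E] :=
    (variance_add_prod hL2.neg hL2).trans (by rw [variance_neg, two_mul])
  have h : eVar[fun p : E × E => -f p.1 + f p.2; (stdGaussian E).prod (stdGaussian E)] ≤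
      ENNReal.ofReal ((Real.pi / 2 * K) ^ 2) := by
    rw [evariance, hmean]
    simpa only [sub_zero, neg_add_eq_sub] using lintegral_enorm_sub_sq_le_of_lipschitzWith hf
  rw [← ofReal_variance (by exact hfst.add hsnd), ENNReal.ofReal_le_ofReal_iff (sq_nonneg _)] at h
  linarith [hvar.symm.trans_le h]

end GaussianPoincare

section HomogeneousExtension

variable {E : Type*} [NormedAddCommGroup E] [NormedSpace ℝ E]

/-- The positively homogeneous extension of the restriction of `h` to the unit sphere. It carries
estimates for Gaussian measures over to the uniform measure on the sphere. -/
noncomputable def homExtension (h : E → ℝ) (x : E) : ℝ := ‖x‖ * h (‖x‖⁻¹ • x)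

lemma odd_homExtension {h : E → ℝ} (hodd : h.Odd) : (homExtension h).Odd := fun x => by
  simp [homExtension, hodd (‖x‖⁻¹ • x)]

lemma norm_inv_norm_smul_le (x : E) : ‖‖x‖⁻¹ • x‖ ≤ 1 := by
  rw [norm_smul, norm_inv, norm_norm]
  exact inv_mul_le_one

lemma norm_smul_inv_norm_smul (x : E) : ‖x‖ • ‖x‖⁻¹ • x = x := by
  rcases eq_or_ne x 0 with rfl | hx
  · simp
  · exact smul_inv_smul₀ (norm_ne_zero_iff.2 hx) x

lemma norm_mul_norm_inv_norm_smul_sub_le (x y : E) :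
    ‖y‖ * ‖‖x‖⁻¹ • x - ‖y‖⁻¹ • y‖ ≤ 2 * ‖x - y‖ := by
  have h : ‖y‖ • (‖x‖⁻¹ • x - ‖y‖⁻¹ • y) = (‖y‖ - ‖x‖) • ‖x‖⁻¹ • x + (x - y) := by
    rw [smul_sub, sub_smul, norm_smul_inv_norm_smul, norm_smul_inv_norm_smul]
    abel
  calc ‖y‖ * ‖‖x‖⁻¹ • x - ‖y‖⁻¹ • y‖ = ‖(‖y‖ - ‖x‖) • ‖x‖⁻¹ • x + (x - y)‖ := by
        rw [← h, norm_smul, norm_norm]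
    _ ≤ |‖y‖ - ‖x‖| * ‖‖x‖⁻¹ • x‖ + ‖x - y‖ := by
        rw [← Real.norm_eq_abs, ← norm_smul]
        exact norm_add_le _ _
    _ ≤ ‖x - y‖ * 1 + ‖x - y‖ := by
        gcongr
        · exact abs_sub_comm ‖y‖ ‖x‖ ▸ abs_norm_sub_norm_le x y
        · exact norm_inv_norm_smul_le x
    _ = 2 * ‖x - y‖ := by ring

lemma lipschitzWith_homExtension {L : ℝ≥0} {h : E → ℝ} (hL : LipschitzWith L h) (h0 : h 0 = 0) :
    LipschitzWith (3 * L) (homExtension h) := by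
  refine LipschitzWith.of_dist_le_mul fun x y => ?_
  have hbound : |h (‖x‖⁻¹ • x)| ≤ L := by
    simpa [h0] using (hL.norm_sub_le (‖x‖⁻¹ • x) 0).trans
      (mul_le_of_le_one_right L.2 (by simpa using norm_inv_norm_smul_le x))
  rw [Real.dist_eq, dist_eq_norm]
  calc |homExtension h x - homExtension h y|
      = |(‖x‖ - ‖y‖) * h (‖x‖⁻¹ • x) + ‖y‖ * (h (‖x‖⁻¹ • x) - h (‖y‖⁻¹ • y))| := by
        simp only [homExtension]
        ring_nf
    _ ≤ |‖x‖ - ‖y‖| * |h (‖x‖⁻¹ • x)| + ‖y‖ * |h (‖x‖⁻¹ • x) - h (‖y‖⁻¹ • y)| := by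
        refine (abs_add_le _ _).trans_eq ?_
        rw [abs_mul, abs_mul, abs_norm]
    _ ≤ ‖x - y‖ * L + ‖y‖ * (L * ‖‖x‖⁻¹ • x - ‖y‖⁻¹ • y‖) := by
        gcongr
        · exact abs_norm_sub_norm_le x y
        · exact hL.norm_sub_le _ _
    _ ≤ (3 * L : ℝ≥0) * ‖x - y‖ := by
        push_cast
        nlinarith [mul_le_mul_of_nonneg_left (norm_mul_norm_inv_norm_smul_sub_le x y) L.coe_nonneg]

end HomogeneousExtension

section SphericalVariance

variable {E : Type*} [NormedAddCommGroup E] [InnerProductSpace ℝ E] [FiniteDimensional ℝ E]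
  [MeasurableSpace E] [BorelSpace E]

lemma integral_stdGaussian_of_odd {f : E → ℝ} (hf : f.Odd) : ∫ x, f x ∂stdGaussian E = 0 := by
  have h : ∫ x, gaussianDensity (-x) * f (-x) = ∫ x, gaussianDensity x * f x :=
    integral_neg_eq_self (fun x : E => gaussianDensity x * f x) volume
  simp only [gaussianDensity, norm_neg, hf _, mul_neg, integral_neg] at h
  simp only [integral_stdGaussian, gaussianDensity]
  linarith

lemma integral_homExtension_sq_stdGaussian [Nontrivial E] (h : E → ℝ) :
    ∫ x, homExtension h x ^ 2 ∂stdGaussian E =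
      (⨍ u, h (u : E) ^ 2 ∂(volume : Measure E).toSphere) * Module.finrank ℝ E := by
  rw [← integral_norm_sq_stdGaussian, integral_stdGaussian, integral_stdGaussian]
  refine (integral_congr_ae (ae_of_all _ fun x => ?_)).trans
    (integral_radial_mul_angular (volume : Measure E) (fun r =>
      (2 * Real.pi) ^ (-(Module.finrank ℝ E / 2 : ℝ)) * Real.exp (-(1 / 2) * r ^ 2) * r ^ 2)
      fun u => h u ^ 2)
  simp only [homExtension, gaussianDensity]
  ring

theorem finrank_mul_average_toSphere_sq_le [Nontrivial E] {L : ℝ≥0} {h : E → ℝ}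
    (hL : LipschitzWith L h) (hodd : h.Odd) :
    Module.finrank ℝ E * ⨍ u, h (u : E) ^ 2 ∂(volume : Measure E).toSphere ≤ 12 * L ^ 2 := by
  have hf := lipschitzWith_homExtension hL hodd.map_zero
  calc Module.finrank ℝ E * ⨍ u, h (u : E) ^ 2 ∂(volume : Measure E).toSphere
      = Var[homExtension h; stdGaussian E] := by
        rw [variance_of_integral_eq_zero hf.continuous.measurable.aemeasurable
          (integral_stdGaussian_of_odd (odd_homExtension hodd)),
          integral_homExtension_sq_stdGaussian, mul_comm]
    _ ≤ Real.pi ^ 2 / 8 * (3 * L : ℝ≥0) ^ 2 := variance_stdGaussian_le hf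
    _ ≤ 12 * L ^ 2 := by
        have hpi : Real.pi ^ 2 ≤ 3.15 ^ 2 := by gcongr; exact Real.pi_lt_d2.le
        push_cast
        nlinarith [sq_nonneg (L : ℝ)]

end SphericalVariance

section SphereUniform

variable {m : ℕ}

lemma nontrivial_vec (hm : 0 < m) : Nontrivial (Vec m) :=
  Module.nontrivial_of_finrank_pos (R := ℝ) (by simpa using hm)

lemma isProbabilityMeasure_sphereUniform (hm : 0 < m) :
    IsProbabilityMeasure (sphereUniform m) := by
  have := nontrivial_vec hm
  have : NeZero (volume : Measure (Vec m)).toSphere := ⟨Measure.toSphere_ne_zero _⟩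
  exact Measure.isProbabilityMeasure_map measurable_subtype_coe.aemeasurable

lemma ae_norm_sphereUniform : ∀ᵐ u ∂(sphereUniform m), ‖u‖ = 1 :=
  (ae_map_iff measurable_subtype_coe.aemeasurable
    (measurableSet_eq_fun measurable_norm measurable_const)).2
    (ae_of_all _ fun u => norm_eq_of_mem_sphere u)

lemma integral_sphereUniform (f : Vec m → ℝ) :
    ∫ u, f u ∂(sphereUniform m) = ⨍ u, f (u : Vec m) ∂(volume : Measure (Vec m)).toSphere :=
  (MeasurableEmbedding.subtype_coe Metric.isClosed_sphere.measurableSet).integral_map f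

theorem integral_sphereUniform_sq_le (hm : 0 < m) {L : ℝ≥0} {h : Vec m → ℝ}
    (hL : LipschitzWith L h) (hodd : h.Odd) :
    m * ∫ u, h u ^ 2 ∂(sphereUniform m) ≤ 12 * L ^ 2 := by
  have := nontrivial_vec hm
  simpa [integral_sphereUniform] using finrank_mul_average_toSphere_sq_le hL hodd

end SphereUniform

section WeaklyConvex

variable {E : Type*} [NormedAddCommGroup E]

lemma strongConvexOn_apply_add_smul_le [NormedSpace ℝ E] {ψ : E → ℝ} {c : ℝ}
    (h : StrongConvexOn Set.univ c ψ) (x y : E) {t : ℝ} (h0 : 0 ≤ t) (h1 : t ≤ 1) :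
    ψ (x + t • (y - x)) ≤ t * ψ y + (1 - t) * ψ x - t * (1 - t) * (c / 2 * ‖y - x‖ ^ 2) := by
  have e : x + t • (y - x) = t • y + (1 - t) • x := by
    rw [smul_sub, sub_smul, one_smul]
    abel
  rw [e]
  exact h.2 (Set.mem_univ y) (Set.mem_univ x) h0 (sub_nonneg.2 h1) (by ring)

lemma le_of_forall_one_sub_mul_le {a b : ℝ} (h : ∀ t : ℝ, 0 < t → t < 1 → (1 - t) * a ≤ b) :
    a ≤ b := by
  have hl : Tendsto (fun t : ℝ => (1 - t) * a) (𝓝[>] 0) (𝓝 a) :=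
    Continuous.tendsto' (by fun_prop) _ _ (by ring) |>.mono_left nhdsWithin_le_nhds
  refine le_of_tendsto hl ?_
  filter_upwards [Ioo_mem_nhdsGT zero_lt_one] with t ht using h t ht.1 ht.2

lemma strongConvexOn_add_inner_gradient_le [InnerProductSpace ℝ E] [CompleteSpace E] {ψ : E → ℝ}
    {c : ℝ} (h : StrongConvexOn Set.univ c ψ) {x : E} (hx : DifferentiableAt ℝ ψ x) (y : E) :
    ψ x + inner ℝ (∇ ψ x) (y - x) + c / 2 * ‖y - x‖ ^ 2 ≤ ψ y := by
  have hslope := (hx.hasFDerivAt.hasLineDerivAt (y - x)).tendsto_slope_zero_right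
  have hbound : Tendsto (fun t : ℝ => ψ y - ψ x - (1 - t) * (c / 2 * ‖y - x‖ ^ 2)) (𝓝[>] 0)
      (𝓝 (ψ y - ψ x - c / 2 * ‖y - x‖ ^ 2)) :=
    Continuous.tendsto' (by fun_prop) _ _ (by ring) |>.mono_left nhdsWithin_le_nhds
  have hle := le_of_tendsto_of_tendsto hslope hbound (by
    filter_upwards [Ioc_mem_nhdsGT zero_lt_one] with t ht
    rw [smul_eq_mul, inv_mul_le_iff₀ ht.1]
    linarith [strongConvexOn_apply_add_smul_le h x y ht.1.le ht.2])
  rw [inner_gradient_left]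
  linarith

end WeaklyConvex

section Differences

variable {E : Type*} [NormedAddCommGroup E]

section

variable [NormedSpace ℝ E] {φ : E → ℝ} {M : ℝ≥0}

lemma abs_apply_add_smul_sub_le (hφ : LipschitzWith M φ) (ε : ℝ) (x : E) {b : E} (hb : ‖b‖ ≤ 1) :
    |φ (x + ε • b) - φ x| ≤ M * |ε| := by
  have h := hφ.norm_sub_le (x + ε • b) x
  rw [add_sub_cancel_left, norm_smul] at h
  exact h.trans (by gcongr; exact mul_le_of_le_one_right (abs_nonneg ε) hb)

lemma lipschitzWith_centralDifference (hφ : LipschitzWith M φ) (ε : ℝ) (x : E) :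
    LipschitzWith (2 * M * ‖ε‖₊) fun u : E => φ (x + ε • u) - φ (x - ε • u) := by
  have hadd := (hφ.comp (isometry_add_left x).lipschitz).comp (lipschitzWith_smul (β := E) ε)
  have hsub := (hφ.comp (IsometryEquiv.subLeft x).isometry.lipschitz).comp
    (lipschitzWith_smul (β := E) ε)
  rw [show 2 * M * ‖ε‖₊ = M * 1 * ‖ε‖₊ + M * 1 * ‖ε‖₊ by ring]
  exact hadd.sub hsub

end

variable [InnerProductSpace ℝ E] [CompleteSpace E] {φ : E → ℝ}

lemma gradient_neg (φ : E → ℝ) (x : E) : ∇ (-φ) x = -∇ φ x := by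
  simp only [gradient, fderiv_neg, map_neg]

lemma lineDeriv_centralDifference {ε : ℝ} {x b : E} (hadd : DifferentiableAt ℝ φ (x + ε • b))
    (hsub : DifferentiableAt ℝ φ (x - ε • b)) (v : E) :
    lineDeriv ℝ (fun u => φ (x + ε • u) - φ (x - ε • u)) b v =
      ε * inner ℝ (∇ φ (x + ε • b)) v + ε * inner ℝ (∇ φ (x - ε • b)) v := by
  have hid : HasFDerivAt (fun u : E => ε • u) (ε • ContinuousLinearMap.id ℝ E) b :=
    (hasFDerivAt_id b).const_smul ε
  have h := (hadd.hasFDerivAt.comp b (hid.const_add x)).sub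
    (hsub.hasFDerivAt.comp b (hid.const_sub x))
  refine (h.hasLineDerivAt v).lineDeriv.trans ?_
  simp [inner_gradient_left]

end Differences

section BallUniform

variable {E : Type*} [NormedAddCommGroup E] [InnerProductSpace ℝ E] [FiniteDimensional ℝ E]
  [MeasurableSpace E] [BorelSpace E]

variable (E) in
/-- The uniform distribution on the closed unit ball. -/
noncomputable def ballUniform : Measure E := (volume : Measure E)[|Metric.closedBall 0 1]

instance : IsProbabilityMeasure (ballUniform E) :=
  cond_isProbabilityMeasure_of_finite (Metric.measure_closedBall_pos _ _ one_pos).ne'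
    measure_closedBall_lt_top.ne

lemma ballUniform_absolutelyContinuous : ballUniform E ≪ volume := cond_absolutelyContinuous

lemma ae_norm_ballUniform : ∀ᵐ b ∂(ballUniform E), ‖b‖ ≤ 1 :=
  (ae_cond_mem Metric.isClosed_closedBall.measurableSet).mono fun _ hb => by simpa using hb

lemma integral_ballUniform_neg (f : E → ℝ) :
    ∫ b, f (-b) ∂(ballUniform E) = ∫ b, f b ∂(ballUniform E) := by
  have h := (Measure.measurePreserving_neg (volume : Measure E)).setIntegral_preimage_emb
    (MeasurableEquiv.neg E).measurableEmbedding f (Metric.closedBall 0 1)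
  rw [ballUniform, ProbabilityTheory.cond, integral_smul_measure, integral_smul_measure, ← h]
  simp

lemma integral_ballUniform_lineDeriv [Nontrivial E] {C : ℝ≥0} {f : E → ℝ}
    (hf : LipschitzWith C f) (v : E) :
    ∫ b, lineDeriv ℝ f b v ∂(ballUniform E) = Module.finrank ℝ E *
      ⨍ u, f (u : E) * inner ℝ (u : E) v ∂(volume : Measure E).toSphere := by
  have hvol : volume (Metric.closedBall (0 : E) 1) = volume (Metric.ball (0 : E) 1) :=
    Measure.addHaar_unitClosedBall_eq_addHaar_unitBall _
  have hne : volume.real (Metric.ball (0 : E) 1) ≠ 0 :=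
    (measureReal_ne_zero_iff measure_ball_lt_top.ne).2 (Metric.measure_ball_pos _ _ one_pos).ne'
  rw [ballUniform, ProbabilityTheory.cond, integral_smul_measure,
    integral_closedBall_lineDeriv volume hf, average_eq, Measure.toSphere_real_apply_univ, hvol,
    ENNReal.toReal_inv, ← measureReal_def, smul_eq_mul, smul_eq_mul]
  have hdim : (Module.finrank ℝ E : ℝ) ≠ 0 := Nat.cast_ne_zero.2 Module.finrank_pos.ne'
  field_simp

end BallUniform

section Smoothing

variable {E : Type*} [NormedAddCommGroup E] [InnerProductSpace ℝ E] [FiniteDimensional ℝ E]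
  [MeasurableSpace E] [BorelSpace E] {φ : E → ℝ} {M : ℝ≥0} {ρ ε : ℝ}

/-- The average of `φ` over the ball of radius `ε` around `x`. -/
noncomputable def smoothing (φ : E → ℝ) (ε : ℝ) (x : E) : ℝ :=
  ∫ b, φ (x + ε • b) ∂(ballUniform E)

/-- The average gradient of `φ` over the ball of radius `ε` around `x`, which is what the two-point
estimator computes in expectation. -/
noncomputable def smoothingGradient (φ : E → ℝ) (ε : ℝ) (x : E) : E :=
  ∫ b, ∇ φ (x + ε • b) ∂(ballUniform E)

lemma ae_volume_differentiableAt_add_smul (hφ : LipschitzWith M φ) (hε : ε ≠ 0) (x : E) :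
    ∀ᵐ b, DifferentiableAt ℝ φ (x + ε • b) :=
  ((quasiMeasurePreserving_add_left volume x).comp
    (Measure.quasiMeasurePreserving_smul volume hε)).ae hφ.ae_differentiableAt

lemma ae_differentiableAt_add_smul (hφ : LipschitzWith M φ) (hε : ε ≠ 0) (x : E) :
    ∀ᵐ b ∂(ballUniform E), DifferentiableAt ℝ φ (x + ε • b) :=
  ballUniform_absolutelyContinuous.ae_le (ae_volume_differentiableAt_add_smul hφ hε x)

lemma integrable_gradient_add_smul (hφ : LipschitzWith M φ) (ε : ℝ) (x : E) :
    Integrable (fun b => ∇ φ (x + ε • b)) (ballUniform E) :=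
  .of_bound (((measurable_gradient φ).comp (by fun_prop)).aestronglyMeasurable) M
    (ae_of_all _ fun _ => norm_gradient_le hφ _)

lemma integrable_add_smul (hφ : LipschitzWith M φ) (ε : ℝ) (x : E) :
    Integrable (fun b => φ (x + ε • b)) (ballUniform E) := by
  have hcont := hφ.continuous
  have hsub : Integrable (fun b => φ (x + ε • b) - φ x) (ballUniform E) :=
    .of_bound (Continuous.aestronglyMeasurable (by fun_prop)) (M * |ε|)
      (ae_norm_ballUniform.mono fun b hb => abs_apply_add_smul_sub_le hφ ε x hb)
  exact (hsub.add (integrable_const (φ x))).congr (ae_of_all _ fun b => sub_add_cancel _ _)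

lemma abs_smoothing_sub_le (hφ : LipschitzWith M φ) (ε : ℝ) (x : E) :
    |smoothing φ ε x - φ x| ≤ M * |ε| := by
  have e : smoothing φ ε x - φ x = ∫ b, (φ (x + ε • b) - φ x) ∂(ballUniform E) := by
    simp [smoothing, integral_sub (integrable_add_smul hφ ε x) (integrable_const _)]
  rw [e]
  simpa using norm_integral_le_of_norm_le_const (μ := ballUniform E) (f := fun b =>
    φ (x + ε • b) - φ x) (ae_norm_ballUniform.mono fun b hb => abs_apply_add_smul_sub_le hφ ε x hb)

lemma lipschitzWith_smoothing (hφ : LipschitzWith M φ) (ε : ℝ) :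
    LipschitzWith M (smoothing φ ε) := by
  refine LipschitzWith.of_dist_le_mul fun x y => ?_
  rw [dist_eq_norm, smoothing, smoothing,
    ← integral_sub (integrable_add_smul hφ ε x) (integrable_add_smul hφ ε y)]
  simpa using norm_integral_le_of_norm_le_const (μ := ballUniform E) (f := fun b =>
    φ (x + ε • b) - φ (y + ε • b)) (ae_of_all _ fun b => by
      simpa [← dist_eq_norm] using hφ.norm_sub_le (x + ε • b) (y + ε • b))

lemma measurable_smoothingGradient (φ : E → ℝ) (ε : ℝ) : Measurable (smoothingGradient φ ε) := by
  have h : StronglyMeasurable fun p : E × E => ∇ φ (p.1 + ε • p.2) :=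
    ((measurable_gradient φ).comp (by fun_prop)).stronglyMeasurable
  exact h.integral_prod_right.measurable

lemma inner_smoothingGradient (hφ : LipschitzWith M φ) (ε : ℝ) (x v : E) :
    inner ℝ (smoothingGradient φ ε x) v = ∫ b, inner ℝ (∇ φ (x + ε • b)) v ∂(ballUniform E) := by
  rw [real_inner_comm, smoothingGradient, ← integral_inner (integrable_gradient_add_smul hφ ε x)]
  simp only [real_inner_comm]

lemma smoothing_add_inner_le (hφ : LipschitzWith M φ) (hc : StrongConvexOn Set.univ (-ρ) φ)
    (hε : ε ≠ 0) (x y : E) :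
    smoothing φ ε x + inner ℝ (smoothingGradient φ ε x) (y - x) - ρ / 2 * ‖y - x‖ ^ 2 ≤
      smoothing φ ε y := by
  have hval := integrable_add_smul hφ ε x
  have hinner : Integrable (fun b => inner ℝ (∇ φ (x + ε • b)) (y - x)) (ballUniform E) :=
    (integrable_gradient_add_smul hφ ε x).inner_const _
  have e : smoothing φ ε x + inner ℝ (smoothingGradient φ ε x) (y - x) - ρ / 2 * ‖y - x‖ ^ 2 =
      ∫ b, (φ (x + ε • b) + inner ℝ (∇ φ (x + ε • b)) (y - x) - ρ / 2 * ‖y - x‖ ^ 2)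
        ∂(ballUniform E) := by
    rw [integral_sub (by exact hval.add hinner) (integrable_const _), integral_add hval hinner,
      inner_smoothingGradient hφ]
    simp [smoothing]
  rw [e]
  refine integral_mono_ae ((hval.add hinner).sub (integrable_const _))
    (integrable_add_smul hφ ε y) ?_
  filter_upwards [ae_differentiableAt_add_smul hφ hε x] with b hb
  have h := strongConvexOn_add_inner_gradient_le hc hb (y + ε • b)
  rw [add_sub_add_right_eq_sub] at h
  linarith

lemma add_inner_smoothingGradient_le (hφ : LipschitzWith M φ)
    (hc : StrongConvexOn Set.univ (-ρ) φ) (hε : 0 < ε) (x y : E) :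
    φ x + inner ℝ (smoothingGradient φ ε x) (y - x) - ρ / 2 * ‖y - x‖ ^ 2 - 2 * M * ε ≤ φ y := by
  have h := smoothing_add_inner_le hφ hc hε.ne' x y
  have hx := abs_le.1 (abs_smoothing_sub_le hφ ε x)
  have hy := abs_le.1 (abs_smoothing_sub_le hφ ε y)
  rw [abs_of_pos hε] at hx hy
  linarith [hx.1, hy.2]

lemma smoothing_neg (φ : E → ℝ) (ε : ℝ) (x : E) : smoothing (-φ) ε x = -smoothing φ ε x := by
  simp [smoothing, integral_neg]

lemma smoothingGradient_neg (φ : E → ℝ) (ε : ℝ) (x : E) :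
    smoothingGradient (-φ) ε x = -smoothingGradient φ ε x := by
  simp [smoothingGradient, gradient_neg, integral_neg]

lemma finrank_mul_average_centralDifference_mul_inner [Nontrivial E] (hφ : LipschitzWith M φ)
    (hε : ε ≠ 0) (x v : E) :
    Module.finrank ℝ E * ⨍ u, (φ (x + ε • (u : E)) - φ (x - ε • (u : E))) * inner ℝ (u : E) v
      ∂(volume : Measure E).toSphere = 2 * ε * inner ℝ (smoothingGradient φ ε x) v := by
  have hadd : Integrable (fun b => inner ℝ (∇ φ (x + ε • b)) v) (ballUniform E) :=
    (integrable_gradient_add_smul hφ ε x).inner_const _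
  have hsub : Integrable (fun b => inner ℝ (∇ φ (x - ε • b)) v) (ballUniform E) := by
    simpa [sub_eq_add_neg] using
      (integrable_gradient_add_smul hφ (-ε) x).inner_const (𝕜 := ℝ) v
  have hsymm : ∫ b, inner ℝ (∇ φ (x - ε • b)) v ∂(ballUniform E) =
      ∫ b, inner ℝ (∇ φ (x + ε • b)) v ∂(ballUniform E) := by
    rw [← integral_ballUniform_neg fun b => inner ℝ (∇ φ (x + ε • b)) v]
    simp only [smul_neg, sub_eq_add_neg]
  have hderiv : ∫ b, lineDeriv ℝ (fun u => φ (x + ε • u) - φ (x - ε • u)) b v ∂(ballUniform E) =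
      ∫ b, (ε * inner ℝ (∇ φ (x + ε • b)) v + ε * inner ℝ (∇ φ (x - ε • b)) v)
        ∂(ballUniform E) := by
    refine integral_congr_ae ?_
    filter_upwards [ae_differentiableAt_add_smul hφ hε x,
      ae_differentiableAt_add_smul hφ (neg_ne_zero.2 hε) x] with b hb hb'
    rw [neg_smul, ← sub_eq_add_neg] at hb'
    exact lineDeriv_centralDifference hb hb' v
  rw [← integral_ballUniform_lineDeriv (lipschitzWith_centralDifference hφ ε x) v, hderiv,
    integral_add (hadd.const_mul ε) (hsub.const_mul ε), integral_const_mul, integral_const_mul,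
    hsymm, inner_smoothingGradient hφ]
  ring

end Smoothing

section Estimator

variable {m : ℕ} {φ A : Vec m → ℝ} {M : ℝ≥0} {ε w : ℝ} {u : Vec m}

lemma measurable_estimator (hA : Measurable A) (ε : ℝ) :
    Measurable fun p : Vec m × Vec m => estimator A ε p.1 p.2 := by
  unfold estimator
  fun_prop

lemma norm_estimator_exact_le (hφ : LipschitzWith M φ) (hε : 0 < ε) (x : Vec m) (hu : ‖u‖ = 1) :
    ‖estimator φ ε x u‖ ≤ m * M := by
  have h : |φ (x + ε • u) - φ (x - ε • u)| ≤ 2 * M * ε := by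
    simpa [hu, abs_of_pos hε] using (lipschitzWith_centralDifference hφ ε x).norm_sub_le u 0
  rw [estimator, norm_smul, hu, mul_one, norm_mul, Real.norm_of_nonneg (by positivity),
    Real.norm_eq_abs]
  calc _ ≤ (m : ℝ) / (2 * ε) * (2 * M * ε) := by gcongr
    _ = m * M := by field_simp

lemma norm_estimator_sub_le (hA : IsSubroutine φ w A) (hε : 0 < ε) (x : Vec m) (hu : ‖u‖ = 1) :
    ‖estimator A ε x u - estimator φ ε x u‖ ≤ m * w / ε := by
  have h : |A (x + ε • u) - A (x - ε • u) - (φ (x + ε • u) - φ (x - ε • u))| ≤ 2 * w := by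
    rw [sub_sub_sub_comm, two_mul]
    exact (abs_sub _ _).trans (add_le_add (hA.accurate _) (hA.accurate _))
  rw [estimator, estimator, ← sub_smul, ← mul_sub, norm_smul, hu, mul_one, norm_mul,
    Real.norm_of_nonneg (by positivity), Real.norm_eq_abs]
  calc _ ≤ (m : ℝ) / (2 * ε) * (2 * w) := by gcongr
    _ = m * w / ε := by field_simp

lemma norm_estimator_le (hφ : LipschitzWith M φ) (hA : IsSubroutine φ w A) (hε : 0 < ε)
    (x : Vec m) (hu : ‖u‖ = 1) : ‖estimator A ε x u‖ ≤ m * M + m * w / ε :=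
  norm_le_norm_add_norm_sub' _ (estimator φ ε x u) |>.trans <|
    add_le_add (norm_estimator_exact_le hφ hε x hu) (norm_estimator_sub_le hA hε x hu)

lemma isSubroutine_self (hφ : Measurable φ) : IsSubroutine φ 0 φ := ⟨hφ, by simp⟩

lemma memLp_estimator (hm : 0 < m) (hφ : LipschitzWith M φ) (hA : IsSubroutine φ w A)
    (hε : 0 < ε) (x : Vec m) (p : ℝ≥0∞) :
    MemLp (fun u => estimator A ε x u) p (sphereUniform m) := by
  have := isProbabilityMeasure_sphereUniform hm
  refine MemLp.of_bound ?_ (m * M + m * w / ε)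
    (ae_norm_sphereUniform.mono fun u hu => norm_estimator_le hφ hA hε x hu)
  exact ((measurable_estimator hA.measurable ε).comp measurable_prodMk_left).aestronglyMeasurable

lemma integrable_estimator (hm : 0 < m) (hφ : LipschitzWith M φ) (hA : IsSubroutine φ w A)
    (hε : 0 < ε) (x : Vec m) :
    Integrable (fun u => estimator A ε x u) (sphereUniform m) :=
  memLp_one_iff_integrable.1 (memLp_estimator hm hφ hA hε x 1)

lemma integrable_norm_estimator_sq (hm : 0 < m) (hφ : LipschitzWith M φ)
    (hA : IsSubroutine φ w A) (hε : 0 < ε) (x : Vec m) :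
    Integrable (fun u => ‖estimator A ε x u‖ ^ 2) (sphereUniform m) :=
  (memLp_estimator hm hφ hA hε x 2).integrable_norm_pow two_ne_zero

lemma integral_estimator_exact (hm : 0 < m) (hφ : LipschitzWith M φ) (hε : 0 < ε) (x : Vec m) :
    ∫ u, estimator φ ε x u ∂(sphereUniform m) = smoothingGradient φ ε x := by
  have := nontrivial_vec hm
  have hint := integrable_estimator hm hφ (isSubroutine_self hφ.continuous.measurable) hε x
  refine ext_inner_right ℝ fun v => ?_
  have h := finrank_mul_average_centralDifference_mul_inner hφ hε.ne' x v
  have hinner (u : Vec m) : inner ℝ v (estimator φ ε x u) =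
      (m : ℝ) / (2 * ε) * ((φ (x + ε • u) - φ (x - ε • u)) * inner ℝ u v) := by
    rw [estimator, real_inner_smul_right, real_inner_comm, mul_assoc]
  rw [finrank_euclideanSpace_fin, ← integral_sphereUniform fun u : Vec m =>
    (φ (x + ε • u) - φ (x - ε • u)) * inner ℝ u v] at h
  rw [real_inner_comm, ← integral_inner hint]
  simp only [hinner]
  rw [integral_const_mul, div_mul_eq_mul_div, h]
  field_simp

lemma norm_integral_estimator_sub_le (hm : 0 < m) (hφ : LipschitzWith M φ)
    (hA : IsSubroutine φ w A) (hε : 0 < ε) (x : Vec m) :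
    ‖(∫ u, estimator A ε x u ∂(sphereUniform m)) - smoothingGradient φ ε x‖ ≤ m * w / ε := by
  have := isProbabilityMeasure_sphereUniform hm
  rw [← integral_estimator_exact hm hφ hε, ← integral_sub (integrable_estimator hm hφ hA hε x)
    (integrable_estimator hm hφ (isSubroutine_self hφ.continuous.measurable) hε x)]
  simpa using norm_integral_le_of_norm_le_const
    (ae_norm_sphereUniform.mono fun u hu => norm_estimator_sub_le hA hε x hu)

lemma integral_norm_estimator_exact_sq_le (hm : 0 < m) (hφ : LipschitzWith M φ) (hε : 0 < ε)
    (x : Vec m) : ∫ u, ‖estimator φ ε x u‖ ^ 2 ∂(sphereUniform m) ≤ 12 * m * (M : ℝ) ^ 2 := by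
  have h := integral_sphereUniform_sq_le hm (lipschitzWith_centralDifference hφ ε x)
    fun u => by simp [← sub_eq_add_neg]
  have hsq : ∀ᵐ u ∂(sphereUniform m), ‖estimator φ ε x u‖ ^ 2 =
      ((m : ℝ) / (2 * ε)) ^ 2 * (φ (x + ε • u) - φ (x - ε • u)) ^ 2 :=
    ae_norm_sphereUniform.mono fun u hu => by
      rw [estimator, norm_smul, hu, mul_one, Real.norm_eq_abs, sq_abs, mul_pow]
  rw [integral_congr_ae hsq, integral_const_mul]
  calc ((m : ℝ) / (2 * ε)) ^ 2 * ∫ u, (φ (x + ε • u) - φ (x - ε • u)) ^ 2 ∂(sphereUniform m)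
      = (m : ℝ) / (2 * ε) ^ 2 *
          (m * ∫ u, (φ (x + ε • u) - φ (x - ε • u)) ^ 2 ∂(sphereUniform m)) := by ring
    _ ≤ (m : ℝ) / (2 * ε) ^ 2 * (12 * (2 * M * ‖ε‖₊ : ℝ≥0) ^ 2) := by gcongr
    _ = 12 * m * (M : ℝ) ^ 2 := by
        push_cast
        rw [Real.norm_of_nonneg hε.le]
        field_simp

lemma integral_norm_estimator_sq_le (hm : 0 < m) (hφ : LipschitzWith M φ)
    (hA : IsSubroutine φ w A) (hε : 0 < ε) (x : Vec m) :
    ∫ u, ‖estimator A ε x u‖ ^ 2 ∂(sphereUniform m) ≤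
      24 * m * (M : ℝ) ^ 2 + 2 * (m * w / ε) ^ 2 := by
  have := isProbabilityMeasure_sphereUniform hm
  have hint := integrable_norm_estimator_sq hm hφ
    (isSubroutine_self hφ.continuous.measurable) hε x
  calc ∫ u, ‖estimator A ε x u‖ ^ 2 ∂(sphereUniform m)
      ≤ ∫ u, (2 * ‖estimator φ ε x u‖ ^ 2 + 2 * (m * w / ε) ^ 2) ∂(sphereUniform m) := by
        refine integral_mono_ae (integrable_norm_estimator_sq hm hφ hA hε x)
          ((hint.const_mul 2).add (integrable_const _)) ?_
        filter_upwards [ae_norm_sphereUniform] with u hu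
        have hle := (norm_le_norm_add_norm_sub' (estimator A ε x u) (estimator φ ε x u)).trans
          (add_le_add_right (norm_estimator_sub_le hA hε x hu) _)
        exact (pow_le_pow_left₀ (norm_nonneg _) hle 2).trans (add_sq_le.trans_eq (mul_add _ _ _))
    _ = 2 * ∫ u, ‖estimator φ ε x u‖ ^ 2 ∂(sphereUniform m) + 2 * (m * w / ε) ^ 2 := by
        rw [integral_add (hint.const_mul 2) (integrable_const _), integral_const_mul]
        simp
    _ ≤ _ := by linarith [integral_norm_estimator_exact_sq_le hm hφ hε x]

lemma neg_inner_integral_estimator_le (hm : 0 < m) (hφ : LipschitzWith M φ)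
    (hA : IsSubroutine φ w A) (hε : 0 < ε) (x d : Vec m) :
    -inner ℝ d (∫ u, estimator A ε x u ∂(sphereUniform m)) ≤
      -inner ℝ d (smoothingGradient φ ε x) + m * w / ε * ‖d‖ := by
  have h := (abs_le.1 (abs_real_inner_le_norm d
    ((∫ u, estimator A ε x u ∂(sphereUniform m)) - smoothingGradient φ ε x))).1
  rw [inner_sub_right] at h
  linarith [mul_le_mul_of_nonneg_left (norm_integral_estimator_sub_le hm hφ hA hε x)
    (norm_nonneg d)]

lemma integrable_comp_step (hm : 0 < m) (hφ : LipschitzWith M φ) (hA : IsSubroutine φ w A)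
    (hε : 0 < ε) {V : Vec m → ℝ} (hV : Continuous V) (η : ℝ) (x : Vec m) :
    Integrable (fun u => V (x - η • estimator A ε x u)) (sphereUniform m) := by
  have := isProbabilityMeasure_sphereUniform hm
  have hmeas : Measurable fun u : Vec m => estimator A ε x u :=
    (measurable_estimator hA.measurable ε).comp measurable_prodMk_left
  have hball := isCompact_closedBall x (|η| * (m * M + m * w / ε))
  obtain ⟨K, hK⟩ := hball.exists_bound_of_continuousOn hV.continuousOn
  refine .of_bound (hV.measurable.comp (by fun_prop)).aestronglyMeasurable K ?_
  filter_upwards [ae_norm_sphereUniform] with u hu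
  refine hK _ ?_
  rw [mem_closedBall_iff_norm, sub_sub_cancel_left, norm_neg, norm_smul, Real.norm_eq_abs]
  gcongr
  exact norm_estimator_le hφ hA hε x hu

lemma integral_comp_step_le (hm : 0 < m) (hφ : LipschitzWith M φ) (hA : IsSubroutine φ w A)
    (hε : 0 < ε) {V : Vec m → ℝ} (hV : Continuous V) {c η : ℝ} (hc : 0 ≤ c) (hη : 0 ≤ η)
    {x d : Vec m} (hmodel : ∀ y, V y ≤ V x + inner ℝ d (y - x) + c / 2 * ‖y - x‖ ^ 2) :
    ∫ u, V (x - η • estimator A ε x u) ∂(sphereUniform m) ≤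
      V x - η * inner ℝ d (smoothingGradient φ ε x) + η * (m * w / ε) * ‖d‖ +
        c * η ^ 2 / 2 * (24 * m * (M : ℝ) ^ 2 + 2 * (m * w / ε) ^ 2) := by
  have := isProbabilityMeasure_sphereUniform hm
  have hint := integrable_estimator hm hφ hA hε x
  have hlin := (integrable_const (V x)).sub ((hint.const_inner (𝕜 := ℝ) d).const_mul η)
  have hquad := (integrable_norm_estimator_sq hm hφ hA hε x).const_mul (c * η ^ 2 / 2)
  calc ∫ u, V (x - η • estimator A ε x u) ∂(sphereUniform m)
      ≤ ∫ u, (V x - η * inner ℝ d (estimator A ε x u) +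
          c * η ^ 2 / 2 * ‖estimator A ε x u‖ ^ 2) ∂(sphereUniform m) := by
        refine integral_mono (integrable_comp_step hm hφ hA hε hV η x) (hlin.add hquad)
          fun u => (hmodel _).trans_eq ?_
        rw [sub_sub_cancel_left, inner_neg_right, real_inner_smul_right, norm_neg, norm_smul,
          mul_pow, Real.norm_eq_abs, sq_abs]
        ring
    _ = V x - η * inner ℝ d (∫ u, estimator A ε x u ∂(sphereUniform m)) +
          c * η ^ 2 / 2 * ∫ u, ‖estimator A ε x u‖ ^ 2 ∂(sphereUniform m) := by
        rw [integral_add (by exact hlin) hquad, integral_sub (integrable_const _)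
          ((hint.const_inner d).const_mul η), integral_const_mul, integral_const_mul,
          integral_inner hint]
        simp
    _ ≤ V x + η * (-inner ℝ d (smoothingGradient φ ε x) + m * w / ε * ‖d‖) +
          c * η ^ 2 / 2 * (24 * m * (M : ℝ) ^ 2 + 2 * (m * w / ε) ^ 2) := by
        rw [sub_eq_add_neg, ← mul_neg]
        gcongr
        · exact neg_inner_integral_estimator_le hm hφ hA hε x d
        · exact integral_norm_estimator_sq_le hm hφ hA hε x
    _ = _ := by ring

end Estimator

section Proximal

variable {E : Type*} [NormedAddCommGroup E] {ψ : E → ℝ} {M : ℝ≥0} {ρ c : ℝ} {x y z : E}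

/-- `z` is a proximal point of `ψ` at `x`: it minimizes `ψ` plus `c / 2` times the squared
distance to `x`. -/
def IsProximalPoint (c : ℝ) (ψ : E → ℝ) (x z : E) : Prop :=
  ∀ y, ψ z + c / 2 * ‖x - z‖ ^ 2 ≤ ψ y + c / 2 * ‖x - y‖ ^ 2

lemma exists_isProximalPoint [ProperSpace E] (hψ : LipschitzWith M ψ) (hc : 0 < c) (x : E) :
    ∃ z, IsProximalPoint c ψ x z := by
  have hcont : Continuous fun y => ψ y + c / 2 * ‖x - y‖ ^ 2 := by
    have := hψ.continuous
    fun_prop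
  have hx : x ∈ Metric.closedBall x (M / (c / 2)) := Metric.mem_closedBall_self (by positivity)
  obtain ⟨z, -, hz⟩ := (isCompact_closedBall x _).exists_isMinOn ⟨x, hx⟩ hcont.continuousOn
  refine ⟨z, fun y => ?_⟩
  by_cases hy : y ∈ Metric.closedBall x (M / (c / 2))
  · exact hz hy
  · have hzx : ψ z + c / 2 * ‖x - z‖ ^ 2 ≤ ψ x := by simpa using hz hx
    have hxy := (abs_le.1 (hψ.norm_sub_le x y)).2
    rw [mem_closedBall_iff_norm', not_le, div_lt_iff₀ (half_pos hc)] at hy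
    nlinarith [norm_nonneg (x - y)]

variable [InnerProductSpace ℝ E]

lemma norm_sub_add_smul_sq (x y z : E) (t : ℝ) :
    ‖x - (z + t • (y - z))‖ ^ 2 =
      t * ‖x - y‖ ^ 2 + (1 - t) * ‖x - z‖ ^ 2 - t * (1 - t) * ‖y - z‖ ^ 2 := by
  rw [← sub_sub, ← sub_sub_sub_cancel_right x y z, norm_sub_sq_real (x - z),
    norm_sub_sq_real (x - z), real_inner_smul_right, norm_smul, mul_pow, Real.norm_eq_abs, sq_abs]
  ring

lemma IsProximalPoint.add_sq_le (hz : IsProximalPoint c ψ x z)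
    (hψ : StrongConvexOn Set.univ (-ρ) ψ) (y : E) :
    ψ z + c / 2 * ‖x - z‖ ^ 2 + (c - ρ) / 2 * ‖y - z‖ ^ 2 ≤ ψ y + c / 2 * ‖x - y‖ ^ 2 := by
  suffices h : (c - ρ) / 2 * ‖y - z‖ ^ 2 ≤
      ψ y + c / 2 * ‖x - y‖ ^ 2 - (ψ z + c / 2 * ‖x - z‖ ^ 2) by linarith
  refine le_of_forall_one_sub_mul_le fun t ht0 ht1 => le_of_mul_le_mul_left ?_ ht0
  have hmin := hz (z + t • (y - z))
  rw [norm_sub_add_smul_sq] at hmin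
  linarith [strongConvexOn_apply_add_smul_le hψ z y ht0.le ht1.le]

lemma IsProximalPoint.norm_sub_le {p q : E} (hp : IsProximalPoint c ψ x p)
    (hq : IsProximalPoint c ψ y q) (hψ : StrongConvexOn Set.univ (-ρ) ψ) (hc : 0 ≤ c) :
    (c - ρ) * ‖p - q‖ ≤ c * ‖x - y‖ := by
  have hpq := hp.add_sq_le hψ q
  have hqp := hq.add_sq_le hψ p
  rw [norm_sub_rev q p] at hpq
  have hpolar : ‖x - q‖ ^ 2 - ‖x - p‖ ^ 2 + ‖y - p‖ ^ 2 - ‖y - q‖ ^ 2 =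
      2 * inner ℝ (x - y) (p - q) := by
    simp only [norm_sub_sq_real, inner_sub_left, inner_sub_right]
    ring
  have hinner := mul_le_mul_of_nonneg_left (real_inner_le_norm (x - y) (p - q)) hc
  rcases (norm_nonneg (p - q)).eq_or_lt with h0 | h0
  · rw [← h0, mul_zero]
    positivity
  · refine le_of_mul_le_mul_right ?_ h0
    calc (c - ρ) * ‖p - q‖ * ‖p - q‖ = (c - ρ) * ‖p - q‖ ^ 2 := by ring
      _ ≤ c / 2 * (‖x - q‖ ^ 2 - ‖x - p‖ ^ 2 + ‖y - p‖ ^ 2 - ‖y - q‖ ^ 2) := by linarith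
      _ = c * inner ℝ (x - y) (p - q) := by rw [hpolar]; ring
      _ ≤ c * ‖x - y‖ * ‖p - q‖ := by linarith

lemma hasGradientAt_of_abs_sub_le [CompleteSpace E] {V : E → ℝ} {d : E} {K : ℝ}
    (h : ∀ y, |V y - V x - inner ℝ d (y - x)| ≤ K * ‖y - x‖ ^ 2) : HasGradientAt V d x := by
  rw [hasGradientAt_iff_hasFDerivAt, hasFDerivAt_iff_isLittleO]
  have hO : (fun y => V y - V x - InnerProductSpace.toDual ℝ E d (y - x))
      =O[𝓝 x] fun y => ‖y - x‖ ^ 2 :=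
    .of_bound K (Eventually.of_forall fun y => by simpa using h y)
  exact hO.trans_isLittleO (Asymptotics.isLittleO_pow_sub_sub x one_lt_two)

end Proximal

section Moreau

variable {m : ℕ} {ψ : Vec m → ℝ} {M : ℝ≥0} {ρ γ : ℝ} {x z : Vec m}

lemma moreau_eq_iInf (γ : ℝ) (ψ : Vec m → ℝ) (x : Vec m) :
    moreau γ ψ x = ⨅ z, (ψ z + γ⁻¹ / 2 * ‖x - z‖ ^ 2) := by
  simp only [moreau, one_div, mul_inv_rev, div_eq_mul_inv γ⁻¹]

lemma IsProximalPoint.moreau_eq (hz : IsProximalPoint γ⁻¹ ψ x z) :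
    moreau γ ψ x = ψ z + γ⁻¹ / 2 * ‖x - z‖ ^ 2 := by
  rw [moreau_eq_iInf]
  exact le_antisymm (ciInf_le ⟨_, Set.forall_mem_range.2 hz⟩ z) (le_ciInf hz)

lemma moreau_le (hψ : LipschitzWith M ψ) (hγ : 0 < γ) (x y : Vec m) :
    moreau γ ψ x ≤ ψ y + γ⁻¹ / 2 * ‖x - y‖ ^ 2 := by
  obtain ⟨z, hz⟩ := exists_isProximalPoint hψ (inv_pos.2 hγ) x
  exact hz.moreau_eq.trans_le (hz y)

lemma IsProximalPoint.moreau_le_add_inner (hz : IsProximalPoint γ⁻¹ ψ x z)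
    (hψ : LipschitzWith M ψ) (hγ : 0 < γ) (y : Vec m) :
    moreau γ ψ y ≤
      moreau γ ψ x + inner ℝ (γ⁻¹ • (x - z)) (y - x) + γ⁻¹ / 2 * ‖y - x‖ ^ 2 := by
  have h := moreau_le hψ hγ y z
  rw [← sub_add_sub_cancel' x z y, norm_add_sq_real] at h
  rw [hz.moreau_eq, real_inner_smul_left]
  linarith

theorem IsProximalPoint.hasGradientAt_moreau (hz : IsProximalPoint γ⁻¹ ψ x z)
    (hψ : LipschitzWith M ψ) (hc : StrongConvexOn Set.univ (-ρ) ψ) (hγ : 0 < γ) (hγρ : ρ < γ⁻¹) :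
    HasGradientAt (moreau γ ψ) (γ⁻¹ • (x - z)) x := by
  have hγ' := inv_pos.2 hγ
  set κ := γ⁻¹ / (γ⁻¹ - ρ)
  refine hasGradientAt_of_abs_sub_le (K := γ⁻¹ * (1 + κ)) fun y => ?_
  obtain ⟨q, hq⟩ := exists_isProximalPoint hψ hγ' y
  have hupper := hz.moreau_le_add_inner hψ hγ y
  have hlower := hq.moreau_le_add_inner hψ hγ x
  have hlip : ‖q - z‖ ≤ κ * ‖y - x‖ := by
    rw [div_mul_eq_mul_div, le_div_iff₀' (sub_pos.2 hγρ)]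
    exact hq.norm_sub_le hz hc hγ'.le
  have hinner : inner ℝ (q - z) (y - x) ≤ κ * ‖y - x‖ ^ 2 := by
    refine (real_inner_le_norm _ _).trans ?_
    rw [pow_two, ← mul_assoc]
    gcongr
  have hsplit : inner ℝ (γ⁻¹ • (y - q)) (x - y) = -inner ℝ (γ⁻¹ • (x - z)) (y - x) -
      γ⁻¹ * ‖y - x‖ ^ 2 + γ⁻¹ * inner ℝ (q - z) (y - x) := by
    rw [show y - q = (x - z) + (y - x) - (q - z) by abel, ← neg_sub y x, inner_neg_right,
      real_inner_smul_left, real_inner_smul_left, inner_sub_left, inner_add_left,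
      real_inner_self_eq_norm_sq]
    ring
  have hinner' := mul_le_mul_of_nonneg_left hinner hγ'.le
  have hsq : 0 ≤ γ⁻¹ * ‖y - x‖ ^ 2 := by positivity
  have hsq' : 0 ≤ γ⁻¹ * (κ * ‖y - x‖ ^ 2) := by
    have : 0 ≤ κ := div_nonneg hγ'.le (sub_pos.2 hγρ).le
    positivity
  rw [hsplit, norm_sub_rev x y] at hlower
  exact abs_le.2 ⟨by linarith, by linarith⟩

lemma differentiable_moreau (hψ : LipschitzWith M ψ) (hc : StrongConvexOn Set.univ (-ρ) ψ)
    (hγ : 0 < γ) (hγρ : ρ < γ⁻¹) : Differentiable ℝ (moreau γ ψ) := fun x =>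
  have ⟨_, hz⟩ := exists_isProximalPoint hψ (inv_pos.2 hγ) x
  (hz.hasGradientAt_moreau hψ hc hγ hγρ).differentiableAt

end Moreau

lemma isCompact_convexHull {E : Type*} [NormedAddCommGroup E] [NormedSpace ℝ E]
    [FiniteDimensional ℝ E] {L : Set E} (hL : IsCompact L) : IsCompact (convexHull ℝ L) := by
  have hcomb : convexHull ℝ L = ⋃ k ∈ Set.Iic (Module.finrank ℝ E + 1),
      (fun q : (Fin k → ℝ) × (Fin k → E) => ∑ i, q.1 i • q.2 i) ''
        (stdSimplex ℝ (Fin k) ×ˢ Set.univ.pi fun _ => L) := by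
    refine Set.Subset.antisymm (fun x hx => ?_) (Set.iUnion₂_subset fun k _ => ?_)
    · obtain ⟨ι, _, z, w, hz, hind, hw, hw1, rfl⟩ := eq_pos_convex_span_of_mem_convexHull hx
      have e := (Fintype.equivFin ι).symm
      refine Set.mem_iUnion₂.2 ⟨Fintype.card ι, hind.card_le_finrank_succ.trans
        (Nat.succ_le_succ (Submodule.finrank_le _)), (w ∘ e, z ∘ e),
        ⟨⟨fun i => (hw (e i)).le, (e.sum_comp w).trans hw1⟩, fun i _ => hz ⟨e i, rfl⟩⟩,
        e.sum_comp fun i => w i • z i⟩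
    · rintro _ ⟨⟨w, z⟩, ⟨hw, hz⟩, rfl⟩
      exact (convex_convexHull ℝ L).sum_mem (fun i _ => hw.1 i) hw.2
        fun i _ => subset_convexHull ℝ L (hz i (Set.mem_univ i))
  rw [hcomb]
  exact (Set.finite_Iic _).isCompact_biUnion fun k _ =>
    ((isCompact_stdSimplex ℝ (Fin k)).prod (isCompact_univ_pi fun _ => hL)).image (by fun_prop)

section LimitGradients

variable {E : Type*} [NormedAddCommGroup E] [InnerProductSpace ℝ E] [CompleteSpace E]
  {φ : E → ℝ} {M : ℝ≥0} {ρ C : ℝ} {z s : E}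

/-- The limits of gradients at nearby points of differentiability; their convex hull is the Clarke
subdifferential. -/
def limitGradients (g : E → ℝ) (x : E) : Set E :=
  {s | ∃ z : ℕ → E, Tendsto z atTop (𝓝 x) ∧
    (∀ k, DifferentiableAt ℝ g (z k)) ∧ Tendsto (fun k => ∇ g (z k)) atTop (𝓝 s)}

lemma isClosed_limitGradients (g : E → ℝ) (x : E) : IsClosed (limitGradients g x) := by
  have h : limitGradients g x =
      (fun s => (x, s)) ⁻¹' closure ((fun y => (y, ∇ g y)) '' {y | DifferentiableAt ℝ g y}) := by
    ext s
    rw [Set.mem_preimage, mem_closure_iff_seq_limit]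
    constructor
    · rintro ⟨z, hz, hd, hs⟩
      exact ⟨fun k => (z k, ∇ g (z k)), fun k => ⟨z k, hd k, rfl⟩, hz.prodMk_nhds hs⟩
    · rintro ⟨p, hp, hlim⟩
      choose z hd hz using hp
      obtain rfl : (fun k => (z k, ∇ g (z k))) = p := funext hz
      exact ⟨z, (continuous_fst.tendsto _).comp hlim, hd, (continuous_snd.tendsto _).comp hlim⟩
  rw [h]
  exact isClosed_closure.preimage (by fun_prop)

lemma isCompact_limitGradients [ProperSpace E] (hφ : LipschitzWith M φ) (x : E) :
    IsCompact (limitGradients φ x) := by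
  refine (isCompact_closedBall (0 : E) M).of_isClosed_subset (isClosed_limitGradients φ x) ?_
  rintro s ⟨z, -, -, hs⟩
  exact Metric.isClosed_closedBall.mem_of_tendsto hs (Eventually.of_forall fun k => by
    simpa using norm_gradient_le hφ (z k))

lemma inner_sub_gradient_le (hc : StrongConvexOn Set.univ (-ρ) (-φ))
    (hs : ∀ y, φ y ≤ φ z + inner ℝ s (y - z) + C * ‖y - z‖ ^ 2) {y : E}
    (hy : DifferentiableAt ℝ φ y) :
    inner ℝ (s - ∇ φ y) (z - y) ≤ (C + ρ / 2) * ‖z - y‖ ^ 2 := by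
  have hconc := strongConvexOn_add_inner_gradient_le hc hy.neg z
  have hsuper := hs y
  rw [gradient_neg, inner_neg_left, Pi.neg_apply, Pi.neg_apply] at hconc
  rw [← neg_sub z y, inner_neg_right, norm_neg] at hsuper
  rw [inner_sub_left]
  linarith

lemma exists_mem_limitGradients_inner_le [FiniteDimensional ℝ E] (hφ : LipschitzWith M φ)
    (hc : StrongConvexOn Set.univ (-ρ) (-φ))
    (hs : ∀ y, φ y ≤ φ z + inner ℝ s (y - z) + C * ‖y - z‖ ^ 2) (v : E) :
    ∃ a ∈ limitGradients φ z, inner ℝ s v ≤ inner ℝ a v := by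
  borelize E
  set t : ℕ → ℝ := fun k => 1 / ((k : ℝ) + 1)
  have ht (k : ℕ) : 0 < t k := by positivity
  have ht0 : Tendsto t atTop (𝓝 0) := tendsto_one_div_add_atTop_nhds_zero_nat
  have hdense (k : ℕ) : Dense {w | DifferentiableAt ℝ φ (z + (-t k) • w)} :=
    Measure.dense_of_ae (μ := volume)
      (ae_volume_differentiableAt_add_smul hφ (neg_ne_zero.2 (ht k).ne') z)
  choose w hwd hwv using fun k => (hdense k).exists_dist_lt v (ht k)
  have hw : Tendsto w atTop (𝓝 v) := tendsto_iff_dist_tendsto_zero.2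
    (squeeze_zero (fun _ => dist_nonneg) (fun k => by rw [dist_comm]; exact (hwv k).le) ht0)
  have hy : Tendsto (fun k => z + (-t k) • w k) atTop (𝓝 z) := by
    simpa using (ht0.neg.smul hw).const_add z
  obtain ⟨a, -, θ, hθ, ha⟩ := (isCompact_closedBall (0 : E) M).tendsto_subseq
    (x := fun k => ∇ φ (z + (-t k) • w k)) fun k => by simpa using norm_gradient_le hφ _
  refine ⟨a, ⟨_, hy.comp hθ.tendsto_atTop, fun k => hwd _, ha⟩, ?_⟩
  have hquot (k : ℕ) :
      inner ℝ (s - ∇ φ (z + (-t k) • w k)) (w k) ≤ (C + ρ / 2) * (t k * ‖w k‖ ^ 2) := by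
    have h := inner_sub_gradient_le hc hs (hwd k)
    rw [neg_smul, ← sub_eq_add_neg, sub_sub_cancel, real_inner_smul_right, norm_smul,
      Real.norm_of_nonneg (ht k).le] at h
    rw [neg_smul, ← sub_eq_add_neg]
    exact le_of_mul_le_mul_left (by linarith) (ht k)
  have hlim := le_of_tendsto_of_tendsto' ((tendsto_const_nhds.sub ha).inner
    (hw.comp hθ.tendsto_atTop)) ((((ht0.mul (hw.norm.pow 2)).const_mul (C + ρ / 2)).comp
      hθ.tendsto_atTop)) fun k => hquot (θ k)
  rwa [zero_mul, mul_zero, inner_sub_left, sub_nonpos] at hlim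

end LimitGradients

section Clarke

variable {m : ℕ} {φ : Vec m → ℝ} {M : ℝ≥0} {ρ ε C : ℝ}

theorem mem_clarke_of_le (hφ : LipschitzWith M φ) (hc : StrongConvexOn Set.univ (-ρ) (-φ))
    {z s : Vec m} (hs : ∀ y, φ y ≤ φ z + inner ℝ s (y - z) + C * ‖y - z‖ ^ 2) :
    s ∈ clarke φ z := by
  by_contra hmem
  obtain ⟨f, u, hf, hfs⟩ := geometric_hahn_banach_closed_point
    (convex_convexHull ℝ (limitGradients φ z))
    (isCompact_convexHull (isCompact_limitGradients hφ z)).isClosed hmem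
  obtain ⟨a, ha, hle⟩ := exists_mem_limitGradients_inner_le hφ hc hs
    ((InnerProductSpace.toDual ℝ (Vec m)).symm f)
  rw [real_inner_comm, real_inner_comm _ a, InnerProductSpace.toDual_symm_apply,
    InnerProductSpace.toDual_symm_apply] at hle
  exact (hfs.trans_le hle).not_gt (hf a (subset_convexHull ℝ _ ha))

lemma IsProximalPoint.mem_clarke (hφ : LipschitzWith M φ)
    (hc : StrongConvexOn Set.univ (-ρ) (-φ)) {c : ℝ} {g x z : Vec m}
    (hz : IsProximalPoint c (fun y => -φ y + inner ℝ g y) x z) :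
    g + c • (z - x) ∈ clarke φ z := by
  refine mem_clarke_of_le hφ hc (C := c / 2) fun y => ?_
  have h := hz y
  rw [← sub_sub_sub_cancel_right x y z, norm_sub_sq_real (x - z)] at h
  rw [inner_add_left, real_inner_smul_left, inner_sub_right, ← neg_sub x z, inner_neg_left]
  linarith

lemma IsProximalPoint.norm_sub_sq_le (hφ : LipschitzWith M φ)
    (hc : StrongConvexOn Set.univ (-ρ) (-φ)) (hε : 0 < ε) {x z : Vec m}
    (hz : IsProximalPoint (ρ + 1) (fun y => -φ y + inner ℝ (smoothingGradient φ ε x) y) x z) :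
    ‖z - x‖ ^ 2 ≤ 4 * (M * ε) := by
  have hmin := hz x
  have hconv := add_inner_smoothingGradient_le hφ.neg hc hε x z
  rw [smoothingGradient_neg, inner_neg_left, inner_sub_right] at hconv
  rw [norm_sub_rev x z] at hmin
  simp only [Pi.neg_apply, sub_self, norm_zero] at hmin hconv
  linarith

theorem exists_mem_clarkeBall (hφ : LipschitzWith M φ)
    (hc : StrongConvexOn Set.univ (-ρ) (-φ)) (hρ : 0 ≤ ρ) (hε : 0 < ε) (x : Vec m) :
    ∃ s ∈ clarkeBall φ (2 * √(M * ε)) x,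
      ‖s‖ ^ 2 ≤ 2 * ‖smoothingGradient φ ε x‖ ^ 2 + 8 * (ρ + 1) ^ 2 * (M * ε) := by
  set g := smoothingGradient φ ε x
  obtain ⟨z, hz⟩ := exists_isProximalPoint
    (hφ.neg.add (innerSL ℝ g).lipschitz) (c := ρ + 1) (by positivity) x
  have hclose : ‖z - x‖ ^ 2 ≤ 4 * (M * ε) := hz.norm_sub_sq_le hφ hc hε
  have hball : z ∈ Metric.closedBall x (2 * √(M * ε)) := by
    rw [mem_closedBall_iff_norm]
    refine le_of_sq_le_sq ?_ (by positivity)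
    rwa [mul_pow, Real.sq_sqrt (by positivity), show (2 : ℝ) ^ 2 = 4 by norm_num]
  refine ⟨g + (ρ + 1) • (z - x), Set.mem_iUnion₂.2 ⟨z, hball, hz.mem_clarke hφ hc⟩, ?_⟩
  calc ‖g + (ρ + 1) • (z - x)‖ ^ 2 ≤ (‖g‖ + (ρ + 1) * ‖z - x‖) ^ 2 := by
        gcongr
        refine (norm_add_le _ _).trans_eq ?_
        rw [norm_smul, Real.norm_of_nonneg (by positivity)]
    _ ≤ 2 * (‖g‖ ^ 2 + ((ρ + 1) * ‖z - x‖) ^ 2) := add_sq_le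
    _ = 2 * ‖g‖ ^ 2 + 2 * (ρ + 1) ^ 2 * ‖z - x‖ ^ 2 := by ring
    _ ≤ 2 * ‖g‖ ^ 2 + 2 * (ρ + 1) ^ 2 * (4 * (M * ε)) := by gcongr
    _ = _ := by ring

end Clarke

section Sampling

variable {m T : ℕ} {A : Vec m → ℝ} {η ε : ℝ} {x₀ : Vec m}

lemma iterate_succ_of_lt {u : Fin T → Vec m} {t : ℕ} (h : t < T) :
    iterate A η ε x₀ u (t + 1) =
      iterate A η ε x₀ u t - η • estimator A ε (iterate A η ε x₀ u t) (u ⟨t, h⟩) := by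
  simp [iterate, h]

lemma measurable_iterate (hA : Measurable A) (t : ℕ) :
    Measurable fun u : Fin T → Vec m => iterate A η ε x₀ u t := by
  induction t with
  | zero => exact measurable_const
  | succ t ih =>
    by_cases h : t < T
    · simp only [iterate_succ_of_lt h]
      have hest := (measurable_estimator hA ε).comp (ih.prodMk (measurable_pi_apply ⟨t, h⟩))
      exact ih.sub (hest.const_smul η)
    · simpa only [iterate, h, dite_false] using ih

lemma iterate_congr {u v : Fin T → Vec m} (t : ℕ) (h : ∀ i : Fin T, (i : ℕ) < t → u i = v i) :
    iterate A η ε x₀ u t = iterate A η ε x₀ v t := by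
  induction t with
  | zero => rfl
  | succ t ih =>
    have ih' := ih fun i hi => h i (hi.trans t.lt_succ_self)
    by_cases ht : t < T
    · rw [iterate_succ_of_lt ht, iterate_succ_of_lt ht, ih', h ⟨t, ht⟩ t.lt_succ_self]
    · simpa only [iterate, ht, dite_false] using ih'

variable {Ω : Type*} [MeasurableSpace Ω] {P : Measure Ω}
  {u : Fin T → Ω → Vec m} {R : Ω → Fin T}

lemma IsSampling.measurable_iterate (hS : IsSampling P u R) (hA : Measurable A) (t : ℕ) :
    Measurable fun ω => iterate A η ε x₀ (fun i => u i ω) t :=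
  (Bilevel.measurable_iterate hA t).comp (measurable_pi_lambda _ hS.measurable_dir)

lemma IsSampling.indepFun_iterate (hS : IsSampling P u R) (hA : Measurable A) (t : Fin T) :
    IndepFun (fun ω => iterate A η ε x₀ (fun i => u i ω) t) (u t) P := by
  classical
  set S : Finset (Fin T) := Finset.univ.filter fun i => i < t
  have hdisj : Disjoint S {t} := by simp [S]
  have hext : Measurable fun a : S → Vec m =>
      fun i : Fin T => if hi : i ∈ S then a ⟨i, hi⟩ else 0 := by
    refine measurable_pi_lambda _ fun i => ?_
    by_cases hi : i ∈ S
    · simpa only [hi, dite_true] using measurable_pi_apply _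
    · simpa only [hi, dite_false] using measurable_const
  have hindep := (hS.indep_dir.indepFun_finset S {t} hdisj hS.measurable_dir).comp
    ((Bilevel.measurable_iterate (A := A) (η := η) (ε := ε) (x₀ := x₀) hA t).comp hext)
    (measurable_pi_apply (⟨t, Finset.mem_singleton_self t⟩ : ({t} : Finset (Fin T))))
  convert hindep using 1
  · funext ω
    refine iterate_congr _ fun i hi => ?_
    have : i ∈ S := by simpa [S] using hi
    simp [this]
  · rfl

lemma IsSampling.lintegral_iterate_succ [IsProbabilityMeasure P] (hm : 0 < m)
    (hS : IsSampling P u R) (hA : Measurable A) (t : Fin T) {H : Vec m → ℝ≥0∞}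
    (hH : Measurable H) :
    ∫⁻ ω, H (iterate A η ε x₀ (fun i => u i ω) (t + 1)) ∂P =
      ∫⁻ ω, ∫⁻ v, H (iterate A η ε x₀ (fun i => u i ω) t - η • estimator A ε
        (iterate A η ε x₀ (fun i => u i ω) t) v) ∂(sphereUniform m) ∂P := by
  have := isProbabilityMeasure_sphereUniform hm
  set X : Ω → Vec m := fun ω => iterate A η ε x₀ (fun i => u i ω) t
  have hX : Measurable X := hS.measurable_iterate hA t
  have hstep : Measurable fun p : Vec m × Vec m => H (p.1 - η • estimator A ε p.1 p.2) :=
    hH.comp (measurable_fst.sub ((measurable_estimator hA ε).const_smul η))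
  have hlaw := (indepFun_iff_map_prod_eq_prod_map_map hX.aemeasurable
    (hS.measurable_dir t).aemeasurable).1 (hS.indepFun_iterate hA t)
  calc ∫⁻ ω, H (iterate A η ε x₀ (fun i => u i ω) (t + 1)) ∂P
      = ∫⁻ ω, H (X ω - η • estimator A ε (X ω) (u t ω)) ∂P := by
        simp only [iterate_succ_of_lt t.2, X]
    _ = ∫⁻ p, H (p.1 - η • estimator A ε p.1 p.2) ∂(P.map fun ω => (X ω, u t ω)) :=
        (lintegral_map hstep (hX.prodMk (hS.measurable_dir t))).symm
    _ = ∫⁻ x, ∫⁻ v, H (x - η • estimator A ε x v) ∂(sphereUniform m) ∂(P.map X) := by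
        rw [hlaw, hS.law_dir, lintegral_prod _ hstep.aemeasurable]
    _ = _ := lintegral_map hstep.lintegral_prod_right' hX

lemma IsSampling.lintegral_ite_index (hS : IsSampling P u R) (hA : Measurable A)
    {H : Vec m → ℝ≥0∞} (hH : Measurable H) (t : Fin T) :
    ∫⁻ ω, (if R ω = t then H (iterate A η ε x₀ (fun i => u i ω) t) else 0) ∂P =
      (T : ℝ≥0∞)⁻¹ * ∫⁻ ω, H (iterate A η ε x₀ (fun i => u i ω) t) ∂P := by
  set χ : Fin T → ℝ≥0∞ := fun i => if i = t then 1 else 0 with hχ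
  have hχm : Measurable χ := Measurable.of_discrete
  have hX : Measurable fun ω => H (iterate A η ε x₀ (fun i => u i ω) t) :=
    hH.comp (hS.measurable_iterate hA t)
  have hindep : IndepFun (fun ω => χ (R ω))
      (fun ω => H (iterate A η ε x₀ (fun i => u i ω) t)) P :=
    hS.indep_index.symm.comp hχm (hH.comp (Bilevel.measurable_iterate hA t))
  have hprob : ∫⁻ ω, χ (R ω) ∂P = (T : ℝ≥0∞)⁻¹ := by
    rw [← hS.law_index t, ← lintegral_indicator_one
      (hS.measurable_index (measurableSet_singleton t))]
    exact lintegral_congr fun ω => by by_cases h : R ω = t <;> simp [hχ, h]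
  refine Eq.trans ?_ ((lintegral_mul_eq_lintegral_mul_lintegral_of_indepFun
    (hχm.comp hS.measurable_index) hX hindep).trans (congrArg (· * _) hprob))
  simp only [hχ, Function.comp_apply, Pi.mul_apply, ite_mul, one_mul, zero_mul]

lemma IsSampling.lintegral_output (hS : IsSampling P u R) (hA : Measurable A)
    {H : Vec m → ℝ≥0∞} (hH : Measurable H) :
    ∫⁻ ω, H (output A η ε x₀ u R ω) ∂P =
      (T : ℝ≥0∞)⁻¹ * ∑ t : Fin T, ∫⁻ ω, H (iterate A η ε x₀ (fun i => u i ω) t) ∂P := by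
  have hmeas (t : Fin T) : Measurable fun ω =>
      if R ω = t then H (iterate A η ε x₀ (fun i => u i ω) t) else 0 :=
    (hH.comp (hS.measurable_iterate hA t)).ite
      (hS.measurable_index (measurableSet_singleton t)) measurable_const
  calc ∫⁻ ω, H (output A η ε x₀ u R ω) ∂P
      = ∫⁻ ω, ∑ t : Fin T, (if R ω = t then H (iterate A η ε x₀ (fun i => u i ω) t) else 0) ∂P :=
        lintegral_congr fun ω => by simp [output]
    _ = _ := by
        rw [lintegral_finsetSum _ fun t _ => hmeas t, Finset.mul_sum]
        simp only [hS.lintegral_ite_index hA hH]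

lemma IsSampling.lintegral_iterate_add_sum_le [IsProbabilityMeasure P] (hm : 0 < m)
    (hS : IsSampling P u R) (hA : Measurable A) {V D : Vec m → ℝ≥0∞} (hV : Measurable V)
    (hD : Measurable D) {c : ℝ≥0∞}
    (hstep : ∀ x, ∫⁻ v, V (x - η • estimator A ε x v) ∂(sphereUniform m) + D x ≤ V x + c)
    {t : ℕ} (ht : t ≤ T) :
    ∫⁻ ω, V (iterate A η ε x₀ (fun i => u i ω) t) ∂P +
        ∑ k ∈ Finset.range t, ∫⁻ ω, D (iterate A η ε x₀ (fun i => u i ω) k) ∂P ≤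
      V x₀ + t * c := by
  induction t with
  | zero => simp [iterate]
  | succ t ih =>
    set X : ℕ → Ω → Vec m := fun t ω => iterate A η ε x₀ (fun i => u i ω) t
    have hX : Measurable (X t) := hS.measurable_iterate hA t
    have hnext : ∫⁻ ω, V (X (t + 1) ω) ∂P + ∫⁻ ω, D (X t ω) ∂P ≤
        ∫⁻ ω, V (X t ω) ∂P + c :=
      calc ∫⁻ ω, V (X (t + 1) ω) ∂P + ∫⁻ ω, D (X t ω) ∂P
          = ∫⁻ ω, (∫⁻ v, V (X t ω - η • estimator A ε (X t ω) v) ∂(sphereUniform m) +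
              D (X t ω)) ∂P := by
            rw [lintegral_add_right _ (by fun_prop)]
            exact congrArg (· + _) (hS.lintegral_iterate_succ hm hA ⟨t, ht⟩ hV)
        _ ≤ ∫⁻ ω, (V (X t ω) + c) ∂P := lintegral_mono fun ω => hstep _
        _ = ∫⁻ ω, V (X t ω) ∂P + c := by simp [lintegral_add_right _ measurable_const]
    rw [Finset.sum_range_succ]
    set S := ∑ k ∈ Finset.range t, ∫⁻ ω, D (X k ω) ∂P
    calc ∫⁻ ω, V (X (t + 1) ω) ∂P + (S + ∫⁻ ω, D (X t ω) ∂P)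
        = ∫⁻ ω, V (X (t + 1) ω) ∂P + ∫⁻ ω, D (X t ω) ∂P + S := by ring
      _ ≤ ∫⁻ ω, V (X t ω) ∂P + c + S := add_le_add_left hnext S
      _ = ∫⁻ ω, V (X t ω) ∂P + S + c := by ring
      _ ≤ V x₀ + t * c + c := add_le_add_left (ih (Nat.le_of_succ_le ht)) c
      _ = V x₀ + (t + 1 : ℕ) * c := by push_cast; ring

lemma IsSampling.lintegral_output_le [IsProbabilityMeasure P] (hm : 0 < m)
    (hS : IsSampling P u R) (hA : Measurable A) {V D : Vec m → ℝ≥0∞} (hV : Measurable V)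
    (hD : Measurable D) {c : ℝ≥0∞}
    (hstep : ∀ x, ∫⁻ v, V (x - η • estimator A ε x v) ∂(sphereUniform m) + D x ≤ V x + c) :
    ∫⁻ ω, D (output A η ε x₀ u R ω) ∂P ≤ (T : ℝ≥0∞)⁻¹ * (V x₀ + T * c) := by
  rw [hS.lintegral_output hA hD,
    ← Finset.sum_range fun k => ∫⁻ ω, D (iterate A η ε x₀ (fun i => u i ω) k) ∂P]
  gcongr
  exact le_add_self.trans (hS.lintegral_iterate_add_sum_le hm hA hV hD hstep le_rfl)

end Sampling

section Interpolation

lemma le_convexCombination_of_deriv {c c' : ℝ → ℝ} {κ : ℝ} (hd : ∀ t, HasDerivAt c (c' t) t)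
    (hκ : ∀ s t, s ≤ t → -(κ * (t - s)) ≤ c' t - c' s) {t : ℝ} (h0 : 0 ≤ t) (h1 : t ≤ 1) :
    c t ≤ t * c 1 + (1 - t) * c 0 + κ / 2 * (t * (1 - t)) := by
  have hder (s : ℝ) : HasDerivAt (fun s => c s + κ / 2 * s ^ 2) (c' s + κ * s) s := by
    have := (hd s).add ((hasDerivAt_pow 2 s).const_mul (κ / 2))
    convert! this using 1
    simp only [Nat.cast_ofNat, Nat.add_one_sub_one, pow_one]
    ring
  have hconv : ConvexOn ℝ Set.univ fun s => c s + κ / 2 * s ^ 2 := by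
    refine Monotone.convexOn_univ_of_deriv (fun s => (hder s).differentiableAt) ?_
    intro s r hsr
    rw [(hder s).deriv, (hder r).deriv]
    linarith [hκ s r hsr]
  have := hconv.2 (Set.mem_univ (1 : ℝ)) (Set.mem_univ (0 : ℝ)) h0 (sub_nonneg.2 h1) (by ring)
  simp only [smul_eq_mul, mul_one, mul_zero, add_zero] at this
  linarith

lemma hasDerivAt_add_smul_sub {E : Type*} [NormedAddCommGroup E] [NormedSpace ℝ E] (p q : E)
    (t : ℝ) : HasDerivAt (fun t : ℝ => q + t • (p - q)) (p - q) t := by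
  simpa using ((hasDerivAt_id t).smul_const (p - q)).const_add q

lemma IsSmooth.le_convexCombination {E : Type*} [NormedAddCommGroup E] [InnerProductSpace ℝ E]
    [CompleteSpace E] {L : ℝ≥0} {g : E → ℝ} (hg : IsSmooth L g) (p q : E) {t : ℝ}
    (h0 : 0 ≤ t) (h1 : t ≤ 1) :
    g (q + t • (p - q)) ≤ t * g p + (1 - t) * g q + L / 2 * (t * (1 - t)) * ‖p - q‖ ^ 2 := by
  set ℓ : ℝ → E := fun t => q + t • (p - q) with hℓ
  have hderiv (t : ℝ) : HasDerivAt (fun t => g (ℓ t)) (inner ℝ (∇ g (ℓ t)) (p - q)) t := by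
    rw [gradient, InnerProductSpace.toDual_symm_apply]
    exact (hg.differentiable (ℓ t)).hasFDerivAt.comp_hasDerivAt t (hasDerivAt_add_smul_sub p q t)
  have hmono (s t : ℝ) (hst : s ≤ t) : -(L * ‖p - q‖ ^ 2 * (t - s)) ≤
      inner ℝ (∇ g (ℓ t)) (p - q) - inner ℝ (∇ g (ℓ s)) (p - q) := by
    have hlip : ‖∇ g (ℓ t) - ∇ g (ℓ s)‖ ≤ L * ((t - s) * ‖p - q‖) := by
      refine (hg.lipschitz_gradient.norm_sub_le (ℓ t) (ℓ s)).trans (le_of_eq ?_)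
      rw [add_sub_add_left_eq_sub, ← sub_smul, norm_smul,
        Real.norm_of_nonneg (sub_nonneg.2 hst)]
    rw [← inner_sub_left]
    have hcs := neg_le_of_abs_le (abs_real_inner_le_norm (∇ g (ℓ t) - ∇ g (ℓ s)) (p - q))
    nlinarith [mul_le_mul_of_nonneg_right hlip (norm_nonneg (p - q))]
  have h := le_convexCombination_of_deriv hderiv hmono h0 h1
  simp only [hℓ, one_smul, zero_smul, add_zero, add_sub_cancel] at h
  linarith

variable {E F : Type*} [NormedAddCommGroup E] [NormedSpace ℝ E] [NormedAddCommGroup F]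
  [InnerProductSpace ℝ F] {G : E → F} {p q : E} {κ t : ℝ}

lemma inner_sub_convexCombination_le (hG : Differentiable ℝ G)
    (hκ : ∀ s t : ℝ, s ≤ t →
      ‖fderiv ℝ G (q + t • (p - q)) - fderiv ℝ G (q + s • (p - q))‖ ≤ κ * (t - s))
    (h0 : 0 ≤ t) (h1 : t ≤ 1) (v : F) :
    inner ℝ v (G (q + t • (p - q)) - (t • G p + (1 - t) • G q)) ≤
      ‖v‖ * (κ / 2 * (t * (1 - t)) * ‖p - q‖) := by
  set ℓ : ℝ → E := fun t => q + t • (p - q) with hℓ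
  have hderiv (t : ℝ) : HasDerivAt (fun t => inner ℝ v (G (ℓ t)))
      (inner ℝ v (fderiv ℝ G (ℓ t) (p - q))) t := by
    have h := (hG (ℓ t)).hasFDerivAt.comp_hasDerivAt t (hasDerivAt_add_smul_sub p q t)
    simpa using! (hasDerivAt_const t v).inner ℝ h
  have hmono (s t : ℝ) (hst : s ≤ t) : -(‖v‖ * (κ * ‖p - q‖) * (t - s)) ≤
      inner ℝ v (fderiv ℝ G (ℓ t) (p - q)) - inner ℝ v (fderiv ℝ G (ℓ s) (p - q)) := by
    rw [← inner_sub_right, ← _root_.sub_apply]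
    refine le_trans (neg_le_neg ?_) (neg_le_of_abs_le (abs_real_inner_le_norm _ _))
    calc ‖v‖ * ‖(fderiv ℝ G (ℓ t) - fderiv ℝ G (ℓ s)) (p - q)‖
        ≤ ‖v‖ * (κ * (t - s) * ‖p - q‖) := by
          gcongr
          exact ContinuousLinearMap.le_of_opNorm_le _ (hκ s t hst) _
      _ = ‖v‖ * (κ * ‖p - q‖) * (t - s) := by ring
  have h := le_convexCombination_of_deriv hderiv hmono h0 h1
  simp only [hℓ, one_smul, zero_smul, add_zero, add_sub_cancel] at h
  rw [inner_sub_right, inner_add_right, real_inner_smul_right, real_inner_smul_right]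
  linarith

lemma norm_convexCombination_sub_le (hG : Differentiable ℝ G)
    (hκ : ∀ s t : ℝ, s ≤ t →
      ‖fderiv ℝ G (q + t • (p - q)) - fderiv ℝ G (q + s • (p - q))‖ ≤ κ * (t - s))
    (h0 : 0 ≤ t) (h1 : t ≤ 1) :
    ‖t • G p + (1 - t) • G q - G (q + t • (p - q))‖ ≤ κ / 2 * (t * (1 - t)) * ‖p - q‖ := by
  rw [norm_sub_rev]
  have h := inner_sub_convexCombination_le hG hκ h0 h1
    (G (q + t • (p - q)) - (t • G p + (1 - t) • G q))
  rw [real_inner_self_eq_norm_mul_norm] at h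
  have hκ0 : 0 ≤ κ := by simpa using (norm_nonneg _).trans (hκ 0 1 zero_le_one)
  rcases (norm_nonneg (G (q + t • (p - q)) - (t • G p + (1 - t) • G q))).eq_or_lt with he | he
  · rw [← he]
    have := sub_nonneg.2 h1
    positivity
  · exact le_of_mul_le_mul_left h he

end Interpolation

/-- The lower-level assumptions without convexity of the solution sets: smoothness, Lipschitz
continuity of `∇∇_y f`, existence of minimizers, and the uniform error bound. -/
structure RegularLowerLevel {m n : ℕ} (Lf Hf : ℝ≥0) (τ : ℝ) (f : Joint m n → ℝ) : Prop where
  smooth : IsSmooth Lf f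
  twice_differentiable : Differentiable ℝ (∇ f)
  lipschitz_hessian : ∀ p q : Joint m n,
    ‖fderiv ℝ (gradY f) p - fderiv ℝ (gradY f) q‖
      ≤ Hf * (‖p.fst - q.fst‖ + ‖p.snd - q.snd‖)
  sol_nonempty : ∀ x, (solSet f x).Nonempty
  tau_nonneg : 0 ≤ τ
  error_bound : ∀ (x : Vec m) (y : Vec n),
    Metric.infDist y (solSet f x) ≤ τ * ‖gradY f (pair x y)‖

section HyperObjective

variable {m n : ℕ} {Lf Hf MF LF : ℝ≥0} {τ : ℝ} {f F : Joint m n → ℝ}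

lemma norm_sq_joint (p : Joint m n) : ‖p‖ ^ 2 = ‖p.fst‖ ^ 2 + ‖p.snd‖ ^ 2 :=
  WithLp.prod_norm_sq_eq_of_L2 p

lemma norm_joint_le (p : Joint m n) : ‖p‖ ≤ ‖p.fst‖ + ‖p.snd‖ := by
  refine le_of_sq_le_sq ?_ (by positivity)
  rw [norm_sq_joint]
  nlinarith [mul_nonneg (norm_nonneg p.fst) (norm_nonneg p.snd)]

lemma gradY_eq_snd_gradient {p : Joint m n} (hf : DifferentiableAt ℝ f p) :
    gradY f p = (∇ f p).snd := by
  refine HasGradientAt.gradient (hasGradientAt_iff_hasFDerivAt.2 ?_)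
  have hpair : HasFDerivAt (fun y : Vec n => pair p.fst y)
      ((WithLp.prodContinuousLinearEquiv 2 ℝ (Vec m) (Vec n)).symm.toContinuousLinearMap ∘L
        ContinuousLinearMap.inr ℝ (Vec m) (Vec n)) p.snd :=
    (WithLp.prodContinuousLinearEquiv 2 ℝ (Vec m) (Vec n)).symm.hasFDerivAt.comp p.snd
      (hasFDerivAt_prodMk_right p.fst p.snd)
  have hfp : HasFDerivAt f (InnerProductSpace.toDual ℝ _ (∇ f p)) (pair p.fst p.snd) :=
    hf.hasGradientAt.hasFDerivAt
  refine (hfp.comp p.snd hpair).congr_fderiv (ContinuousLinearMap.ext fun v => ?_)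
  change inner ℝ (∇ f p) (pair 0 v) = inner ℝ (∇ f p).snd v
  rw [WithLp.prod_inner_apply]
  change inner ℝ (∇ f p).fst 0 + inner ℝ (∇ f p).snd v = _
  rw [inner_zero_right, zero_add]

lemma differentiable_gradY (hf : Differentiable ℝ f) (hf' : Differentiable ℝ (∇ f)) :
    Differentiable ℝ (gradY f) := by
  have e : gradY f = WithLp.sndL 2 ℝ (Vec m) (Vec n) ∘ ∇ f :=
    funext fun p => gradY_eq_snd_gradient (hf p)
  rw [e]
  exact (ContinuousLinearMap.differentiable _).comp hf'

lemma IsSmooth.norm_gradY_sub_le (hf : IsSmooth Lf f) (p q : Joint m n) :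
    ‖gradY f p - gradY f q‖ ≤ Lf * ‖p - q‖ := by
  rw [gradY_eq_snd_gradient (hf.differentiable p), gradY_eq_snd_gradient (hf.differentiable q)]
  refine le_trans (le_of_sq_le_sq ?_ (norm_nonneg _)) (hf.lipschitz_gradient.norm_sub_le p q)
  rw [norm_sq_joint (∇ f p - ∇ f q)]
  exact le_add_of_nonneg_left (sq_nonneg _)

lemma gradY_eq_zero {x : Vec m} {y : Vec n} (hy : y ∈ solSet f x) : gradY f (pair x y) = 0 := by
  have : IsLocalMin (fun y : Vec n => f (pair x y)) y := Eventually.of_forall hy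
  simp [gradY, gradient, this.fderiv_eq_zero]

lemma LowerLevel.regular (hf : LowerLevel Lf Hf τ f) : RegularLowerLevel Lf Hf τ f :=
  ⟨hf.smooth, hf.twice_differentiable, hf.lipschitz_hessian, hf.sol_nonempty, hf.tau_pos.le,
    hf.error_bound⟩

lemma IsSmooth.continuous {E : Type*} [NormedAddCommGroup E] [InnerProductSpace ℝ E]
    [CompleteSpace E] {L : ℝ≥0} {g : E → ℝ} (hg : IsSmooth L g) : Continuous g :=
  hg.differentiable.continuous

lemma isClosed_solSet (hf : Continuous f) (x : Vec m) : IsClosed (solSet f x) := by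
  have hpair : Continuous fun y : Vec n => f (pair x y) := by fun_prop
  rw [solSet, Set.ofPred_forall]
  exact isClosed_iInter fun y' => isClosed_le hpair continuous_const

lemma RegularLowerLevel.exists_solSet_norm_sub_le_gradY (hf : RegularLowerLevel Lf Hf τ f)
    (x : Vec m) (y : Vec n) : ∃ y' ∈ solSet f x, ‖y - y'‖ ≤ τ * ‖gradY f (pair x y)‖ := by
  obtain ⟨y', hy', h⟩ :=
    (isClosed_solSet hf.smooth.continuous x).exists_infDist_eq_dist (hf.sol_nonempty x) y
  refine ⟨y', hy', ?_⟩
  rw [← dist_eq_norm, ← h]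
  exact hf.error_bound x y

lemma RegularLowerLevel.exists_solSet_norm_sub_le (hf : RegularLowerLevel Lf Hf τ f)
    {x : Vec m} {y : Vec n} (hy : y ∈ solSet f x) (x' : Vec m) :
    ∃ y' ∈ solSet f x', ‖y - y'‖ ≤ Lf * τ * ‖x - x'‖ := by
  obtain ⟨y', hy', h⟩ := hf.exists_solSet_norm_sub_le_gradY x' y
  refine ⟨y', hy', h.trans ?_⟩
  have hpair : ‖pair x' y - pair x y‖ ≤ ‖x - x'‖ := by
    simpa [norm_sub_rev] using norm_joint_le (pair x' y - pair x y)
  have hgrad : ‖gradY f (pair x' y)‖ ≤ Lf * ‖x - x'‖ := by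
    have := hf.smooth.norm_gradY_sub_le (pair x' y) (pair x y)
    rw [gradY_eq_zero hy, sub_zero] at this
    exact this.trans (by gcongr)
  calc τ * ‖gradY f (pair x' y)‖ ≤ τ * (Lf * ‖x - x'‖) :=
        mul_le_mul_of_nonneg_left hgrad hf.tau_nonneg
    _ = Lf * τ * ‖x - x'‖ := by ring

lemma RegularLowerLevel.norm_gradY_convexCombination_sub_le (hf : RegularLowerLevel Lf Hf τ f)
    (p q : Joint m n) {t : ℝ} (h0 : 0 ≤ t) (h1 : t ≤ 1) :
    ‖t • gradY f p + (1 - t) • gradY f q - gradY f (q + t • (p - q))‖ ≤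
      Hf / 2 * (t * (1 - t)) * (‖p.fst - q.fst‖ + ‖p.snd - q.snd‖) ^ 2 := by
  set r := ‖p.fst - q.fst‖ + ‖p.snd - q.snd‖
  have hhess (s t : ℝ) (hst : s ≤ t) : ‖fderiv ℝ (gradY f) (q + t • (p - q)) -
      fderiv ℝ (gradY f) (q + s • (p - q))‖ ≤ Hf * r * (t - s) := by
    refine (hf.lipschitz_hessian _ _).trans (le_of_eq ?_)
    simp only [WithLp.add_fst, WithLp.add_snd, WithLp.smul_fst, WithLp.smul_snd, WithLp.sub_fst,
      WithLp.sub_snd, add_sub_add_left_eq_sub, ← sub_smul, norm_smul,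
      Real.norm_of_nonneg (sub_nonneg.2 hst), r]
    ring
  refine (norm_convexCombination_sub_le (differentiable_gradY hf.smooth.differentiable
    hf.twice_differentiable) hhess h0 h1).trans ?_
  have hr : ‖p - q‖ ≤ r := norm_joint_le (p - q)
  have : 0 ≤ 1 - t := sub_nonneg.2 h1
  calc Hf * r / 2 * (t * (1 - t)) * ‖p - q‖ ≤ Hf * r / 2 * (t * (1 - t)) * r := by gcongr
    _ = Hf / 2 * (t * (1 - t)) * r ^ 2 := by ring

lemma LS_nonneg : 0 ≤ LS Lf Hf τ := le_max_of_le_right (by positivity)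

lemma rho_nonneg : 0 ≤ rho Lf Hf MF LF τ := by
  have := LS_nonneg (Lf := Lf) (Hf := Hf) (τ := τ)
  unfold rho
  positivity

lemma sq_mul_le_LS : ((Lf : ℝ) * τ) ^ 2 ≤ LS Lf Hf τ :=
  le_max_of_le_right (by nlinarith [sq_nonneg ((Lf : ℝ) * τ)])

lemma mul_one_add_sq_le_LS (hτ : 0 ≤ τ) :
    Hf * τ * (1 + ((Lf : ℝ) * τ) ^ 2) ≤ LS Lf Hf τ / 2 := by
  have hmax : 2 * Hf * τ * (1 + 9 * (Lf : ℝ) ^ 2 * τ ^ 2) ≤ LS Lf Hf τ := le_max_left _ _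
  have : 0 ≤ (Hf : ℝ) * τ * ((Lf : ℝ) * τ) ^ 2 := by positivity
  nlinarith

lemma RegularLowerLevel.exists_solSet_interpolation (hf : RegularLowerLevel Lf Hf τ f)
    (x₁ x₂ : Vec m) {t : ℝ} (h0 : 0 < t) (h1 : t ≤ 1) {y : Vec n}
    (hy : y ∈ solSet f (x₂ + t • (x₁ - x₂))) :
    ∃ y₁ ∈ solSet f x₁, ∃ y₂ ∈ solSet f x₂, ∃ z : Vec n, y = y₂ + t • (z - y₂) ∧
      ‖z - y₂‖ ^ 2 ≤ LS Lf Hf τ * ‖x₁ - x₂‖ ^ 2 ∧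
      ‖z - y₁‖ ≤ (1 - t) * (LS Lf Hf τ / 2 * ‖x₁ - x₂‖ ^ 2) := by
  have hτ := hf.tau_nonneg
  have : 0 ≤ 1 - t := sub_nonneg.2 h1
  set a := ‖x₁ - x₂‖
  obtain ⟨y₂, hy₂, hyy₂⟩ := hf.exists_solSet_norm_sub_le hy x₂
  rw [add_sub_cancel_left, norm_smul, Real.norm_of_nonneg h0.le] at hyy₂
  obtain ⟨z, rfl⟩ : ∃ z, y = y₂ + t • (z - y₂) := ⟨y₂ + t⁻¹ • (y - y₂), by simp [h0.ne']⟩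
  have hz : ‖z - y₂‖ ≤ Lf * τ * a := by
    rw [add_sub_cancel_left, norm_smul, Real.norm_of_nonneg h0.le] at hyy₂
    exact le_of_mul_le_mul_left (by linarith) h0
  have hz2 : ‖z - y₂‖ ^ 2 ≤ (Lf * τ) ^ 2 * a ^ 2 := by
    rw [← mul_pow]
    gcongr
  obtain ⟨y₁, hy₁, hzy₁⟩ := hf.exists_solSet_norm_sub_le_gradY x₁ z
  refine ⟨y₁, hy₁, y₂, hy₂, z, rfl, hz2.trans (by gcongr; exact sq_mul_le_LS), hzy₁.trans ?_⟩
  have hgrad : ‖gradY f (pair x₁ z)‖ ≤ (1 - t) * (Hf * (1 + (Lf * τ) ^ 2) * a ^ 2) := by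
    have h := hf.norm_gradY_convexCombination_sub_le (pair x₁ z) (pair x₂ y₂) h0.le h1
    have hmid : pair x₂ y₂ + t • (pair x₁ z - pair x₂ y₂) =
        pair (x₂ + t • (x₁ - x₂)) (y₂ + t • (z - y₂)) := rfl
    rw [hmid, gradY_eq_zero hy, gradY_eq_zero hy₂, smul_zero, add_zero, sub_zero, norm_smul,
      Real.norm_of_nonneg h0.le] at h
    refine le_of_mul_le_mul_left (h.trans ?_) h0
    have hsq : (a + ‖z - y₂‖) ^ 2 ≤ 2 * ((1 + (Lf * τ) ^ 2) * a ^ 2) := by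
      nlinarith [sq_nonneg (a - ‖z - y₂‖)]
    calc Hf / 2 * (t * (1 - t)) * (a + ‖z - y₂‖) ^ 2
        ≤ Hf / 2 * (t * (1 - t)) * (2 * ((1 + (Lf * τ) ^ 2) * a ^ 2)) := by gcongr
      _ = t * ((1 - t) * (Hf * (1 + (Lf * τ) ^ 2) * a ^ 2)) := by ring
  calc τ * ‖gradY f (pair x₁ z)‖ ≤ τ * ((1 - t) * (Hf * (1 + (Lf * τ) ^ 2) * a ^ 2)) := by gcongr
    _ = (1 - t) * (Hf * τ * (1 + (Lf * τ) ^ 2) * a ^ 2) := by ring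
    _ ≤ (1 - t) * (LS Lf Hf τ / 2 * a ^ 2) := by gcongr; exact mul_one_add_sq_le_LS hτ

lemma RegularLowerLevel.exists_upper_le (hf : RegularLowerLevel Lf Hf τ f)
    (hF : LipschitzWith MF F) {x : Vec m} {y : Vec n} (hy : y ∈ solSet f x) (x' : Vec m) :
    ∃ y' ∈ solSet f x', F (pair x y) ≤ F (pair x' y') + Mphi Lf MF τ * ‖x - x'‖ := by
  obtain ⟨y', hy', h⟩ := hf.exists_solSet_norm_sub_le hy x'
  have hlip : F (pair x y) - F (pair x' y') ≤ MF * ‖pair x y - pair x' y'‖ :=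
    (le_abs_self _).trans (hF.norm_sub_le _ _)
  have hpair : ‖pair x y - pair x' y'‖ ≤ ‖x - x'‖ + Lf * τ * ‖x - x'‖ :=
    (norm_joint_le _).trans (add_le_add_right h _)
  refine ⟨y', hy', ?_⟩
  have := mul_le_mul_of_nonneg_left hpair MF.coe_nonneg
  unfold Mphi
  linarith

lemma RegularLowerLevel.exists_upper_interpolation_le (hf : RegularLowerLevel Lf Hf τ f)
    (hF : UpperLevel MF LF F) (x₁ x₂ : Vec m) {t : ℝ} (h0 : 0 < t) (h1 : t ≤ 1) {y : Vec n}
    (hy : y ∈ solSet f (x₂ + t • (x₁ - x₂))) :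
    ∃ y₁ ∈ solSet f x₁, ∃ y₂ ∈ solSet f x₂, F (pair (x₂ + t • (x₁ - x₂)) y) ≤
      t * F (pair x₁ y₁) + (1 - t) * F (pair x₂ y₂) +
        rho Lf Hf MF LF τ / 2 * (t * (1 - t)) * ‖x₁ - x₂‖ ^ 2 := by
  obtain ⟨y₁, hy₁, y₂, hy₂, z, rfl, hzy₂, hzy₁⟩ := hf.exists_solSet_interpolation x₁ x₂ h0 h1 hy
  refine ⟨y₁, hy₁, y₂, hy₂, ?_⟩
  set a := ‖x₁ - x₂‖
  have : 0 ≤ 1 - t := sub_nonneg.2 h1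
  have hsmooth : F (pair (x₂ + t • (x₁ - x₂)) (y₂ + t • (z - y₂))) ≤ t * F (pair x₁ z) +
      (1 - t) * F (pair x₂ y₂) + LF / 2 * (t * (1 - t)) * ((1 + LS Lf Hf τ) * a ^ 2) := by
    refine (hF.smooth.le_convexCombination (pair x₁ z) (pair x₂ y₂) h0.le h1).trans ?_
    have hnorm : ‖pair x₁ z - pair x₂ y₂‖ ^ 2 = a ^ 2 + ‖z - y₂‖ ^ 2 := norm_sq_joint _
    rw [hnorm]
    gcongr
    linarith
  have hlip : F (pair x₁ z) ≤ F (pair x₁ y₁) + MF * ((1 - t) * (LS Lf Hf τ / 2 * a ^ 2)) := by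
    have hpair : ‖pair x₁ z - pair x₁ y₁‖ ≤ ‖z - y₁‖ := by
      simpa using norm_joint_le (pair x₁ z - pair x₁ y₁)
    have hF' : F (pair x₁ z) - F (pair x₁ y₁) ≤ MF * ‖pair x₁ z - pair x₁ y₁‖ :=
      (le_abs_self _).trans (hF.lipschitz.norm_sub_le _ _)
    linarith [mul_le_mul_of_nonneg_left (hpair.trans hzy₁) MF.coe_nonneg]
  have := mul_le_mul_of_nonneg_left hlip h0.le
  simp only [rho]
  linarith

lemma RegularLowerLevel.bddAbove_upperValues (hf : RegularLowerLevel Lf Hf τ f)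
    (hF : LipschitzWith MF F) (h : ∃ x, BddAbove (upperValues f F x)) (x : Vec m) :
    BddAbove (upperValues f F x) := by
  obtain ⟨x', B, hB⟩ := h
  refine ⟨B + Mphi Lf MF τ * ‖x - x'‖, ?_⟩
  rintro _ ⟨y, hy, rfl⟩
  obtain ⟨y', hy', h⟩ := hf.exists_upper_le hF hy x'
  exact h.trans (add_le_add_left (hB ⟨y', hy', rfl⟩) _)

lemma RegularLowerLevel.Mphi_nonneg (hf : RegularLowerLevel Lf Hf τ f) : 0 ≤ Mphi Lf MF τ := by
  have := hf.tau_nonneg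
  unfold Mphi
  positivity

lemma RegularLowerLevel.lipschitzWith_phiP (hf : RegularLowerLevel Lf Hf τ f)
    (hF : LipschitzWith MF F) (h : ∃ x, BddAbove (upperValues f F x)) :
    LipschitzWith (Mphi Lf MF τ).toNNReal (phiP f F) := by
  refine LipschitzWith.of_le_add_mul _ fun x x' => csSup_le ((hf.sol_nonempty x).image _) ?_
  rintro _ ⟨y, hy, rfl⟩
  obtain ⟨y', hy', h'⟩ := hf.exists_upper_le hF hy x'
  rw [Real.coe_toNNReal _ hf.Mphi_nonneg, dist_eq_norm]
  exact h'.trans (add_le_add_left (le_csSup (hf.bddAbove_upperValues hF h x') ⟨y', hy', rfl⟩) _)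

lemma RegularLowerLevel.strongConvexOn_phiP (hf : RegularLowerLevel Lf Hf τ f)
    (hF : UpperLevel MF LF F) (h : ∃ x, BddAbove (upperValues f F x)) :
    StrongConvexOn Set.univ (-rho Lf Hf MF LF τ) (phiP f F) := by
  refine ⟨convex_univ, fun x₁ _ x₂ _ t s h0 hs hts => ?_⟩
  obtain rfl : s = 1 - t := by linarith
  rcases h0.eq_or_lt with rfl | h0
  · simp
  have hle (x : Vec m) (y : Vec n) (hy : y ∈ solSet f x) : F (pair x y) ≤ phiP f F x :=
    le_csSup (hf.bddAbove_upperValues hF.lipschitz h x) ⟨y, hy, rfl⟩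
  have hx : t • x₁ + (1 - t) • x₂ = x₂ + t • (x₁ - x₂) := by module
  rw [hx]
  refine csSup_le ((hf.sol_nonempty _).image _) ?_
  rintro _ ⟨y, hy, rfl⟩
  obtain ⟨y₁, hy₁, y₂, hy₂, hF₁₂⟩ :=
    hf.exists_upper_interpolation_le hF x₁ x₂ h0 (sub_nonneg.1 hs) hy
  have h₁ := mul_le_mul_of_nonneg_left (hle x₁ y₁ hy₁) h0.le
  have h₂ := mul_le_mul_of_nonneg_left (hle x₂ y₂ hy₂) hs
  simp only [smul_eq_mul]
  linarith

lemma phiP_neg (f F : Joint m n → ℝ) : phiP f (-F) = -phiO f F := by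
  funext x
  have e : upperValues f (-F) x = -upperValues f F x := by
    simp only [upperValues, ← Set.image_neg_eq_neg, Set.image_image, Pi.neg_apply]
  rw [phiP, e, Real.sSup_neg]
  rfl

lemma UpperLevel.neg (hF : UpperLevel MF LF F) : UpperLevel MF LF (-F) := by
  refine ⟨hF.lipschitz.neg, hF.smooth.differentiable.neg, ?_⟩
  have e : ∇ (-F) = -∇ F := funext fun x => gradient_neg F x
  rw [e]
  exact hF.smooth.lipschitz_gradient.neg

lemma exists_bddAbove_upperValues_neg (h : ∃ x, BddBelow (upperValues f F x)) :
    ∃ x, BddAbove (upperValues f (-F) x) := by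
  obtain ⟨x, B, hB⟩ := h
  refine ⟨x, -B, ?_⟩
  rintro _ ⟨y, hy, rfl⟩
  exact neg_le_neg (hB ⟨y, hy, rfl⟩)

lemma RegularLowerLevel.lipschitzWith_phiO (hf : RegularLowerLevel Lf Hf τ f)
    (hF : LipschitzWith MF F) (h : ∃ x, BddBelow (upperValues f F x)) :
    LipschitzWith (Mphi Lf MF τ).toNNReal (phiO f F) := by
  have := hf.lipschitzWith_phiP hF.neg (exists_bddAbove_upperValues_neg h)
  rw [phiP_neg] at this
  simpa using this.neg

lemma RegularLowerLevel.strongConvexOn_neg_phiO (hf : RegularLowerLevel Lf Hf τ f)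
    (hF : UpperLevel MF LF F) (h : ∃ x, BddBelow (upperValues f F x)) :
    StrongConvexOn Set.univ (-rho Lf Hf MF LF τ) (-phiO f F) := by
  rw [← phiP_neg]
  exact hf.strongConvexOn_phiP hF.neg (exists_bddAbove_upperValues_neg h)

end HyperObjective

section Rates

variable {cη Cη Cε Cw Cr η ε w : ℝ} {m T : ℕ}

lemma natCast_rpow_neg_half (k : ℕ) : (k : ℝ) ^ (-(1 / 2) : ℝ) = (√(k : ℝ))⁻¹ := by
  rw [Real.rpow_neg (Nat.cast_nonneg k), ← Real.sqrt_eq_rpow]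

lemma natCast_rpow_neg_quarter (k : ℕ) : (k : ℝ) ^ (-(1 / 4) : ℝ) = √((√(k : ℝ))⁻¹) := by
  rw [← natCast_rpow_neg_half, Real.sqrt_eq_rpow, ← Real.rpow_mul (Nat.cast_nonneg k)]
  norm_num

lemma natCast_mul_rpow_sq {k : ℕ} (hk : 0 < k) :
    ((k : ℝ) * (k : ℝ) ^ (-(3 / 4) : ℝ)) ^ 2 = √(k : ℝ) := by
  have hk' : (0 : ℝ) < k := by exact_mod_cast hk
  rw [← Real.rpow_one_add' hk'.le (by norm_num), ← Real.rpow_natCast, ← Real.rpow_mul hk'.le,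
    Real.sqrt_eq_rpow]
  norm_num

lemma one_le_sqrt_natCast {k : ℕ} (hk : 0 < k) : 1 ≤ √(k : ℝ) :=
  Real.one_le_sqrt.2 (by exact_mod_cast hk)

lemma IsParameterChoice.le_step (h : IsParameterChoice cη Cη Cε Cw Cr m T η ε w) :
    cη / (√(m : ℝ) * √(T : ℝ)) ≤ η := by
  rw [div_eq_mul_inv, mul_inv, ← natCast_rpow_neg_half, ← natCast_rpow_neg_half]
  exact h.step_lower

lemma IsParameterChoice.step_le (h : IsParameterChoice cη Cη Cε Cw Cr m T η ε w) :
    η ≤ Cη / (√(m : ℝ) * √(T : ℝ)) := by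
  rw [div_eq_mul_inv, mul_inv, ← natCast_rpow_neg_half, ← natCast_rpow_neg_half]
  exact h.step_upper

lemma IsParameterChoice.radius_le (h : IsParameterChoice cη Cη Cε Cw Cr m T η ε w) :
    ε ≤ Cε / √(T : ℝ) := by
  rw [div_eq_mul_inv, ← natCast_rpow_neg_half]
  exact h.radius_upper

lemma IsParameterChoice.step_pos (h : IsParameterChoice cη Cη Cε Cw Cr m T η ε w) (hm : 0 < m)
    (hT : 0 < T) (hcη : 0 < cη) : 0 < η :=
  lt_of_lt_of_le (by positivity) h.le_step

lemma IsParameterChoice.step_const_nonneg (h : IsParameterChoice cη Cη Cε Cw Cr m T η ε w)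
    (hm : 0 < m) (hT : 0 < T) (hcη : 0 < cη) : 0 ≤ Cη := by
  have hη := (h.step_pos hm hT hcη).trans_le h.step_le
  exact (div_pos_iff_of_pos_right (by positivity)).1 hη |>.le

lemma IsParameterChoice.radius_const_nonneg (h : IsParameterChoice cη Cη Cε Cw Cr m T η ε w)
    (hT : 0 < T) : 0 ≤ Cε := by
  have hε := h.radius_pos.trans_le h.radius_le
  exact (div_pos_iff_of_pos_right (by positivity)).1 hε |>.le

lemma IsParameterChoice.inv_step_mul_le (h : IsParameterChoice cη Cη Cε Cw Cr m T η ε w)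
    (hm : 0 < m) (hT : 0 < T) (hcη : 0 < cη) : (η * T)⁻¹ ≤ √(m : ℝ) / √(T : ℝ) / cη := by
  calc (η * T)⁻¹ ≤ (cη / (√(m : ℝ) * √(T : ℝ)) * T)⁻¹ := by
        gcongr
        exact h.le_step
    _ = √(m : ℝ) / √(T : ℝ) / cη := by
        field_simp
        rw [Real.sq_sqrt (Nat.cast_nonneg T)]

lemma IsParameterChoice.step_mul_dim_le (h : IsParameterChoice cη Cη Cε Cw Cr m T η ε w)
    (hm : 0 < m) : η * m ≤ Cη * (√(m : ℝ) / √(T : ℝ)) := by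
  calc η * m ≤ Cη / (√(m : ℝ) * √(T : ℝ)) * m := by
        gcongr
        exact h.step_le
    _ = Cη * (√(m : ℝ) / √(T : ℝ)) := by
        nth_rw 2 [← Real.mul_self_sqrt (Nat.cast_nonneg m)]
        field_simp

lemma IsParameterChoice.step_le_const (h : IsParameterChoice cη Cη Cε Cw Cr m T η ε w)
    (hm : 0 < m) (hT : 0 < T) (hcη : 0 < cη) : η ≤ Cη :=
  h.step_le.trans (div_le_self (h.step_const_nonneg hm hT hcη)
    (one_le_mul_of_one_le_of_one_le (one_le_sqrt_natCast hm) (one_le_sqrt_natCast hT)))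

lemma IsParameterChoice.radius_le_rate (h : IsParameterChoice cη Cη Cε Cw Cr m T η ε w)
    (hm : 0 < m) (hT : 0 < T) : ε ≤ Cε * (√(m : ℝ) / √(T : ℝ)) := by
  rw [← mul_div_assoc]
  refine h.radius_le.trans ?_
  gcongr
  exact le_mul_of_one_le_right (h.radius_const_nonneg hT) (one_le_sqrt_natCast hm)

lemma IsParameterChoice.error_sq_le (h : IsParameterChoice cη Cη Cε Cw Cr m T η ε w)
    (hm : 0 < m) : (m * w / ε) ^ 2 ≤ Cr ^ 2 * (√(m : ℝ) / √(T : ℝ)) := by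
  have := h.radius_pos
  have := h.error_pos
  calc (m * w / ε) ^ 2
      ≤ (m * (Cr * ((m : ℝ) ^ (-(3 / 4) : ℝ) * (T : ℝ) ^ (-(1 / 4) : ℝ)))) ^ 2 := by
        rw [mul_div_assoc]
        gcongr
        exact h.error_radius
    _ = Cr ^ 2 * (m * (m : ℝ) ^ (-(3 / 4) : ℝ)) ^ 2 * ((T : ℝ) ^ (-(1 / 4) : ℝ)) ^ 2 := by ring
    _ = Cr ^ 2 * (√(m : ℝ) / √(T : ℝ)) := by
        rw [natCast_mul_rpow_sq hm, natCast_rpow_neg_quarter, Real.sq_sqrt (by positivity),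
          mul_assoc, div_eq_mul_inv]

lemma IsParameterChoice.two_mul_sqrt_le (h : IsParameterChoice cη Cη Cε Cw Cr m T η ε w) {M : ℝ}
    (hM : 0 ≤ M) (hCε : 0 ≤ Cε) :
    2 * √(M * ε) ≤ 2 * √(M * Cε) * (T : ℝ) ^ (-(1 / 4) : ℝ) := by
  rw [natCast_rpow_neg_quarter, mul_assoc, ← Real.sqrt_mul (by positivity), mul_assoc M,
    ← div_eq_mul_inv]
  gcongr
  exact h.radius_le

/-- The bound `(2/θ) (Δ/(ηT) + β + b²/(2θ) + (c/2) η (24 m M² + 2 b²))`, with `b = m w / ε`, on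
the mean squared norm of a direction field `d` along the zeroth-order method: `Δ` is the initial
gap of the Lyapunov function, `c` its curvature, and `⟨d, s⟩ ≥ θ‖d‖² - β` for the gradient `s` of
the smoothing. -/
noncomputable def descentBound (θ β c M : ℝ) (m T : ℕ) (η ε w Δ : ℝ) : ℝ :=
  2 / θ * (Δ * (η * T)⁻¹ + β + (m * w / ε) ^ 2 / (2 * θ) +
    c / 2 * (η * (24 * m * M ^ 2 + 2 * (m * w / ε) ^ 2)))

/-- The constant in front of the rate `√m (Δ + 1) / √T` when `descentBound` is evaluated with
`β = B ε` at the parameters of the theorem. -/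
noncomputable def rateConst (cη Cη Cε Cr θ B c M : ℝ) : ℝ :=
  2 / θ * (1 / cη + B * Cε + Cr ^ 2 / (2 * θ) + c / 2 * (24 * M ^ 2 * Cη + 2 * Cη * Cr ^ 2))

lemma IsParameterChoice.descentBound_le (h : IsParameterChoice cη Cη Cε Cw Cr m T η ε w)
    (hm : 0 < m) (hT : 0 < T) (hcη : 0 < cη) {θ B c Δ : ℝ} (hθ : 0 < θ) (hB : 0 ≤ B)
    (hc : 0 ≤ c) (hΔ : 0 ≤ Δ) (M : ℝ) :
    descentBound θ (B * ε) c M m T η ε w Δ ≤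
      rateConst cη Cη Cε Cr θ B c M * (√(m : ℝ) * (Δ + 1) / √(T : ℝ)) := by
  have := h.step_pos hm hT hcη
  have hCη := h.step_const_nonneg hm hT hcη
  have hCε := h.radius_const_nonneg hT
  have hgap := mul_le_mul_of_nonneg_left (h.inv_step_mul_le hm hT hcη) hΔ
  have hbias := mul_le_mul_of_nonneg_left (h.radius_le_rate hm hT) hB
  have hdim := h.step_mul_dim_le hm
  have herr := h.error_sq_le hm
  have hstep := h.step_le_const hm hT hcη
  have hq : 0 ≤ √(m : ℝ) / √(T : ℝ) := by positivity
  rw [mul_div_right_comm]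
  set q := √(m : ℝ) / √(T : ℝ)
  have hvar : η * (24 * m * M ^ 2 + 2 * (m * w / ε) ^ 2) ≤
      (24 * M ^ 2 * Cη + 2 * Cη * Cr ^ 2) * q := by
    have hη_err : η * (m * w / ε) ^ 2 ≤ Cη * (Cr ^ 2 * q) := by gcongr
    linarith [mul_le_mul_of_nonneg_left hdim (sq_nonneg M)]
  calc descentBound θ (B * ε) c M m T η ε w Δ
      ≤ 2 / θ * (Δ * (q / cη) + B * (Cε * q) + Cr ^ 2 * q / (2 * θ) +
          c / 2 * ((24 * M ^ 2 * Cη + 2 * Cη * Cr ^ 2) * q)) := by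
        unfold descentBound
        gcongr
    _ = rateConst cη Cη Cε Cr θ B c M * q - 2 / θ * (1 / cη) * q +
          2 / θ * (1 / cη) * (q * Δ) := by
        unfold rateConst
        ring
    _ ≤ rateConst cη Cη Cε Cr θ B c M * q + rateConst cη Cη Cε Cr θ B c M * (q * Δ) := by
        gcongr
        · exact sub_le_self _ (by positivity)
        · rw [rateConst, add_assoc, add_assoc, mul_add]
          exact le_add_of_nonneg_right (by positivity)
    _ = rateConst cη Cη Cε Cr θ B c M * (q * (Δ + 1)) := by ring

end Rates

lemma lintegral_ofReal_add_le {α : Type*} [MeasurableSpace α] {μ : Measure α} {g : α → ℝ}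
    (hg : Integrable g μ) (hg0 : 0 ≤ g) {D V c : ℝ} (hD : 0 ≤ D) (hV : 0 ≤ V) (hc : 0 ≤ c)
    (h : ∫ a, g a ∂μ + D ≤ V + c) :
    ∫⁻ a, ENNReal.ofReal (g a) ∂μ + ENNReal.ofReal D ≤
      ENNReal.ofReal V + ENNReal.ofReal c := by
  rw [← ofReal_integral_eq_lintegral_ofReal hg (Eventually.of_forall hg0),
    ← ENNReal.ofReal_add (integral_nonneg hg0) hD, ← ENNReal.ofReal_add hV hc]
  exact ENNReal.ofReal_le_ofReal h

section Convergence

variable {m T : ℕ} {M : ℝ≥0} {ρ η ε w : ℝ} {φ A V : Vec m → ℝ} {d : Vec m → Vec m}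
  {c θ β v Δ : ℝ} {x₀ : Vec m} {Ω : Type*} [MeasurableSpace Ω] {P : Measure Ω}
  [IsProbabilityMeasure P] {u : Fin T → Ω → Vec m} {R : Ω → Fin T}

lemma integral_comp_step_add_le (hm : 0 < m) (hφ : LipschitzWith M φ)
    (hA : IsSubroutine φ w A) (hε : 0 < ε) (hη : 0 < η) (hV : Continuous V) (hc : 0 ≤ c)
    (hθ : 0 < θ) {x d : Vec m}
    (hmodel : ∀ y, V y ≤ V x + inner ℝ d (y - x) + c / 2 * ‖y - x‖ ^ 2)
    (hdrift : θ * ‖d‖ ^ 2 - β ≤ inner ℝ d (smoothingGradient φ ε x)) :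
    ∫ u, V (x - η • estimator A ε x u) ∂(sphereUniform m) + η * θ / 2 * ‖d‖ ^ 2 ≤
      V x + η * (β + (m * w / ε) ^ 2 / (2 * θ) +
        c / 2 * (η * (24 * m * M ^ 2 + 2 * (m * w / ε) ^ 2))) := by
  have hstep := integral_comp_step_le hm hφ hA hε hV hc hη.le hmodel
  set b := m * w / ε
  have hyoung : b * ‖d‖ ≤ b ^ 2 / (2 * θ) + θ / 2 * ‖d‖ ^ 2 := by
    have : b ^ 2 / (2 * θ) + θ / 2 * ‖d‖ ^ 2 - b * ‖d‖ = (b - θ * ‖d‖) ^ 2 / (2 * θ) := by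
      field_simp
      ring
    linarith [show 0 ≤ (b - θ * ‖d‖) ^ 2 / (2 * θ) by positivity]
  linarith [mul_le_mul_of_nonneg_left hyoung hη.le, mul_le_mul_of_nonneg_left hdrift hη.le]

lemma IsSampling.lintegral_ofReal_output_le (hm : 0 < m) (hS : IsSampling P u R)
    (hA : Measurable A) {W D : Vec m → ℝ} (hW : Measurable W) (hW0 : 0 ≤ W) (hD : Measurable D)
    (hD0 : 0 ≤ D) (hc : 0 ≤ c)
    (hint : ∀ x, Integrable (fun u => W (x - η • estimator A ε x u)) (sphereUniform m))
    (hstep : ∀ x, ∫ u, W (x - η • estimator A ε x u) ∂(sphereUniform m) + D x ≤ W x + c) :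
    ∫⁻ ω, ENNReal.ofReal (D (output A η ε x₀ u R ω)) ∂P ≤
      ENNReal.ofReal ((T : ℝ)⁻¹ * W x₀ + c) := by
  obtain ⟨ω⟩ := nonempty_of_isProbabilityMeasure P
  have hT : (0 : ℝ) < T := by exact_mod_cast (R ω).pos
  calc ∫⁻ ω, ENNReal.ofReal (D (output A η ε x₀ u R ω)) ∂P
      ≤ (T : ℝ≥0∞)⁻¹ * (ENNReal.ofReal (W x₀) + T * ENNReal.ofReal c) :=
        hS.lintegral_output_le hm hA hW.ennreal_ofReal hD.ennreal_ofReal fun x =>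
          lintegral_ofReal_add_le (hint x) (fun u => hW0 (x - η • estimator A ε x u))
            (hD0 x) (hW0 x) hc (hstep x)
    _ = ENNReal.ofReal ((T : ℝ)⁻¹ * (W x₀ + T * c)) := by
        have := hW0 x₀
        rw [ENNReal.ofReal_mul (by positivity), ENNReal.ofReal_add (hW0 x₀) (by positivity),
          ENNReal.ofReal_mul hT.le, ENNReal.ofReal_inv_of_pos hT, ENNReal.ofReal_natCast]
    _ = ENNReal.ofReal ((T : ℝ)⁻¹ * W x₀ + c) := by
        rw [mul_add, inv_mul_cancel_left₀ hT.ne']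

lemma IsSampling.lintegral_output_le_of_descent (hm : 0 < m) (hφ : LipschitzWith M φ)
    (hA : IsSubroutine φ w A) (hε : 0 < ε) (hη : 0 < η) (hV : Continuous V) (hv : ∀ x, v ≤ V x)
    (hd : Measurable d) (hc : 0 ≤ c) (hθ : 0 < θ) (hβ : 0 ≤ β)
    (hmodel : ∀ x y, V y ≤ V x + inner ℝ (d x) (y - x) + c / 2 * ‖y - x‖ ^ 2)
    (hdrift : ∀ x, θ * ‖d x‖ ^ 2 - β ≤ inner ℝ (d x) (smoothingGradient φ ε x))
    (hS : IsSampling P u R) (hΔ : V x₀ - v ≤ Δ) :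
    ∫⁻ ω, ‖d (output A η ε x₀ u R ω)‖ₑ ^ 2 ∂P ≤
      ENNReal.ofReal (descentBound θ β c M m T η ε w Δ) := by
  have := isProbabilityMeasure_sphereUniform hm
  set E := β + (m * w / ε) ^ 2 / (2 * θ) +
    c / 2 * (η * (24 * m * M ^ 2 + 2 * (m * w / ε) ^ 2)) with hE
  set κ := 2 / (η * θ) with hκ
  have hκη : κ * (η * θ / 2) = 1 := by
    rw [hκ]
    field_simp
  have hint (x : Vec m) :
      Integrable (fun u => V (x - η • estimator A ε x u)) (sphereUniform m) :=
    integrable_comp_step hm hφ hA hε hV η x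
  have hstep (x : Vec m) :
      ∫ u, κ * (V (x - η • estimator A ε x u) - v) ∂(sphereUniform m) + ‖d x‖ ^ 2 ≤
        κ * (V x - v) + κ * (η * E) := by
    rw [integral_const_mul, integral_sub (hint x) (integrable_const v), integral_const,
      probReal_univ, one_smul]
    have h := mul_le_mul_of_nonneg_left
      (integral_comp_step_add_le hm hφ hA hε hη hV hc hθ (hmodel x) (hdrift x))
      (by positivity : 0 ≤ κ)
    linear_combination h - ‖d x‖ ^ 2 * hκη
  calc ∫⁻ ω, ‖d (output A η ε x₀ u R ω)‖ₑ ^ 2 ∂P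
      = ∫⁻ ω, ENNReal.ofReal (‖d (output A η ε x₀ u R ω)‖ ^ 2) ∂P := by
        simp only [ENNReal.ofReal_pow (norm_nonneg _), ofReal_norm]
    _ ≤ ENNReal.ofReal ((T : ℝ)⁻¹ * (κ * (V x₀ - v)) + κ * (η * E)) :=
        hS.lintegral_ofReal_output_le hm hA.measurable (D := fun x => ‖d x‖ ^ 2)
          ((hV.measurable.sub_const v).const_mul κ)
          (fun x => mul_nonneg (by positivity) (sub_nonneg.2 (hv x))) (by fun_prop)
          (fun x => sq_nonneg _) (by positivity)
          (fun x => ((hint x).sub (integrable_const v)).const_mul κ) hstep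
    _ ≤ ENNReal.ofReal ((T : ℝ)⁻¹ * (κ * Δ) + κ * (η * E)) := by gcongr
    _ = ENNReal.ofReal (descentBound θ β c M m T η ε w Δ) := by
        rw [descentBound, hκ, hE]
        congr 1
        field_simp
        ring

theorem lintegral_smoothingGradient_output_le (hm : 0 < m) (hφ : LipschitzWith M φ)
    (hc : StrongConvexOn Set.univ (-ρ) (-φ)) (hρ : 0 ≤ ρ) (hε : 0 < ε) (hη : 0 < η)
    (hA : IsSubroutine φ w A) (hbdd : BddBelow (Set.range φ)) (hS : IsSampling P u R) :
    ∫⁻ ω, ‖smoothingGradient φ ε (output A η ε x₀ u R ω)‖ₑ ^ 2 ∂P ≤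
      ENNReal.ofReal (descentBound 1 0 ρ M m T η ε w (φ x₀ - (⨅ x, φ x) + 2 * M * ε)) := by
  have hclose (x : Vec m) : |smoothing φ ε x - φ x| ≤ M * ε := by
    simpa only [abs_of_pos hε] using abs_smoothing_sub_le hφ ε x
  refine hS.lintegral_output_le_of_descent (V := smoothing φ ε) (v := (⨅ x, φ x) - M * ε) hm hφ hA
    hε hη (lipschitzWith_smoothing hφ ε).continuous (fun x => ?_)
    (measurable_smoothingGradient φ ε) hρ one_pos le_rfl (fun x y => ?_) (fun x => ?_) ?_
  · linarith [ciInf_le hbdd x, (abs_le.1 (hclose x)).1]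
  · have h := smoothing_add_inner_le hφ.neg hc hε.ne' x y
    rw [smoothing_neg, smoothing_neg, smoothingGradient_neg, inner_neg_left] at h
    linarith
  · rw [one_mul, sub_zero, real_inner_self_eq_norm_sq]
  · linarith [(abs_le.1 (hclose x₀)).2]

lemma infEDist_clarkeBall_sq_le (hφ : LipschitzWith M φ)
    (hc : StrongConvexOn Set.univ (-ρ) (-φ)) (hρ : 0 ≤ ρ) (hε : 0 < ε) (x : Vec m) :
    (Metric.infEDist 0 (clarkeBall φ (2 * √(M * ε)) x)) ^ 2 ≤
      2 * ‖smoothingGradient φ ε x‖ₑ ^ 2 + ENNReal.ofReal (8 * (ρ + 1) ^ 2 * (M * ε)) := by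
  obtain ⟨s, hs, hle⟩ := exists_mem_clarkeBall hφ hc hρ hε x
  calc (Metric.infEDist 0 (clarkeBall φ (2 * √(M * ε)) x)) ^ 2
      ≤ ‖s‖ₑ ^ 2 := by
        gcongr
        simpa [edist_comm] using Metric.infEDist_le_edist_of_mem (x := 0) hs
    _ = ENNReal.ofReal (‖s‖ ^ 2) := by rw [ENNReal.ofReal_pow (norm_nonneg _), ofReal_norm]
    _ ≤ ENNReal.ofReal (2 * ‖smoothingGradient φ ε x‖ ^ 2 + 8 * (ρ + 1) ^ 2 * (M * ε)) :=
        ENNReal.ofReal_le_ofReal hle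
    _ = _ := by
        rw [ENNReal.ofReal_add (by positivity) (by positivity), ENNReal.ofReal_mul zero_le_two,
          ENNReal.ofReal_pow (norm_nonneg _), ofReal_norm, ENNReal.ofReal_ofNat]

theorem lintegral_infEDist_clarkeBall_output_le (hm : 0 < m) (hφ : LipschitzWith M φ)
    (hc : StrongConvexOn Set.univ (-ρ) (-φ)) (hρ : 0 ≤ ρ) (hε : 0 < ε) (hη : 0 < η)
    (hA : IsSubroutine φ w A) (hbdd : BddBelow (Set.range φ)) (hS : IsSampling P u R) :
    ∫⁻ ω, (Metric.infEDist 0 (clarkeBall φ (2 * √(M * ε)) (output A η ε x₀ u R ω))) ^ 2 ∂P ≤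
      ENNReal.ofReal (2 * descentBound 1 (2 * (ρ + 1) ^ 2 * M * ε) ρ M m T η ε w
        (φ x₀ - (⨅ x, φ x) + 2 * M * ε)) := by
  set Δ := φ x₀ - (⨅ x, φ x) + 2 * M * ε
  have hΔ : 0 ≤ Δ := add_nonneg (sub_nonneg.2 (ciInf_le hbdd x₀)) (by positivity)
  have hbound : 0 ≤ descentBound 1 0 ρ M m T η ε w Δ := by
    unfold descentBound
    positivity
  calc ∫⁻ ω, (Metric.infEDist 0 (clarkeBall φ (2 * √(M * ε)) (output A η ε x₀ u R ω))) ^ 2 ∂P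
      ≤ ∫⁻ ω, (2 * ‖smoothingGradient φ ε (output A η ε x₀ u R ω)‖ₑ ^ 2 +
          ENNReal.ofReal (8 * (ρ + 1) ^ 2 * (M * ε))) ∂P :=
        lintegral_mono fun ω => infEDist_clarkeBall_sq_le hφ hc hρ hε _
    _ = 2 * ∫⁻ ω, ‖smoothingGradient φ ε (output A η ε x₀ u R ω)‖ₑ ^ 2 ∂P +
          ENNReal.ofReal (8 * (ρ + 1) ^ 2 * (M * ε)) := by
        rw [lintegral_add_right _ measurable_const, lintegral_const_mul' _ _ (by norm_num),
          lintegral_const, measure_univ, mul_one]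
    _ ≤ 2 * ENNReal.ofReal (descentBound 1 0 ρ M m T η ε w Δ) +
          ENNReal.ofReal (8 * (ρ + 1) ^ 2 * (M * ε)) := by
        gcongr
        exact lintegral_smoothingGradient_output_le hm hφ hc hρ hε hη hA hbdd hS
    _ = ENNReal.ofReal (2 * descentBound 1 (2 * (ρ + 1) ^ 2 * M * ε) ρ M m T η ε w Δ) := by
        rw [← ENNReal.ofReal_ofNat, ← ENNReal.ofReal_mul zero_le_two,
          ← ENNReal.ofReal_add (by positivity) (by positivity)]
        congr 1
        unfold descentBound
        ring

lemma IsProximalPoint.mul_norm_sq_sub_le_inner {γ : ℝ} {x z : Vec m}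
    (hz : IsProximalPoint γ⁻¹ φ x z) (hφ : LipschitzWith M φ)
    (hc : StrongConvexOn Set.univ (-ρ) φ) (hγ : 0 < γ) (hε : 0 < ε) :
    (1 - γ * ρ) * ‖γ⁻¹ • (x - z)‖ ^ 2 - 2 * M / γ * ε ≤
      inner ℝ (γ⁻¹ • (x - z)) (smoothingGradient φ ε x) := by
  have hprox := hz.add_sq_le hc x
  have hsmooth := add_inner_smoothingGradient_le hφ hc hε x z
  rw [sub_self, norm_zero] at hprox
  rw [← neg_sub x z, inner_neg_right, norm_neg, real_inner_comm] at hsmooth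
  rw [real_inner_smul_left, norm_smul, Real.norm_of_nonneg (inv_nonneg.2 hγ.le)]
  have h : (γ⁻¹ - ρ) * ‖x - z‖ ^ 2 - 2 * M * ε ≤ inner ℝ (x - z) (smoothingGradient φ ε x) := by
    linarith
  calc _ = γ⁻¹ * ((γ⁻¹ - ρ) * ‖x - z‖ ^ 2 - 2 * M * ε) := by field_simp
    _ ≤ _ := by gcongr

theorem lintegral_gradient_moreau_output_le {γ : ℝ} (hm : 0 < m) (hφ : LipschitzWith M φ)
    (hc : StrongConvexOn Set.univ (-ρ) φ) (hγ : 0 < γ) (hγρ : γ * ρ < 1) (hε : 0 < ε)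
    (hη : 0 < η) (hA : IsSubroutine φ w A) (hbdd : BddBelow (Set.range (moreau γ φ)))
    (hS : IsSampling P u R) :
    ∫⁻ ω, ‖∇ (moreau γ φ) (output A η ε x₀ u R ω)‖ₑ ^ 2 ∂P ≤
      ENNReal.ofReal (descentBound (1 - γ * ρ) (2 * M / γ * ε) γ⁻¹ M m T η ε w
        (moreau γ φ x₀ - ⨅ x, moreau γ φ x)) := by
  have hρ : ρ < γ⁻¹ := (lt_inv_mul_iff₀ hγ).2 hγρ |>.trans_eq (mul_one _)
  have hprox (x : Vec m) :
      ∃ z, IsProximalPoint γ⁻¹ φ x z ∧ ∇ (moreau γ φ) x = γ⁻¹ • (x - z) := by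
    obtain ⟨z, hz⟩ := exists_isProximalPoint hφ (inv_pos.2 hγ) x
    exact ⟨z, hz, (hz.hasGradientAt_moreau hφ hc hγ hρ).gradient⟩
  refine hS.lintegral_output_le_of_descent hm hφ hA hε hη
    (differentiable_moreau hφ hc hγ hρ).continuous (ciInf_le hbdd) (measurable_gradient _)
    (by positivity) (sub_pos.2 hγρ) (by positivity) (fun x y => ?_) (fun x => ?_) le_rfl
  · obtain ⟨z, hz, hgrad⟩ := hprox x
    exact hgrad ▸ hz.moreau_le_add_inner hφ hγ y
  · obtain ⟨z, hz, hgrad⟩ := hprox x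
    exact hgrad ▸ hz.mul_norm_sq_sub_le_inner hφ hc hγ hε

end Convergence

section Rate

variable {m n T : ℕ} {Lf Hf MF LF : ℝ≥0} {τ cη Cη Cε Cw Cr η ε w : ℝ} {f F : Joint m n → ℝ}
  {A : Vec m → ℝ} {x₀ : Vec m} {Ω : Type*} [MeasurableSpace Ω] {P : Measure Ω}
  [IsProbabilityMeasure P] {u : Fin T → Ω → Vec m} {R : Ω → Fin T}

theorem RegularLowerLevel.lintegral_infEDist_clarkeBall_phiO_le
    (hf : RegularLowerLevel Lf Hf τ f) (hF : UpperLevel MF LF F)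
    (h : ∃ x, BddBelow (upperValues f F x)) (hbdd : BddBelow (Set.range (phiO f F)))
    (hpar : IsParameterChoice cη Cη Cε Cw Cr m T η ε w) (hcη : 0 < cη) (hm : 0 < m)
    (hT : 0 < T) (hA : IsSubroutine (phiO f F) w A) (hS : IsSampling P u R) :
    ∫⁻ ω, (Metric.infEDist 0
        (clarkeBall (phiO f F) (2 * √(Mphi Lf MF τ * ε)) (output A η ε x₀ u R ω))) ^ 2 ∂P ≤
      ENNReal.ofReal (2 * rateConst cη Cη Cε Cr 1
        (2 * (rho Lf Hf MF LF τ + 1) ^ 2 * Mphi Lf MF τ) (rho Lf Hf MF LF τ) (Mphi Lf MF τ) *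
        (√(m : ℝ) * ((phiO f F x₀ - ⨅ x, phiO f F x) + 2 * Mphi Lf MF τ * ε + 1) /
          √(T : ℝ))) := by
  have hM : 0 ≤ Mphi Lf MF τ := hf.Mphi_nonneg
  have hε := hpar.radius_pos
  have hρ : 0 ≤ rho Lf Hf MF LF τ := rho_nonneg
  have hgap : 0 ≤ (phiO f F x₀ - ⨅ x, phiO f F x) + 2 * Mphi Lf MF τ * ε :=
    add_nonneg (sub_nonneg.2 (ciInf_le hbdd x₀)) (by positivity)
  have hrate := lintegral_infEDist_clarkeBall_output_le (x₀ := x₀) hm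
    (hf.lipschitzWith_phiO hF.lipschitz h) (hf.strongConvexOn_neg_phiO hF h) hρ hε
    (hpar.step_pos hm hT hcη) hA hbdd hS
  rw [Real.coe_toNNReal _ hM] at hrate
  refine hrate.trans (ENNReal.ofReal_le_ofReal ?_)
  rw [mul_assoc 2 (rateConst ..)]
  exact mul_le_mul_of_nonneg_left
    (hpar.descentBound_le hm hT hcη one_pos (by positivity) hρ hgap _) zero_le_two

theorem RegularLowerLevel.lintegral_gradient_moreau_phiP_le {γ : ℝ}
    (hf : RegularLowerLevel Lf Hf τ f) (hF : UpperLevel MF LF F)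
    (h : ∃ x, BddAbove (upperValues f F x)) (hγ : 0 < γ) (hγρ : γ * rho Lf Hf MF LF τ < 1)
    (hbdd : BddBelow (Set.range (moreau γ (phiP f F))))
    (hpar : IsParameterChoice cη Cη Cε Cw Cr m T η ε w) (hcη : 0 < cη) (hm : 0 < m)
    (hT : 0 < T) (hA : IsSubroutine (phiP f F) w A) (hS : IsSampling P u R) :
    ∫⁻ ω, ‖∇ (moreau γ (phiP f F)) (output A η ε x₀ u R ω)‖ₑ ^ 2 ∂P ≤
      ENNReal.ofReal (rateConst cη Cη Cε Cr (1 - γ * rho Lf Hf MF LF τ)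
        (2 * Mphi Lf MF τ / γ) γ⁻¹ (Mphi Lf MF τ) *
        (√(m : ℝ) * ((moreau γ (phiP f F) x₀ - ⨅ x, moreau γ (phiP f F) x) + 1) /
          √(T : ℝ))) := by
  have hM : 0 ≤ Mphi Lf MF τ := hf.Mphi_nonneg
  have hgap : 0 ≤ moreau γ (phiP f F) x₀ - ⨅ x, moreau γ (phiP f F) x :=
    sub_nonneg.2 (ciInf_le hbdd x₀)
  have hrate := lintegral_gradient_moreau_output_le (x₀ := x₀) hm
    (hf.lipschitzWith_phiP hF.lipschitz h) (hf.strongConvexOn_phiP hF h) hγ hγρ hpar.radius_pos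
    (hpar.step_pos hm hT hcη) hA hbdd hS
  rw [Real.coe_toNNReal _ hM] at hrate
  exact hrate.trans (ENNReal.ofReal_le_ofReal
    (hpar.descentBound_le hm hT hcη (sub_pos.2 hγρ) (by positivity) (by positivity) hgap _))

end Rate

lemma RegularLowerLevel.differentiable_moreau_phiP {m n : ℕ} {Lf Hf MF LF : ℝ≥0} {τ γ : ℝ}
    {f F : Joint m n → ℝ} (hf : RegularLowerLevel Lf Hf τ f) (hF : UpperLevel MF LF F)
    (h : ∃ x, BddAbove (upperValues f F x)) (hγ : 0 < γ)
    (hγρ : γ * rho Lf Hf MF LF τ < 1) : Differentiable ℝ (moreau γ (phiP f F)) :=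
  differentiable_moreau (hf.lipschitzWith_phiP hF.lipschitz h) (hf.strongConvexOn_phiP hF h) hγ
    (lt_inv_mul_iff₀ hγ |>.2 hγρ |>.trans_eq (mul_one _))

lemma mul_rho_lt_one {Lf Hf MF LF : ℝ≥0} {τ γ : ℝ} (hγ : 0 < γ)
    (h : γ < 1 / (rho Lf Hf MF LF τ + 1)) : γ * rho Lf Hf MF LF τ < 1 := by
  have hρ : 0 ≤ rho Lf Hf MF LF τ := rho_nonneg
  linarith [(lt_div_iff₀ (by positivity)).1 h]

end Bilevel

theorem theorem4p1_general (Lf Hf MF LF : ℝ≥0) (τ cη Cη Cε Cw Cr : ℝ) (hcη : 0 < cη) :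
    (∃ K C : ℝ, ∀ (m n T : ℕ), 0 < m → 0 < T →
      ∀ f F : Bilevel.Joint m n → ℝ,
      Bilevel.RegularLowerLevel Lf Hf τ f → Bilevel.UpperLevel MF LF F →
      (∃ x, BddBelow (Bilevel.upperValues f F x)) →
      BddBelow (Set.range (Bilevel.phiO f F)) →
      ∀ η ε w : ℝ, Bilevel.IsParameterChoice cη Cη Cε Cw Cr m T η ε w →
      ∃ δ : ℝ, 0 ≤ δ ∧ δ ≤ K * (T : ℝ) ^ (-(1 / 4) : ℝ) ∧
      ∀ A : Bilevel.Vec m → ℝ, Bilevel.IsSubroutine (Bilevel.phiO f F) w A →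
      ∀ (x₀ : Bilevel.Vec m) (Ω : Type*) [MeasurableSpace Ω] (P : Measure Ω)
        [IsProbabilityMeasure P] (u : Fin T → Ω → Bilevel.Vec m) (R : Ω → Fin T),
      Bilevel.IsSampling P u R →
      ∫⁻ ω, (Metric.infEDist 0
          (Bilevel.clarkeBall (Bilevel.phiO f F) δ (Bilevel.output A η ε x₀ u R ω))) ^ 2 ∂P
        ≤ ENNReal.ofReal (C * (√(m : ℝ) *
          ((Bilevel.phiO f F x₀ - ⨅ x, Bilevel.phiO f F x) + 2 * Bilevel.Mphi Lf MF τ * ε + 1)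
            / √(T : ℝ)))) ∧
    (∀ γ : ℝ, 0 < γ → γ * Bilevel.rho Lf Hf MF LF τ < 1 →
      ∃ C : ℝ, ∀ (m n T : ℕ), 0 < m → 0 < T →
      ∀ f F : Bilevel.Joint m n → ℝ,
      Bilevel.RegularLowerLevel Lf Hf τ f → Bilevel.UpperLevel MF LF F →
      (∃ x, BddAbove (Bilevel.upperValues f F x)) →
      Differentiable ℝ (Bilevel.moreau γ (Bilevel.phiP f F)) ∧
      (BddBelow (Set.range (Bilevel.moreau γ (Bilevel.phiP f F))) →
      ∀ η ε w : ℝ, Bilevel.IsParameterChoice cη Cη Cε Cw Cr m T η ε w →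
      ∀ A : Bilevel.Vec m → ℝ, Bilevel.IsSubroutine (Bilevel.phiP f F) w A →
      ∀ (x₀ : Bilevel.Vec m) (Ω : Type*) [MeasurableSpace Ω] (P : Measure Ω)
        [IsProbabilityMeasure P] (u : Fin T → Ω → Bilevel.Vec m) (R : Ω → Fin T),
      Bilevel.IsSampling P u R →
      ∫⁻ ω, ‖∇ (Bilevel.moreau γ (Bilevel.phiP f F))
          (Bilevel.output A η ε x₀ u R ω)‖ₑ ^ 2 ∂P
        ≤ ENNReal.ofReal (C * (√(m : ℝ) *
          ((Bilevel.moreau γ (Bilevel.phiP f F) x₀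
            - ⨅ x, Bilevel.moreau γ (Bilevel.phiP f F) x) + 1)
            / √(T : ℝ))))) := by
  refine ⟨⟨2 * √(Bilevel.Mphi Lf MF τ * Cε), _, fun m n T hm hT f F hf hF h hbdd η ε w hpar =>
    ⟨2 * √(Bilevel.Mphi Lf MF τ * ε), by positivity,
      hpar.two_mul_sqrt_le hf.Mphi_nonneg (hpar.radius_const_nonneg hT),
      fun A hA x₀ Ω _ P _ u R hS =>
        hf.lintegral_infEDist_clarkeBall_phiO_le hF h hbdd hpar hcη hm hT hA hS⟩⟩,
    fun γ hγ hγρ => ⟨_, fun m n T hm hT f F hf hF h =>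
      ⟨hf.differentiable_moreau_phiP hF h hγ hγρ,
        fun hbdd η ε w hpar A hA x₀ Ω _ P _ u R hS =>
          hf.lintegral_gradient_moreau_phiP_le hF h hγ hγρ hbdd hpar hcη hm hT hA hS⟩⟩⟩

theorem theorem4p1 (Lf Hf MF LF : ℝ≥0) (τ cη Cη Cε Cw Cr : ℝ) (hcη : 0 < cη) :
    -- optimistic case
    (∃ K C : ℝ, ∀ (m n T : ℕ), 0 < m → 0 < T →
      ∀ f F : Bilevel.Joint m n → ℝ,
      Bilevel.LowerLevel Lf Hf τ f → Bilevel.UpperLevel MF LF F →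
      (∃ x, BddBelow (Bilevel.upperValues f F x)) →
      BddBelow (Set.range (Bilevel.phiO f F)) →
      ∀ η ε w : ℝ, Bilevel.IsParameterChoice cη Cη Cε Cw Cr m T η ε w →
      ∃ δ : ℝ, 0 ≤ δ ∧ δ ≤ K * (T : ℝ) ^ (-(1 / 4) : ℝ) ∧
      ∀ A : Bilevel.Vec m → ℝ, Bilevel.IsSubroutine (Bilevel.phiO f F) w A →
      ∀ (x₀ : Bilevel.Vec m) (Ω : Type*) [MeasurableSpace Ω] (P : Measure Ω)
        [IsProbabilityMeasure P] (u : Fin T → Ω → Bilevel.Vec m) (R : Ω → Fin T),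
      Bilevel.IsSampling P u R →
      ∫⁻ ω, (Metric.infEDist 0
          (Bilevel.clarkeBall (Bilevel.phiO f F) δ (Bilevel.output A η ε x₀ u R ω))) ^ 2 ∂P
        ≤ ENNReal.ofReal (C * (√(m : ℝ) *
          ((Bilevel.phiO f F x₀ - ⨅ x, Bilevel.phiO f F x) + 2 * Bilevel.Mphi Lf MF τ * ε + 1)
            / √(T : ℝ)))) ∧
    -- pessimistic case
    (∀ γ : ℝ, 0 < γ → γ < 1 / (Bilevel.rho Lf Hf MF LF τ + 1) →
      ∃ C : ℝ, ∀ (m n T : ℕ), 0 < m → 0 < T →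
      ∀ f F : Bilevel.Joint m n → ℝ,
      Bilevel.LowerLevel Lf Hf τ f → Bilevel.UpperLevel MF LF F →
      (∃ x, BddAbove (Bilevel.upperValues f F x)) →
      Differentiable ℝ (Bilevel.moreau γ (Bilevel.phiP f F)) ∧
      (BddBelow (Set.range (Bilevel.moreau γ (Bilevel.phiP f F))) →
      ∀ η ε w : ℝ, Bilevel.IsParameterChoice cη Cη Cε Cw Cr m T η ε w →
      ∀ A : Bilevel.Vec m → ℝ, Bilevel.IsSubroutine (Bilevel.phiP f F) w A →
      ∀ (x₀ : Bilevel.Vec m) (Ω : Type*) [MeasurableSpace Ω] (P : Measure Ω)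
        [IsProbabilityMeasure P] (u : Fin T → Ω → Bilevel.Vec m) (R : Ω → Fin T),
      Bilevel.IsSampling P u R →
      ∫⁻ ω, ‖∇ (Bilevel.moreau γ (Bilevel.phiP f F))
          (Bilevel.output A η ε x₀ u R ω)‖ₑ ^ 2 ∂P
        ≤ ENNReal.ofReal (C * (√(m : ℝ) *
          ((Bilevel.moreau γ (Bilevel.phiP f F) x₀
            - ⨅ x, Bilevel.moreau γ (Bilevel.phiP f F) x) + 1)
            / √(T : ℝ))))) := by
  obtain ⟨⟨K, C, hO⟩, hP⟩ := theorem4p1_general Lf Hf MF LF τ cη Cη Cε Cw Cr hcη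
  refine ⟨⟨K, C, fun m n T hm hT f F hf => hO m n T hm hT f F hf.regular⟩, fun γ hγ hγρ => ?_⟩
  obtain ⟨C, hC⟩ := hP γ hγ (Bilevel.mul_rho_lt_one hγ hγρ)
  exact ⟨C, fun m n T hm hT f F hf => hC m n T hm hT f F hf.regular⟩
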